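/- Let $K$ be a commutative ring with $1$; "f.g.p." means finitely generated projective. **Structures.** A *triple* is $(M^-,M^+,g)$ where $M^\pm$ are f.g.p. $K$-modules of rank $6$ and $g:M^-\times M^+\to K$ is a nonsingular bilinear form; a *quadruple* $(M^-,M^+,g,e)$ has in addition $e=(e^-,e^+)\in M^-\times M^+$ with $g(e^-,e^+)=1$, and one puts $U^\sigma=(e^{-\sigma})^\perp\subseteq M^\sigma$ ($\sigma=\pm$). Endomorphisms $A$ of $M^\sigma$ act on $\bigwedge(M^\sigma)$ as derivations $x\mapsto A\circ x$. The algebra $\bigwedge(M^{-\sigma})$ acts on $\bigwedge(M^{\sigma})$, $(a,x)\mapsto a\cdot x$, by the algebra homomorphism into $\mathrm{End}(\bigwedge(M^\sigma))$ under which $m\in M^{-\sigma}$ acts as the anti-derivation extending $g(m,\cdot)$ (resp. $g(\cdot,m)$). For $x\in\bigwedge^3(M^\sigma)$, $y\in\bigwedge^3(M^{-\sigma})$ let $E^\sigma(x,y)\in\mathrm{End}(M^\sigma)$, $E^\sigma(x,y)(v)=(v\cdot y)\cdot x$. * $\Lambda_3(M^-,M^+,g)$ is the pair of modules $(\bigwedge^3(M^-),\bigwedge^3(M^+))$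 with the products $\{x,y,z\}^\sigma=E^\sigma(x,y)\circ z-(x\cdot y)z$ for $x,z\in\bigwedge^3(M^\sigma)$, $y\in\bigwedge^3(M^{-\sigma})$. If $\frac16\in K$, a quadruple gives it the SP-grading (short Peirce grading) $(\Lambda_3)_0^\sigma=\bigwedge^3(U^\sigma)$, $(\Lambda_3)_1^\sigma=\bigwedge^2(U^\sigma)e^\sigma$. * The *reflection* $P^\vee$ of an SP-graded pair $P=P_0\oplus P_1$ has $(P^\vee)^\sigma_0=P_0^{-\sigma}$, $(P^\vee)^\sigma_1=P_1^{\sigma}$ and, for $a_0,b_1,c_0\in P^{-\sigma}$ and $a_1,b_0,c_1\in P^{\sigma}$ (the lower index is the degree), $$\{a_0+a_1,\,b_0+b_1,\,c_0+c_1\}^\vee=\{a_0,b_0,c_0\}-\{b_1,a_1,c_0\}+K(a_0,b_1)c_1+\{a_1,b_1,c_1\}-\{b_0,a_0,c_1\}+K(a_1,b_0)c_0,$$ where $K(x,z)y=\{x,y,z\}-\{z,y,x\}$. * $\mathcal E(M^-,M^+,g)=\bigwedge^6(M^-)\oplus\bigwedge^3(M^-)\oplus\mathcal E_0\oplus\bigwedge^3(M^+)\oplus\bigwedge^6(M^+)$,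 with degrees $-2,\dots,2$, is the 5-graded Lie algebra in which $\mathcal E_0$ consists of the $(A^-,A^+)+ah_0$ with $a\in K$, $A^\sigma\in\mathrm{End}(M^\sigma)$, $g(A^-m,n)+g(m,A^+n)=0$ for all $m,n$, and $\mathrm{tr}(A^+)+3a=0$. Its bracket is bilinear and skew-symmetric; $\mathcal E_0$ carries the commutator, with $h_0$ central, and $[(A^-,A^+)+ah_0,p]=A^\sigma\circ p+\sigma kap$ for $p\in\bigwedge^{3k}(M^\sigma)$, $k=1,2$; moreover, with $p_i,q_i\in\mathcal E_i$, $[p_{-1},q_1]=(E^-(p_{-1},q_1),-E^+(q_1,p_{-1}))+(p_{-1}\cdot q_1)h_0$, $[p_{-2},q_2]=(p_{-2}\cdot q_2)\big((\mathrm{id},-\mathrm{id})+2h_0\big)$, $[p_i,q_i]=p_iq_i$ and $[p_i,q_{-2i}]=p_i\cdot q_{-2i}$ for $i=\pm1$, and brackets of degrees whose sum lies outside $\{-2,\dots,2\}$ are $0$. * A quadruple makes $\mathcal E$ a $BC_2$-graded ($\mathbb Z^2$-graded) Lie algebra: $\mathcal E_{\sigma1,0}=\bigwedge^3(U^\sigma)$,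 $\mathcal E_{\sigma1,\sigma1}=\bigwedge^2(U^\sigma)e^\sigma$, $\mathcal E_{\sigma2,\sigma1}=\bigwedge^6(M^\sigma)$; $\mathcal E_{0,0}$ is the set of $(A^-,A^+)+ah_0\in\mathcal E_0$ with $A^+$ stabilizing $Ke^+$ and $U^+$; $\mathcal E_{0,1}$ (resp. $\mathcal E_{0,-1}$) is the set of $(A^-,A^+)\in\mathcal E_0$ with $A^+\in\mathrm{Hom}(U^+,Ke^+)$ (resp. $A^+\in\mathrm{Hom}(Ke^+,U^+)$), these being regarded as subsets of $\mathrm{End}(M^+)$ by means of $M^+=Ke^+\oplus U^+$; all other components are $0$. Isomorphisms of pairs are pairs of linear bijections preserving both products, and isomorphisms of Lie algebras are linear bijections preserving brackets; graded isomorphisms also map each homogeneous component onto the corresponding one. For an f.g.p. $K$-module $I$ of rank $1$ put $M_I=K^5\oplus I$, and take the quadruple $(M_I^*,M_I,\mathrm{can},e_I)$, where $e_I^+$ is the first standard vector of $K^5$ and $e_I^-$ is the first coordinate of $K^5$, extended by $0$ on $I$. Let $\Lambda_{3,I}$ be the corresponding SP-graded pair. **Theorem.** (A) Suppose $\frac16\in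 K$, and let $I,I'$ be f.g.p. $K$-modules of rank $1$. The following are equivalent: $(\Lambda_{3,I})^\vee\simeq(\Lambda_{3,I'})^\vee$ as ungraded pairs; $(\Lambda_{3,I})^\vee\simeq(\Lambda_{3,I'})^\vee$ as SP-graded pairs; $\Lambda_{3,I}\simeq\Lambda_{3,I'}$ as SP-graded pairs; $\Lambda_{3,I}\simeq\Lambda_{3,I'}$ as ungraded pairs; $I\simeq I'$ as $K$-modules. (B) Suppose that $K$ is a Dedekind domain. Sending the class of $I$ to the class of the structure built from $(M_I^*,M_I,\mathrm{can},e_I)$ (or from $(M_I^*,M_I,\mathrm{can})$) is a bijection from $\mathrm{Pic}(K)$, the group of isomorphism classes of f.g.p. modules of rank $1$, onto each of the following sets: (i) the graded isomorphism classes of the 5-graded Lie algebras $\mathcal E$ of triples; (ii) the graded isomorphism classes of the $BC_2$-graded Lie algebras $\mathcal E$ of quadruples; and, if $\frac16\in K$, (iii) the isomorphism classes of the ungraded pairs $\Lambda_3$ of triples; (iv) the graded isomorphism classes of the SP-graded pairs $\Lambda_3$ of quadruples; (v) the graded isomorphism classes of the SP-graded pairs $\Lambda_3^\vee$ of quadruples;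 (vi) the isomorphism classes of the ungraded pairs $\Lambda_3^\vee$ of quadruples. -/

import Mathlib

open scoped TensorProduct

universe u v w v' w' v'' w''

set_option linter.unusedSectionVars false
set_option linter.checkUnivs false

noncomputable section

namespace ExtPair

variable {K : Type u} [CommRing K]

section Machinery

variable {M : Type v} {N : Type w} [AddCommGroup M] [AddCommGroup N] [Module K M] [Module K N]

theorem mem_zero_iff {x : ExteriorAlgebra K M} :
    x ∈ ⋀[K]^0 M ↔ ∃ r, algebraMap K (ExteriorAlgebra K M) r = x := by
  unfold ExteriorAlgebra.exteriorPower
  rw [pow_zero, Submodule.mem_one]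

theorem mem_one_iff {x : ExteriorAlgebra K M} :
    x ∈ ⋀[K]^1 M ↔ ∃ m, ExteriorAlgebra.ι K m = x := by
  unfold ExteriorAlgebra.exteriorPower
  rw [pow_one]; rfl

theorem power_succ (n : ℕ) :
    ⋀[K]^(n + 1) M = LinearMap.range (ExteriorAlgebra.ι K : M →ₗ[K] _) * ⋀[K]^n M :=
  pow_succ' _ _

theorem ι_mul_mem {n : ℕ} (m : M) {y : ExteriorAlgebra K M} (hy : y ∈ ⋀[K]^n M) :
    ExteriorAlgebra.ι K m * y ∈ ⋀[K]^(n + 1) M := by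
  rw [power_succ]
  exact Submodule.mul_mem_mul ⟨_, rfl⟩ hy

@[elab_as_elim]
theorem power_ind {n : ℕ} {P : (x : ExteriorAlgebra K M) → x ∈ ⋀[K]^(n + 1) M → Prop}
    (hm : ∀ m y (hy : y ∈ ⋀[K]^n M), P (ExteriorAlgebra.ι K m * y) (ι_mul_mem m hy))
    (ha : ∀ x y hx hy, P x hx → P y hy → P (x + y) (add_mem hx hy))
    {x : ExteriorAlgebra K M} (hx : x ∈ ⋀[K]^(n + 1) M) : P x hx := by
  suffices h : ∃ hx, P x hx from h.2
  have hx' := hx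
  rw [power_succ] at hx'
  induction hx' using Submodule.mul_induction_on' with
  | mem_mul_mem a ha' b hb =>
    obtain ⟨m, rfl⟩ := ha'
    exact ⟨_, hm m b hb⟩
  | add a h1 b h2 ha' hb =>
    rw [← power_succ] at h1 h2
    exact ⟨_, ha a b h1 h2 (ha' h1).2 (hb h2).2⟩

theorem mul_mem {k n : ℕ} {x y : ExteriorAlgebra K M} (hx : x ∈ ⋀[K]^k M) (hy : y ∈ ⋀[K]^n M) :
    x * y ∈ ⋀[K]^(k + n) M := by
  unfold ExteriorAlgebra.exteriorPower at *
  rw [pow_add]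
  exact Submodule.mul_mem_mul hx hy

/-- One step of the recursion `D(m x) = A(m) x + m D(x)`. -/
def derAux (A : Module.End K M) :
    M →ₗ[K] ExteriorAlgebra K M × ExteriorAlgebra K M →ₗ[K] ExteriorAlgebra K M :=
  let L := (Algebra.lmul K (ExteriorAlgebra K M)).toLinearMap ∘ₗ ExteriorAlgebra.ι K
  (L ∘ₗ A).compl₂ (LinearMap.fst K _ _) + L.compl₂ (LinearMap.snd K _ _)

theorem derAux_apply (A : Module.End K M) (m : M) (p : ExteriorAlgebra K M × ExteriorAlgebra K M) :
    derAux A m p = ExteriorAlgebra.ι K (A m) * p.1 + ExteriorAlgebra.ι K m * p.2 := rfl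

theorem derAux_derAux (A : Module.End K M) (m : M) (x fx : ExteriorAlgebra K M) :
    derAux A m (CliffordAlgebra.ι 0 m * x, derAux A m (x, fx)) =
      (0 : QuadraticForm K M) m • fx := by
  simp only [derAux_apply, mul_add, ← mul_assoc]
  rw [ExteriorAlgebra.ι_sq_zero, zero_mul, add_zero, ← add_mul, ExteriorAlgebra.ι_add_mul_swap]
  simp

/-- The derivation of the exterior algebra extending the endomorphism `A`. -/
def derFun (A : Module.End K M) : Module.End K (ExteriorAlgebra K M) :=
  CliffordAlgebra.foldr' 0 (derAux A) (derAux_derAux A) 0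

theorem derFun_ι_mul (A : Module.End K M) (m : M) (x : ExteriorAlgebra K M) :
    derFun A (ExteriorAlgebra.ι K m * x) =
      ExteriorAlgebra.ι K (A m) * x + ExteriorAlgebra.ι K m * derFun A x :=
  CliffordAlgebra.foldr'_ι_mul _ _ _ _ _ _

theorem derFun_algebraMap (A : Module.End K M) (r : K) :
    derFun A (algebraMap K _ r) = 0 :=
  (CliffordAlgebra.foldr'_algebraMap (0 : QuadraticForm K M)
    (derAux A) (derAux_derAux A) 0 r).trans (smul_zero r)

@[elab_as_elim]
theorem leftInd {P : ExteriorAlgebra K M → Prop} (h0 : ∀ r, P (algebraMap K _ r))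
    (ha : ∀ x y, P x → P y → P (x + y))
    (hm : ∀ m x, P x → P (ExteriorAlgebra.ι K m * x)) (x : ExteriorAlgebra K M) : P x :=
  CliffordAlgebra.left_induction 0 h0 ha (fun x m h => hm m x h) x

/-- The action `A ∘ x`: the unique derivation of the exterior algebra extending the
endomorphism `A` of `M`, as a linear function of `A`. -/
def der : Module.End K M →ₗ[K] Module.End K (ExteriorAlgebra K M) where
  toFun := derFun
  map_add' A B := LinearMap.ext fun x => by
    induction x using leftInd with
    | h0 r => simp [derFun_algebraMap]
    | ha x y hx hy => simp only [map_add, hx, hy]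
    | hm m x hx =>
      simp only [derFun_ι_mul, hx, LinearMap.add_apply, map_add, add_mul, mul_add]
      abel
  map_smul' c A := LinearMap.ext fun x => by
    induction x using leftInd with
    | h0 r => simp [derFun_algebraMap]
    | ha x y hx hy => simp only [map_add, hx, hy]
    | hm m x hx =>
      simp only [derFun_ι_mul, hx, LinearMap.smul_apply, map_smul, smul_mul_assoc, smul_add,
        mul_smul_comm, RingHom.id_apply]

theorem der_ι_mul (A : Module.End K M) (m : M) (x : ExteriorAlgebra K M) :
    der A (ExteriorAlgebra.ι K m * x) =
      ExteriorAlgebra.ι K (A m) * x + ExteriorAlgebra.ι K m * der A x :=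
  derFun_ι_mul A m x

theorem der_algebraMap (A : Module.End K M) (r : K) :
    der A (algebraMap K (ExteriorAlgebra K M) r) = 0 := derFun_algebraMap A r

theorem der_mul (A : Module.End K M) (x y : ExteriorAlgebra K M) :
    der A (x * y) = der A x * y + x * der A y := by
  induction x using leftInd with
  | h0 r => simp [der_algebraMap, ← Algebra.smul_def]
  | ha x z hx hz => simp only [map_add, add_mul, hx, hz]; abel
  | hm m x hx => simp only [mul_assoc, der_ι_mul, hx, mul_add, add_mul, add_assoc]

theorem der_ι (A : Module.End K M) (m : M) :
    der A (ExteriorAlgebra.ι K m) = ExteriorAlgebra.ι K (A m) := by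
  have := der_ι_mul A m 1
  rwa [← map_one (algebraMap K (ExteriorAlgebra K M)), der_algebraMap, map_one, mul_one, mul_one,
    mul_zero, add_zero] at this

theorem der_comm (A B : Module.End K M) (x : ExteriorAlgebra K M) :
    der (A * B - B * A) x = der A (der B x) - der B (der A x) := by
  induction x using leftInd with
  | h0 r => simp only [der_algebraMap, map_zero, sub_zero]
  | ha x z hx hz => simp only [map_add, hx, hz]; abel
  | hm m x hx =>
    rw [der_ι_mul, hx]
    simp only [der_ι_mul, map_add, LinearMap.sub_apply, Module.End.mul_apply, map_sub, mul_sub,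
      sub_mul]
    abel

theorem der_mem (A : Module.End K M) (n : ℕ) {x : ExteriorAlgebra K M} (hx : x ∈ ⋀[K]^n M) :
    der A x ∈ ⋀[K]^n M := by
  induction n generalizing x with
  | zero =>
    obtain ⟨r, rfl⟩ := mem_zero_iff.1 hx
    rw [der_algebraMap]; exact zero_mem _
  | succ n ih =>
    induction hx using power_ind with
    | hm m y hy =>
      rw [der_ι_mul]
      exact add_mem (ι_mul_mem _ hy) (ι_mul_mem _ (ih hy))
    | ha a b _ _ ha hb => rw [map_add]; exact add_mem ha hb

/-- The action `a · x` of `⋀(M)` on `⋀(N)` determined by the pairing `g`: the homomorphism of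
`⋀(M)` into `End(⋀(N))` under which `m : M` acts as the anti-derivation extending `g m`. -/
def contr (g : M →ₗ[K] N →ₗ[K] K) :
    ExteriorAlgebra K M →ₐ[K] Module.End K (ExteriorAlgebra K N) :=
  ExteriorAlgebra.lift K ⟨CliffordAlgebra.contractLeft ∘ₗ g, fun m =>
    LinearMap.ext fun x => CliffordAlgebra.contractLeft_contractLeft (g m) x⟩

variable (g : M →ₗ[K] N →ₗ[K] K)

theorem contr_ι (m : M) (x : ExteriorAlgebra K N) :
    contr g (ExteriorAlgebra.ι K m) x = CliffordAlgebra.contractLeft (g m) x := by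
  simp [contr]

theorem contr_ι_ι_mul (m : M) (n : N) (x : ExteriorAlgebra K N) :
    contr g (ExteriorAlgebra.ι K m) (ExteriorAlgebra.ι K n * x) =
      g m n • x - ExteriorAlgebra.ι K n * contr g (ExteriorAlgebra.ι K m) x := by
  rw [contr_ι, contr_ι, CliffordAlgebra.contractLeft_ι_mul]

theorem contr_ι_algebraMap (m : M) (r : K) :
    contr g (ExteriorAlgebra.ι K m) (algebraMap K _ r) = 0 := by
  rw [contr_ι, CliffordAlgebra.contractLeft_algebraMap]

theorem contr_ι_mul (m : M) (a : ExteriorAlgebra K M) (x : ExteriorAlgebra K N) :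
    contr g (ExteriorAlgebra.ι K m * a) x = contr g (ExteriorAlgebra.ι K m) (contr g a x) := by
  rw [map_mul]; rfl

theorem contr_algebraMap (r : K) (x : ExteriorAlgebra K N) :
    contr g (algebraMap K _ r) x = r • x := by
  rw [AlgHom.commutes]; rfl

theorem contr_ι_mem (m : M) (n : ℕ) {x : ExteriorAlgebra K N} (hx : x ∈ ⋀[K]^(n + 1) N) :
    contr g (ExteriorAlgebra.ι K m) x ∈ ⋀[K]^n N := by
  induction n generalizing x with
  | zero =>
    obtain ⟨y, rfl⟩ := mem_one_iff.1 hx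
    rw [contr_ι, CliffordAlgebra.contractLeft_ι]
    exact mem_zero_iff.2 ⟨_, rfl⟩
  | succ n ih =>
    induction hx using power_ind with
    | hm n y hy =>
      rw [contr_ι_ι_mul]
      exact sub_mem (Submodule.smul_mem _ _ hy) (ι_mul_mem _ (ih hy))
    | ha a b _ _ ha hb => rw [map_add]; exact add_mem ha hb

theorem contr_mem (k n : ℕ) {a : ExteriorAlgebra K M} (ha : a ∈ ⋀[K]^k M)
    {x : ExteriorAlgebra K N} (hx : x ∈ ⋀[K]^(n + k) N) : contr g a x ∈ ⋀[K]^n N := by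
  induction k generalizing a n with
  | zero =>
    obtain ⟨r, rfl⟩ := mem_zero_iff.1 ha
    rw [contr_algebraMap]; exact Submodule.smul_mem _ _ hx
  | succ k ih =>
    induction ha using power_ind with
    | hm m y hy =>
      rw [contr_ι_mul]
      exact contr_ι_mem g m n (ih (n + 1) hy (by convert hx using 2; ring))
    | ha a b _ _ ha hb => rw [map_add, LinearMap.add_apply]; exact add_mem ha hb

theorem contr_eq_zero (k : ℕ) {a : ExteriorAlgebra K M} (ha : a ∈ ⋀[K]^(k + 1) M)
    {x : ExteriorAlgebra K N} (hx : x ∈ ⋀[K]^k N) : contr g a x = 0 := by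
  induction ha using power_ind with
  | hm m y hy =>
    obtain ⟨r, hr⟩ := mem_zero_iff.1 (contr_mem g k 0 hy (by rwa [zero_add]))
    rw [contr_ι_mul, ← hr, contr_ι_algebraMap]
  | ha a b _ _ ha hb => rw [map_add, LinearMap.add_apply, ha, hb, add_zero]

/-- The value of `a · x` in `K`, for `a` and `x` of the same degree. -/
def dot : ExteriorAlgebra K M →ₗ[K] ExteriorAlgebra K N →ₗ[K] K :=
  LinearMap.compr₂ (contr g).toLinearMap ExteriorAlgebra.algebraMapInv.toLinearMap

theorem dot_apply (a : ExteriorAlgebra K M) (x : ExteriorAlgebra K N) :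
    dot g a x = ExteriorAlgebra.algebraMapInv (contr g a x) := rfl

theorem algebraMap_dot (k : ℕ) {a : ExteriorAlgebra K M} (ha : a ∈ ⋀[K]^k M)
    {x : ExteriorAlgebra K N} (hx : x ∈ ⋀[K]^k N) :
    algebraMap K (ExteriorAlgebra K N) (dot g a x) = contr g a x := by
  obtain ⟨r, hr⟩ := mem_zero_iff.1 (contr_mem g k 0 ha (by rwa [zero_add]))
  rw [dot_apply, ← hr, ExteriorAlgebra.algebraMap_leftInverse]

/-- `E(x, a)(v) = (v · a) · x` for `x` in `⋀(N)`, `a` in `⋀(M)` of the same degree and `v : N`. -/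
def eOp : ExteriorAlgebra K N →ₗ[K] ExteriorAlgebra K M →ₗ[K] Module.End K N :=
  LinearMap.mk₂ K
    (fun x a => ExteriorAlgebra.ιInv ∘ₗ (contr g).toLinearMap.flip x ∘ₗ
      ((contr g.flip).toLinearMap.flip a) ∘ₗ ExteriorAlgebra.ι K)
    (fun x y a => by ext v; simp) (fun c x a => by ext v; simp)
    (fun x a b => by ext v; simp) (fun c x a => by ext v; simp)

theorem eOp_apply (x : ExteriorAlgebra K N) (a : ExteriorAlgebra K M) (v : N) :
    eOp g x a v =
      ExteriorAlgebra.ιInv (contr g (contr g.flip (ExteriorAlgebra.ι K v) a) x) := rfl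

theorem ι_eOp (k : ℕ) {x : ExteriorAlgebra K N} (hx : x ∈ ⋀[K]^(k + 1) N)
    {a : ExteriorAlgebra K M} (ha : a ∈ ⋀[K]^(k + 1) M) (v : N) :
    ExteriorAlgebra.ι K (eOp g x a v) = contr g (contr g.flip (ExteriorAlgebra.ι K v) a) x := by
  obtain ⟨y, hy⟩ := mem_one_iff.1
    (contr_mem g k 1 (contr_ι_mem g.flip v k ha) (by rwa [add_comm]))
  rw [eOp_apply, ← hy, ExteriorAlgebra.ι_leftInverse]

/-- The pairing is skew for the pair of endomorphisms `(A, B)`. -/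
def IsSkew (A : Module.End K M) (B : Module.End K N) : Prop :=
  ∀ m n, g (A m) n + g m (B n) = 0

variable {g}

theorem IsSkew.flip {A : Module.End K M} {B : Module.End K N} (h : IsSkew g A B) :
    IsSkew g.flip B A := fun n m => by
  rw [add_comm]; exact h m n

theorem IsSkew.der_contr {A : Module.End K M} {B : Module.End K N} (h : IsSkew g A B)
    (a : ExteriorAlgebra K M) (x : ExteriorAlgebra K N) :
    der B (contr g a x) = contr g (der A a) x + contr g a (der B x) := by
  induction a using leftInd generalizing x with
  | h0 r => simp [der_algebraMap]
  | ha a b ha hb => simp only [map_add, LinearMap.add_apply, ha, hb]; abel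
  | hm m a ha =>
    have key : ∀ y : ExteriorAlgebra K N, der B (contr g (ExteriorAlgebra.ι K m) y) =
        contr g (ExteriorAlgebra.ι K (A m)) y + contr g (ExteriorAlgebra.ι K m) (der B y) := by
      intro y
      induction y using leftInd with
      | h0 r => simp only [contr_ι_algebraMap, der_algebraMap, map_zero, add_zero]
      | ha a b ha hb => simp only [map_add, ha, hb]; abel
      | hm n y hy =>
        have h1 := h m n
        have h2 : g m (B n) = - g (A m) n := by linear_combination h1
        simp only [contr_ι_ι_mul, der_ι_mul, hy, map_sub, map_smul, map_add, mul_add, h2, neg_smul]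
        abel
    rw [contr_ι_mul, key, ha, der_ι_mul, map_add, map_add, LinearMap.add_apply, contr_ι_mul,
      contr_ι_mul, contr_ι_mul]
    abel

theorem IsSkew.dot_der {A : Module.End K M} {B : Module.End K N} (h : IsSkew g A B) (k : ℕ)
    {a : ExteriorAlgebra K M} (ha : a ∈ ⋀[K]^k M) {x : ExteriorAlgebra K N} (hx : x ∈ ⋀[K]^k N) :
    dot g (der A a) x + dot g a (der B x) = 0 := by
  rw [← ExteriorAlgebra.algebraMap_eq_zero_iff (M := N), map_add,
    algebraMap_dot g k (der_mem A k ha) hx, algebraMap_dot g k ha (der_mem B k hx),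
    ← h.der_contr, ← algebraMap_dot g k ha hx, der_algebraMap]

theorem IsSkew.eOp_der {A : Module.End K M} {B : Module.End K N} (h : IsSkew g A B) (k : ℕ)
    {x : ExteriorAlgebra K N} (hx : x ∈ ⋀[K]^(k + 1) N)
    {a : ExteriorAlgebra K M} (ha : a ∈ ⋀[K]^(k + 1) M) :
    B * eOp g x a - eOp g x a * B = eOp g (der B x) a + eOp g x (der A a) := by
  ext v
  rw [← ExteriorAlgebra.ι_inj K]
  simp only [LinearMap.sub_apply, LinearMap.add_apply, Module.End.mul_apply, map_sub, map_add]
  rw [ι_eOp g k hx ha, ι_eOp g k (der_mem B _ hx) ha, ι_eOp g k hx (der_mem A _ ha), ← der_ι,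
    ι_eOp g k hx ha, h.der_contr, h.flip.der_contr, der_ι, map_add, LinearMap.add_apply]
  abel

theorem contr_contr (m : M) (z : ExteriorAlgebra K N) (b : ExteriorAlgebra K M) :
    contr g.flip (contr g (ExteriorAlgebra.ι K m) z) b =
      ExteriorAlgebra.ι K m * contr g.flip z b -
        contr g.flip (CliffordAlgebra.involute z) (ExteriorAlgebra.ι K m * b) := by
  induction z using leftInd generalizing b with
  | h0 r => simp [contr_ι_algebraMap]
  | ha x y hx hy => simp only [map_add, LinearMap.add_apply, hx, hy, mul_add]; abel
  | hm n z hz =>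
    rw [contr_ι_ι_mul, map_sub, map_smul, LinearMap.sub_apply, contr_ι_mul, hz,
      map_mul CliffordAlgebra.involute, CliffordAlgebra.involute_ι, neg_mul, map_neg,
      LinearMap.neg_apply, contr_ι_mul, contr_ι_mul, map_sub, contr_ι_ι_mul, sub_neg_eq_add,
      LinearMap.flip_apply, LinearMap.smul_apply, sub_sub, sub_sub_cancel]

theorem involute_of_mem (n : ℕ) {x : ExteriorAlgebra K M} (hx : x ∈ ⋀[K]^n M) :
    CliffordAlgebra.involute x = (-1 : K) ^ n • x := by
  induction n generalizing x with
  | zero =>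
    obtain ⟨r, rfl⟩ := mem_zero_iff.1 hx
    rw [AlgHom.commutes, pow_zero, one_smul]
  | succ n ih =>
    induction hx using power_ind with
    | hm m y hy =>
      rw [map_mul, CliffordAlgebra.involute_ι, ih hy, pow_succ']
      simp
    | ha a b _ _ ha hb => rw [map_add, ha, hb, smul_add]

theorem ι_mul_eq (m : M) (x : ExteriorAlgebra K M) :
    ExteriorAlgebra.ι K m * x = CliffordAlgebra.involute x * ExteriorAlgebra.ι K m := by
  induction x using leftInd with
  | h0 r => rw [AlgHom.commutes, Algebra.commutes]
  | ha x y hx hy => rw [map_add, mul_add, add_mul, hx, hy]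
  | hm n x hx =>
    rw [map_mul, CliffordAlgebra.involute_ι, mul_assoc, ← hx, ← mul_assoc, ← mul_assoc, neg_mul,
      ← add_eq_zero_iff_eq_neg.1 (ExteriorAlgebra.ι_add_mul_swap m n)]

variable (g) in
theorem dot_comm (k : ℕ) {a : ExteriorAlgebra K M} (ha : a ∈ ⋀[K]^k M)
    {x : ExteriorAlgebra K N} (hx : x ∈ ⋀[K]^k N) : dot g a x = dot g.flip x a := by
  induction k generalizing a x with
  | zero =>
    obtain ⟨r, rfl⟩ := mem_zero_iff.1 ha
    obtain ⟨s, rfl⟩ := mem_zero_iff.1 hx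
    simp only [dot_apply, contr_algebraMap, map_smul, ExteriorAlgebra.algebraMap_leftInverse _ _,
      smul_eq_mul, mul_comm]
  | succ k ih =>
    induction ha using power_ind with
    | hm m b hb =>
      have h1 := contr_contr (g := g) m x b
      rw [contr_eq_zero g.flip k hx hb, mul_zero, zero_sub, involute_of_mem _ hx, map_smul,
        LinearMap.smul_apply] at h1
      have h2 := congrArg ExteriorAlgebra.algebraMapInv h1
      rw [map_neg, map_smul, ← dot_apply, ← dot_apply, ← ih hb (contr_ι_mem g m k hx)] at h2
      have h3 : dot g (ExteriorAlgebra.ι K m * b) x =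
          (-1 : K) ^ k • dot g b (contr g (ExteriorAlgebra.ι K m) x) := by
        rw [ι_mul_eq, involute_of_mem _ hb, dot_apply, dot_apply, smul_mul_assoc, map_smul, map_mul,
          LinearMap.smul_apply, map_smul]
        rfl
      rw [h3, h2, pow_succ]
      rcases neg_one_pow_eq_or K k with h | h <;> simp [h]
    | ha a b _ _ ha hb => rw [map_add, map_add, LinearMap.add_apply, ha, hb]

variable (g) in
theorem dot_ι_ι (m : M) (n : N) :
    dot g (ExteriorAlgebra.ι K m) (ExteriorAlgebra.ι K n) = g m n := by
  rw [dot_apply, contr_ι, CliffordAlgebra.contractLeft_ι, ExteriorAlgebra.algebraMap_leftInverse]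

variable (g) in
theorem apply_eOp_eq (k : ℕ) {x : ExteriorAlgebra K N} (hx : x ∈ ⋀[K]^(k + 1) N)
    {a : ExteriorAlgebra K M} (ha : a ∈ ⋀[K]^(k + 1) M) (m : M) (n : N) :
    g m (eOp g x a n) =
      dot g (ExteriorAlgebra.ι K m * contr g.flip (ExteriorAlgebra.ι K n) a) x := by
  rw [← dot_ι_ι, ι_eOp g k hx ha, dot_apply, dot_apply, map_mul]
  rfl

variable (g) in
theorem apply_eOp_eq' (k : ℕ) {x : ExteriorAlgebra K N} (hx : x ∈ ⋀[K]^(k + 1) N)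
    {a : ExteriorAlgebra K M} (ha : a ∈ ⋀[K]^(k + 1) M) (m : M) (n : N) :
    g m (eOp g x a n) = (-1 : K) ^ k •
      dot g (contr g.flip (ExteriorAlgebra.ι K n) a) (contr g (ExteriorAlgebra.ι K m) x) := by
  rw [apply_eOp_eq g k hx ha, ι_mul_eq, involute_of_mem _ (contr_ι_mem g.flip n k ha), dot_apply,
    dot_apply, smul_mul_assoc, map_smul, map_mul, LinearMap.smul_apply, map_smul]
  rfl

variable (g) in
theorem eOp_adjoint (k : ℕ) {x : ExteriorAlgebra K N} (hx : x ∈ ⋀[K]^(k + 1) N)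
    {a : ExteriorAlgebra K M} (ha : a ∈ ⋀[K]^(k + 1) M) (m : M) (n : N) :
    g (eOp g.flip a x m) n = g m (eOp g x a n) := by
  rw [apply_eOp_eq' g k hx ha, dot_comm g k (contr_ι_mem _ _ _ ha) (contr_ι_mem _ _ _ hx)]
  exact apply_eOp_eq' g.flip k ha hx n m

variable (g) in
/-- The pair of endomorphisms attached to `a` and `x` is skew. -/
theorem eOp_isSkew (k : ℕ) {x : ExteriorAlgebra K N} (hx : x ∈ ⋀[K]^(k + 1) N)
    {a : ExteriorAlgebra K M} (ha : a ∈ ⋀[K]^(k + 1) M) :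
    IsSkew g (eOp g.flip a x) (-eOp g x a) := fun m n => by
  rw [eOp_adjoint g k hx ha, LinearMap.neg_apply, map_neg, add_neg_cancel]

theorem der_id (n : ℕ) {x : ExteriorAlgebra K N} (hx : x ∈ ⋀[K]^n N) :
    der (LinearMap.id : Module.End K N) x = (n : K) • x := by
  induction n generalizing x with
  | zero =>
    obtain ⟨r, rfl⟩ := mem_zero_iff.1 hx
    rw [der_algebraMap, Nat.cast_zero, zero_smul]
  | succ n ih =>
    induction hx using power_ind with
    | hm m y hy =>
      rw [der_ι_mul, ih hy, LinearMap.id_apply, mul_smul_comm, Nat.cast_succ, add_smul, one_smul,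
        add_comm]
    | ha a b _ _ ha hb => rw [map_add, ha, hb, smul_add]

variable (g) in
theorem der_rankOne (m : M) (n : N) (x : ExteriorAlgebra K N) :
    der ((g m).smulRight n) x =
      ExteriorAlgebra.ι K n * contr g (ExteriorAlgebra.ι K m) x := by
  induction x using leftInd with
  | h0 r => rw [der_algebraMap, contr_ι_algebraMap, mul_zero]
  | ha x y hx hy => rw [map_add, map_add, mul_add, hx, hy]
  | hm v x hx =>
    rw [der_ι_mul, hx, contr_ι_ι_mul, mul_sub, ← mul_assoc, ← mul_assoc,
      eq_neg_of_add_eq_zero_left (ExteriorAlgebra.ι_add_mul_swap v n)]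
    simp [← sub_eq_add_neg]

/-- The trace of an endomorphism of a finitely generated projective module: the image of the
endomorphism under the inverse of `M* ⊗ M ≃ End M` followed by the evaluation `M* ⊗ M → K`. -/
def projTrace [Module.Finite K M] [Module.Projective K M] : Module.End K M →ₗ[K] K :=
  contractLeft K M ∘ₗ
    (LinearEquiv.ofBijective (dualTensorHom K M M) dualTensorHom_bijective).symm.toLinearMap

section Trace
variable [Module.Finite K M] [Module.Projective K M]

theorem projTrace_dualTensorHom (t : Module.Dual K M ⊗[K] M) :
    projTrace (dualTensorHom K M M t) = contractLeft K M t := by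
  rw [projTrace, LinearMap.comp_apply]
  congr 1
  exact (LinearEquiv.ofBijective (dualTensorHom K M M) dualTensorHom_bijective).symm_apply_apply t

variable (K M) in
theorem exists_dual_basis : ∃ s : Finset (Module.Dual K M × M),
    (∀ v, v = ∑ p ∈ s, p.1 v • p.2) ∧
      ∀ A : Module.End K M, projTrace A = ∑ p ∈ s, p.1 (A p.2) := by
  obtain ⟨t, ht⟩ := (dualTensorHom_bijective (R := K) (M := M) (N := M)).2 LinearMap.id
  obtain ⟨s, rfl⟩ := TensorProduct.exists_finset t
  have hid : ∀ v : M, v = ∑ p ∈ s, p.1 v • p.2 := by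
    intro v
    have := LinearMap.congr_fun ht v
    rw [map_sum, LinearMap.sum_apply] at this
    simpa using this.symm
  refine ⟨s, hid, fun A => ?_⟩
  have hA : A = dualTensorHom K M M (∑ p ∈ s, p.1 ⊗ₜ A p.2) := by
    ext v
    rw [map_sum, LinearMap.sum_apply]
    conv_lhs => rw [hid v, map_sum]
    simp
  conv_lhs => rw [hA, projTrace_dualTensorHom, map_sum]
  simp

theorem projTrace_comm (A B : Module.End K M) : projTrace (A * B) = projTrace (B * A) := by
  obtain ⟨s, hs, ht⟩ := exists_dual_basis K M
  rw [ht, ht]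
  have h : ∀ A B : Module.End K M, ∑ p ∈ s, p.1 ((A * B) p.2) =
      ∑ p ∈ s, ∑ q ∈ s, q.1 (B p.2) * p.1 (A q.2) := by
    intro A B
    refine Finset.sum_congr rfl fun p _ => ?_
    rw [Module.End.mul_apply]
    conv_lhs => rw [hs (B p.2), map_sum, map_sum]
    simp
  rw [h, h, Finset.sum_comm]
  exact Finset.sum_congr rfl fun p _ => Finset.sum_congr rfl fun q _ => mul_comm _ _

theorem trace_baseChange_rankOne {L : Type*} [CommRing L] [Algebra K L]
    [Module.Free L (L ⊗[K] M)] (f : Module.Dual K M) (m : M) :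
    LinearMap.trace L (L ⊗[K] M) ((f.smulRight m).baseChange L) = algebraMap K L (f m) := by
  have : (f.smulRight m).baseChange L = dualTensorHom L (L ⊗[K] M) (L ⊗[K] M)
      ((f.baseChange L) ⊗ₜ ((1 : L) ⊗ₜ[K] m)) := by
    ext v
    simp [TensorProduct.smul_tmul']
  rw [this, LinearMap.trace_eq_contract_apply]
  simp [Algebra.smul_def]

theorem projTrace_id {n : ℕ} (hn : ∀ p, Module.rankAtStalk (R := K) M p = n) :
    projTrace (LinearMap.id : Module.End K M) = n := by
  obtain ⟨s, hs, ht⟩ := exists_dual_basis K M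
  rw [ht]
  simp only [LinearMap.id_apply]
  have hid : (LinearMap.id : Module.End K M) = ∑ p ∈ s, p.1.smulRight p.2 := by
    ext v
    rw [LinearMap.sum_apply]
    exact hs v
  rw [← sub_eq_zero]
  refine eq_zero_of_localization _ fun J hJ => ?_
  let p : PrimeSpectrum K := ⟨J, hJ.isPrime⟩
  let L := Localization.AtPrime J
  have : Module.Free L (L ⊗[K] M) := Module.free_of_flat_of_isLocalRing
  have h1 := LinearMap.trace_id L (L ⊗[K] M)
  have h2 : Module.finrank L (L ⊗[K] M) = n := by
    rw [← hn p, Module.rankAtStalk_eq_finrank_tensorProduct]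
  rw [h2, ← LinearMap.baseChange_id, hid] at h1
  have h3 := map_sum (LinearMap.baseChangeHom K L M M) (fun p => p.1.smulRight p.2) s
  change LinearMap.baseChange L _ = ∑ p ∈ s, LinearMap.baseChange L _ at h3
  rw [h3, map_sum] at h1
  simp only [trace_baseChange_rankOne] at h1
  rw [map_sub, map_sum, h1, map_natCast, sub_self]

theorem projTrace_eOp (hg : g.flip.IsPerfPair) (k : ℕ) {x : ExteriorAlgebra K M}
    (hx : x ∈ ⋀[K]^(k + 1) M) {a : ExteriorAlgebra K N} (ha : a ∈ ⋀[K]^(k + 1) N) :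
    projTrace (eOp g.flip x a) = ((k : K) + 1) * dot g.flip a x := by
  obtain ⟨s, hs, ht⟩ := exists_dual_basis K M
  rw [ht]
  have hsurj : ∀ f : Module.Dual K M, ∃ n, g.flip n = f := hg.bijective_left.2
  choose r hr using hsurj
  have h1 : ∑ p ∈ s, ExteriorAlgebra.ι K (r p.1) * contr g (ExteriorAlgebra.ι K p.2) a =
      ((k : K) + 1) • a := by
    have h2 : (LinearMap.id : Module.End K N) = ∑ p ∈ s, (g p.2).smulRight (r p.1) := by
      ext n
      apply hg.bijective_left.1
      ext v
      conv_lhs => rw [hs v]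
      simp [hr, mul_comm]
    have h3 := der_id (k + 1) ha
    rw [h2, map_sum, LinearMap.sum_apply] at h3
    rw [← Nat.cast_succ, ← h3]
    exact Finset.sum_congr rfl fun p _ => (der_rankOne g p.2 (r p.1) a).symm
  calc ∑ p ∈ s, p.1 (eOp g.flip x a p.2)
      = ∑ p ∈ s, dot g.flip
          (ExteriorAlgebra.ι K (r p.1) * contr g (ExteriorAlgebra.ι K p.2) a) x := by
        refine Finset.sum_congr rfl fun p _ => ?_
        rw [← hr p.1, apply_eOp_eq g.flip k hx ha, hr p.1]
        rfl
    _ = _ := by rw [← LinearMap.sum_apply, ← map_sum, h1]; simp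

end Trace

end Machinery
end ExtPair

/-- A trilinear map given by a function of three variables. -/
def mkTri {K : Type u} [CommRing K] {A B C D : Type*} [AddCommGroup A] [AddCommGroup B] [AddCommGroup C] [AddCommGroup D]
    [Module K A] [Module K B] [Module K C] [Module K D] (f : A → B → C → D)
    (h1 : ∀ a a' b c, f (a + a') b c = f a b c + f a' b c)
    (h1' : ∀ (r : K) a b c, f (r • a) b c = r • f a b c)
    (h2 : ∀ a b b' c, f a (b + b') c = f a b c + f a b' c)
    (h2' : ∀ (r : K) a b c, f a (r • b) c = r • f a b c)
    (h3 : ∀ a b c c', f a b (c + c') = f a b c + f a b c')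
    (h3' : ∀ (r : K) a b c, f a b (r • c) = r • f a b c) :
    A →ₗ[K] B →ₗ[K] C →ₗ[K] D :=
  LinearMap.mk₂ K
    (fun a b => { toFun := f a b, map_add' := h3 a b, map_smul' := fun r c => h3' r a b c })
    (fun a a' b => LinearMap.ext (h1 a a' b)) (fun r a b => LinearMap.ext (h1' r a b))
    (fun a b b' => LinearMap.ext (h2 a b b')) (fun r a b => LinearMap.ext (h2' r a b))

/-- A trilinear pair over `K`: a pair of modules with two trilinear products. -/
structure TrilinearPair (K : Type u) [CommRing K] where
  Neg : Type v
  Pos : Type w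
  [addNeg : AddCommGroup Neg]
  [addPos : AddCommGroup Pos]
  [modNeg : Module K Neg]
  [modPos : Module K Pos]
  prodNeg : Neg →ₗ[K] Pos →ₗ[K] Neg →ₗ[K] Neg
  prodPos : Pos →ₗ[K] Neg →ₗ[K] Pos →ₗ[K] Pos

namespace TrilinearPair

attribute [instance] TrilinearPair.addNeg TrilinearPair.addPos TrilinearPair.modNeg
  TrilinearPair.modPos

variable {K : Type u} [CommRing K]

/-- Isomorphisms of trilinear pairs: pairs of linear bijections preserving the products. -/
@[ext]
structure Iso (P : TrilinearPair.{u, v, w} K) (Q : TrilinearPair.{u, v', w'} K) where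
  neg : P.Neg ≃ₗ[K] Q.Neg
  pos : P.Pos ≃ₗ[K] Q.Pos
  map_neg : ∀ x y z, neg (P.prodNeg x y z) = Q.prodNeg (neg x) (pos y) (neg z)
  map_pos : ∀ x y z, pos (P.prodPos x y z) = Q.prodPos (pos x) (neg y) (pos z)

/-- The identity isomorphism. -/
def Iso.refl (P : TrilinearPair.{u, v, w} K) : Iso P P :=
  ⟨LinearEquiv.refl K _, LinearEquiv.refl K _, fun _ _ _ => rfl, fun _ _ _ => rfl⟩

/-- The inverse isomorphism. -/
def Iso.symm {P : TrilinearPair.{u, v, w} K} {Q : TrilinearPair.{u, v', w'} K} (e : Iso P Q) :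
    Iso Q P :=
  ⟨e.neg.symm, e.pos.symm,
    fun x y z => e.neg.injective (by simp [e.map_neg]),
    fun x y z => e.pos.injective (by simp [e.map_pos])⟩

/-- The composite of two isomorphisms. -/
def Iso.trans {P : TrilinearPair.{u, v, w} K} {Q : TrilinearPair.{u, v', w'} K}
    {R : TrilinearPair.{u, v'', w''} K} (e : Iso P Q) (f : Iso Q R) : Iso P R :=
  ⟨e.neg.trans f.neg, e.pos.trans f.pos,
    fun x y z => by simp [e.map_neg, f.map_neg],
    fun x y z => by simp [e.map_pos, f.map_pos]⟩

/-- Being isomorphic, as an equivalence relation. -/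
def isoSetoid : Setoid (TrilinearPair.{u, v, w} K) where
  r P Q := Nonempty (Iso P Q)
  iseqv := ⟨fun P => ⟨Iso.refl P⟩, fun ⟨e⟩ => ⟨e.symm⟩, fun ⟨e⟩ ⟨f⟩ => ⟨e.trans f⟩⟩

end TrilinearPair

/-- A trilinear pair with a short Peirce grading: a `ℤ`-grading
`P^σ = ⨁ P_i^σ`, `{P_g^σ, P_k^{-σ}, P_l^σ} ⊆ P_{g-k+l}^σ`, with support in `{0, 1}`. -/
structure SPGradedPair (K : Type u) [CommRing K] extends TrilinearPair.{u, v, w} K where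
  negGr : ℤ → Submodule K Neg
  posGr : ℤ → Submodule K Pos
  neg_isCompl : IsCompl (negGr 0) (negGr 1)
  pos_isCompl : IsCompl (posGr 0) (posGr 1)
  neg_support : ∀ i, i ≠ 0 → i ≠ 1 → negGr i = ⊥
  pos_support : ∀ i, i ≠ 0 → i ≠ 1 → posGr i = ⊥
  neg_mem : ∀ g k l, ∀ x ∈ negGr g, ∀ y ∈ posGr k, ∀ z ∈ negGr l,
    prodNeg x y z ∈ negGr (g - k + l)
  pos_mem : ∀ g k l, ∀ x ∈ posGr g, ∀ y ∈ negGr k, ∀ z ∈ posGr l,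
    prodPos x y z ∈ posGr (g - k + l)

namespace SPGradedPair

variable {K : Type u} [CommRing K]

/-- Graded isomorphisms of SP-graded pairs. -/
structure Iso (P : SPGradedPair.{u, v, w} K) (Q : SPGradedPair.{u, v', w'} K) extends
    TrilinearPair.Iso P.toTrilinearPair Q.toTrilinearPair where
  map_negGr : ∀ i, (P.negGr i).map neg.toLinearMap = Q.negGr i
  map_posGr : ∀ i, (P.posGr i).map pos.toLinearMap = Q.posGr i

/-- Being graded isomorphic, as an equivalence relation. -/
def isoSetoid : Setoid (SPGradedPair.{u, v, w} K) where
  r P Q := Nonempty (Iso P Q)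
  iseqv := by
    refine ⟨fun P => ⟨⟨.refl _, fun i => ?_, fun i => ?_⟩⟩, fun {P Q} ⟨e⟩ =>
      ⟨⟨e.toIso.symm, fun i => ?_, fun i => ?_⟩⟩,
      fun {P Q R} ⟨e⟩ ⟨f⟩ => ⟨⟨e.toIso.trans f.toIso, fun i => ?_, fun i => ?_⟩⟩⟩
    · exact Submodule.map_id _
    · exact Submodule.map_id _
    · rw [← e.map_negGr i]
      exact ((P.negGr i).map_symm_eq_iff e.neg).2 rfl
    · rw [← e.map_posGr i]
      exact ((P.posGr i).map_symm_eq_iff e.pos).2 rfl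
    · rw [← f.map_negGr, ← e.map_negGr]
      exact Submodule.map_comp _ _ _
    · rw [← f.map_posGr, ← e.map_posGr]
      exact Submodule.map_comp _ _ _

/-- The family of submodules with `p` in degree `0`, `q` in degree `1` and `0` elsewhere. -/
def gr01 {V : Type*} [AddCommGroup V] [Module K V] (p q : Submodule K V) (i : ℤ) :
    Submodule K V :=
  if i = 0 then p else if i = 1 then q else ⊥

section Reflection

variable {A : Type v} {B : Type w} [AddCommGroup A] [AddCommGroup B] [Module K A] [Module K B]

variable (f : A →ₗ[K] B →ₗ[K] A →ₗ[K] A) (h : B →ₗ[K] A →ₗ[K] B →ₗ[K] B)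
  (grA : ℤ → Submodule K A) (grB : ℤ → Submodule K B)
  (hf : ∀ g k l, ∀ x ∈ grA g, ∀ y ∈ grB k, ∀ z ∈ grA l, f x y z ∈ grA (g - k + l))
  (hh : ∀ g k l, ∀ x ∈ grB g, ∀ y ∈ grA k, ∀ z ∈ grB l, h x y z ∈ grB (g - k + l))

/-- The `σ`-product of the reflection, written for `A = P^σ` and `B = P^{-σ}` with products
`f` and `h`:
`{a₀ + a₁, b₀ + b₁, c₀ + c₁} = {a₀,b₀,c₀} - {b₁,a₁,c₀} + K(a₀,b₁)c₁
  + {a₁,b₁,c₁} - {b₀,a₀,c₁} + K(a₁,b₀)c₀`, where `a₀, b₁, c₀ ∈ P^{-σ}`, `a₁, b₀, c₁ ∈ P^σ` and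
`K(x,z)y = {x,y,z} - {z,y,x}`. -/
def reflProd :
    (grB 0 × grA 1) →ₗ[K] (grA 0 × grB 1) →ₗ[K] (grB 0 × grA 1) →ₗ[K] (grB 0 × grA 1) :=
  mkTri (fun a b c =>
    (⟨h a.1 b.1 c.1 - h b.2 a.2 c.1 + (h a.1 c.2 b.2 - h b.2 c.2 a.1),
        add_mem (sub_mem (hh 0 0 0 _ a.1.2 _ b.1.2 _ c.1.2) (hh 1 1 0 _ b.2.2 _ a.2.2 _ c.1.2))
          (sub_mem (hh 0 1 1 _ a.1.2 _ c.2.2 _ b.2.2) (hh 1 1 0 _ b.2.2 _ c.2.2 _ a.1.2))⟩,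
      ⟨f a.2 b.2 c.2 - f b.1 a.1 c.2 + (f a.2 c.1 b.1 - f b.1 c.1 a.2),
        add_mem (sub_mem (hf 1 1 1 _ a.2.2 _ b.2.2 _ c.2.2) (hf 0 0 1 _ b.1.2 _ a.1.2 _ c.2.2))
          (sub_mem (hf 1 0 0 _ a.2.2 _ c.1.2 _ b.1.2) (hf 0 0 1 _ b.1.2 _ c.1.2 _ a.2.2))⟩))
    (fun a a' b c => by
      refine Prod.ext (Subtype.ext ?_) (Subtype.ext ?_) <;> simp <;> abel)
    (fun r a b c => by
      refine Prod.ext (Subtype.ext ?_) (Subtype.ext ?_) <;> simp [smul_sub, smul_add])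
    (fun a a' b c => by
      refine Prod.ext (Subtype.ext ?_) (Subtype.ext ?_) <;> simp <;> abel)
    (fun r a b c => by
      refine Prod.ext (Subtype.ext ?_) (Subtype.ext ?_) <;> simp [smul_sub, smul_add])
    (fun a a' b c => by
      refine Prod.ext (Subtype.ext ?_) (Subtype.ext ?_) <;> simp <;> abel)
    (fun r a b c => by
      refine Prod.ext (Subtype.ext ?_) (Subtype.ext ?_) <;> simp [smul_sub, smul_add])

theorem gr01_isCompl {V W : Type*} [AddCommGroup V] [Module K V] [AddCommGroup W] [Module K W] :
    IsCompl (gr01 (K := K) (Submodule.prod (⊤ : Submodule K V) (⊥ : Submodule K W))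
      (Submodule.prod ⊥ ⊤) 0) (gr01 (Submodule.prod (⊤ : Submodule K V) (⊥ : Submodule K W))
      (Submodule.prod ⊥ ⊤) 1) := by
  simp only [gr01, if_true, one_ne_zero, if_false]
  constructor
  · rw [Submodule.disjoint_def]
    rintro ⟨x, y⟩ ⟨_, hy⟩ ⟨hx, _⟩
    exact Prod.ext hx hy
  · rw [codisjoint_iff, eq_top_iff]
    rintro ⟨x, y⟩ _
    exact Submodule.mem_sup.2 ⟨(x, 0), ⟨trivial, rfl⟩, (0, y), ⟨rfl, trivial⟩, by simp⟩

theorem gr01_support {V : Type*} [AddCommGroup V] [Module K V] (p q : Submodule K V) (i : ℤ)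
    (h0 : i ≠ 0) (h1 : i ≠ 1) : gr01 p q i = ⊥ := by
  simp [gr01, h0, h1]

theorem mem_gr01 {V : Type*} [AddCommGroup V] [Module K V] {p q : Submodule K V} {i : ℤ} {x : V}
    (hx : x ∈ gr01 p q i) : x = 0 ∨ (i = 0 ∧ x ∈ p) ∨ (i = 1 ∧ x ∈ q) := by
  unfold gr01 at hx
  split_ifs at hx with h0 h1
  · exact .inr (.inl ⟨h0, hx⟩)
  · exact .inr (.inr ⟨h1, hx⟩)
  · exact .inl hx

theorem reflProd_mem (i j l : ℤ) (x : grB 0 × grA 1)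
    (hx : x ∈ gr01 (K := K) (Submodule.prod ⊤ ⊥) (Submodule.prod ⊥ ⊤) i) (y : grA 0 × grB 1)
    (hy : y ∈ gr01 (K := K) (Submodule.prod ⊤ ⊥) (Submodule.prod ⊥ ⊤) j) (z : grB 0 × grA 1)
    (hz : z ∈ gr01 (K := K) (Submodule.prod ⊤ ⊥) (Submodule.prod ⊥ ⊤) l) :
    reflProd f h grA grB hf hh x y z ∈
      gr01 (K := K) (Submodule.prod ⊤ ⊥) (Submodule.prod ⊥ ⊤) (i - j + l) := by
  rcases mem_gr01 hx with rfl | ⟨rfl, _, hx⟩ | ⟨rfl, hx, _⟩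
  · simp
  all_goals
    rcases mem_gr01 hy with rfl | ⟨rfl, _, hy⟩ | ⟨rfl, hy, _⟩
    · simp
    all_goals
      rcases mem_gr01 hz with rfl | ⟨rfl, _, hz⟩ | ⟨rfl, hz, _⟩
      · simp
      all_goals
        have hx : _ = _ := hx
        have hy : _ = _ := hy
        have hz : _ = _ := hz
        simp [gr01, reflProd, mkTri, hx, hy, hz]

end Reflection

/-- The reflection `P^∨` of an SP-graded pair: `(P^∨)_0^σ = P_0^{-σ}` and `(P^∨)_1^σ = P_1^σ`. -/
def reflect (P : SPGradedPair.{u, v, w} K) : SPGradedPair.{u, max v w, max v w} K where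
  Neg := P.posGr 0 × P.negGr 1
  Pos := P.negGr 0 × P.posGr 1
  prodNeg := reflProd P.prodNeg P.prodPos P.negGr P.posGr P.neg_mem P.pos_mem
  prodPos := reflProd P.prodPos P.prodNeg P.posGr P.negGr P.pos_mem P.neg_mem
  negGr := gr01 (Submodule.prod ⊤ ⊥) (Submodule.prod ⊥ ⊤)
  posGr := gr01 (Submodule.prod ⊤ ⊥) (Submodule.prod ⊥ ⊤)
  neg_isCompl := gr01_isCompl
  pos_isCompl := gr01_isCompl
  neg_support := gr01_support _ _
  pos_support := gr01_support _ _
  neg_mem := reflProd_mem _ _ _ _ _ _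
  pos_mem := reflProd_mem _ _ _ _ _ _

end SPGradedPair

namespace ExtPair

variable {K : Type u} [CommRing K]

section Pair

variable {M : Type v} {N : Type w} [AddCommGroup M] [AddCommGroup N] [Module K M] [Module K N]
  (g : M →ₗ[K] N →ₗ[K] K)

/-- The product `{x, y, z} = E(x, y) ∘ z - (x · y) z` of `⋀³(N) × ⋀³(M) × ⋀³(N) → ⋀³(N)`. -/
def prod : ⋀[K]^3 N →ₗ[K] ⋀[K]^3 M →ₗ[K] ⋀[K]^3 N →ₗ[K] ⋀[K]^3 N :=
  mkTri (fun x y z => ⟨der (eOp g x y) z - dot g.flip (x : ExteriorAlgebra K N) y • z.1,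
      sub_mem (der_mem _ 3 z.2) (Submodule.smul_mem _ _ z.2)⟩)
    (fun a a' b c => Subtype.ext <| by simp [add_smul]; abel)
    (fun r a b c => Subtype.ext <| by simp [smul_sub, mul_smul])
    (fun a b b' c => Subtype.ext <| by simp [add_smul]; abel)
    (fun r a b c => Subtype.ext <| by simp [smul_sub, mul_smul])
    (fun a b c c' => Subtype.ext <| by simp [smul_add]; abel)
    (fun r a b c => Subtype.ext <| by simp [smul_sub, smul_comm r])

theorem coe_prod (x : ⋀[K]^3 N) (y : ⋀[K]^3 M) (z : ⋀[K]^3 N) :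
    (prod g x y z : ExteriorAlgebra K N) =
      der (eOp g x y) z - dot g.flip (x : ExteriorAlgebra K N) y • z.1 := rfl

variable (e : M) (f : N)

/-- The submodule of `⋀(N)` spanned by the products of `k` elements of `U`. -/
def powers (U : Submodule K N) (k : ℕ) : Submodule K (ExteriorAlgebra K N) :=
  (U.map (ExteriorAlgebra.ι K)) ^ k

/-- `⋀³(U)` inside `⋀³(N)`, where `U` is the kernel of `g e`. -/
def piece0 : Submodule K (⋀[K]^3 N) :=
  (powers (LinearMap.ker (g e)) 3).comap (⋀[K]^3 N).subtype

/-- `⋀²(U) f` inside `⋀³(N)`, where `U` is the kernel of `g e`. -/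
def piece1 : Submodule K (⋀[K]^3 N) :=
  (powers (LinearMap.ker (g e)) 2 * Submodule.span K {ExteriorAlgebra.ι K f}).comap
    (⋀[K]^3 N).subtype

/-- The grading of `⋀³(N)`. -/
def spGr : ℤ → Submodule K (⋀[K]^3 N) := SPGradedPair.gr01 (piece0 g e) (piece1 g e f)

theorem powers_le (U : Submodule K N) (k : ℕ) : powers U k ≤ ⋀[K]^k N :=
  pow_le_pow_left' LinearMap.map_le_range k

theorem contr_contr_self (x : ExteriorAlgebra K N) :
    contr g (ExteriorAlgebra.ι K e) (contr g (ExteriorAlgebra.ι K e) x) = 0 := by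
  rw [contr_ι, contr_ι, CliffordAlgebra.contractLeft_contractLeft]

theorem contr_powers (k : ℕ) {x : ExteriorAlgebra K N}
    (hx : x ∈ powers (LinearMap.ker (g e)) k) : contr g (ExteriorAlgebra.ι K e) x = 0 := by
  induction k generalizing x with
  | zero =>
    obtain ⟨r, rfl⟩ := mem_zero_iff.1 (powers_le _ 0 hx)
    exact contr_ι_algebraMap g e r
  | succ k ih =>
    rw [powers, pow_succ'] at hx
    refine Submodule.mul_induction_on hx ?_ fun a b ha hb => by rw [map_add, ha, hb, add_zero]
    rintro _ ⟨u, hu, rfl⟩ b hb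
    rw [contr_ι_ι_mul, LinearMap.mem_ker.1 hu, ih hb, zero_smul, mul_zero, sub_zero]

/-- The derivation extending the projection of `N` onto `K f` along `U`. -/
abbrev tau : Module.End K (ExteriorAlgebra K N) := der ((g e).smulRight f)

theorem tau_apply (x : ExteriorAlgebra K N) :
    tau g e f x = ExteriorAlgebra.ι K f * contr g (ExteriorAlgebra.ι K e) x := der_rankOne g e f x

variable {g e f}

theorem map_eq (x : ExteriorAlgebra K N) :
    ExteriorAlgebra.map (LinearMap.id - (g e).smulRight f) x = x - tau g e f x := by
  induction x using leftInd with
  | h0 r => simp [der_algebraMap]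
  | ha x y hx hy => rw [map_add, hx, hy, map_add]; abel
  | hm n x hx =>
    rw [map_mul, hx, ExteriorAlgebra.map_apply_ι, der_ι_mul, tau_apply]
    simp only [LinearMap.sub_apply, LinearMap.id_apply, LinearMap.smulRight_apply, map_sub,
      map_smul, sub_mul, mul_sub, smul_mul_assoc]
    rw [← mul_assoc (ExteriorAlgebra.ι K f) (ExteriorAlgebra.ι K f), ExteriorAlgebra.ι_sq_zero,
      zero_mul, smul_zero]
    abel

theorem mem_powers (hef : g e f = 1) (k : ℕ) {x : ExteriorAlgebra K N} (hx : x ∈ ⋀[K]^k N)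
    (hc : contr g (ExteriorAlgebra.ι K e) x = 0) : x ∈ powers (LinearMap.ker (g e)) k := by
  have h1 := map_eq (g := g) (e := e) (f := f) x
  rw [tau_apply, hc, mul_zero, sub_zero] at h1
  rw [← h1]
  have h2 : (⋀[K]^k N).map (ExteriorAlgebra.map
      (LinearMap.id - (g e).smulRight f)).toLinearMap ≤ powers (LinearMap.ker (g e)) k := by
    unfold ExteriorAlgebra.exteriorPower powers
    rw [Submodule.map_pow]
    refine pow_le_pow_left' ?_ k
    rintro _ ⟨_, ⟨n, rfl⟩, rfl⟩
    refine ⟨n - g e n • f, ?_, ?_⟩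
    · simp [hef]
    · simp
  exact h2 ⟨x, hx, rfl⟩

theorem contr_tau (hef : g e f = 1) (x : ExteriorAlgebra K N) :
    contr g (ExteriorAlgebra.ι K e) (tau g e f x) = contr g (ExteriorAlgebra.ι K e) x := by
  rw [tau_apply, contr_ι_ι_mul, hef, one_smul, contr_contr_self, mul_zero, sub_zero]

theorem tau_tau (hef : g e f = 1) (x : ExteriorAlgebra K N) : tau g e f (tau g e f x) = tau g e f x := by
  rw [tau_apply, contr_tau hef, ← tau_apply]

theorem mem_piece0 (hef : g e f = 1) {x : ⋀[K]^3 N} : x ∈ piece0 g e ↔ tau g e f x.1 = 0 := by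
  constructor
  · intro hx
    have h : contr g (ExteriorAlgebra.ι K e) x.1 = 0 := contr_powers g e 3 hx
    rw [tau_apply, h, mul_zero]
  · intro hx
    refine mem_powers hef 3 x.2 ?_
    change contr g (ExteriorAlgebra.ι K e) x.1 = 0
    rw [← contr_tau hef, hx, map_zero]

theorem mem_piece1 (hef : g e f = 1) {x : ⋀[K]^3 N} : x ∈ piece1 g e f ↔ tau g e f x.1 = x.1 := by
  have hinv : ∀ y ∈ ⋀[K]^2 N, y * ExteriorAlgebra.ι K f = ExteriorAlgebra.ι K f * y := by
    intro y hy
    rw [ι_mul_eq, involute_of_mem 2 hy]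
    simp
  constructor
  · intro hx
    obtain ⟨y, hy, h⟩ := Submodule.mem_mul_span_singleton.1 hx
    change y * _ = x.1 at h
    rw [← h, hinv y (powers_le _ 2 hy), tau_apply, contr_ι_ι_mul, hef, one_smul,
      contr_powers g e 2 hy, mul_zero, sub_zero]
  · intro hx
    have h2 := contr_ι_mem g e 2 x.2
    refine Submodule.mem_mul_span_singleton.2 ⟨contr g (ExteriorAlgebra.ι K e) x,
      mem_powers hef 2 h2 (contr_contr_self g e _), ?_⟩
    rw [hinv _ h2, ← tau_apply, hx]
    rfl

theorem spGr_isCompl (hef : g e f = 1) : IsCompl (spGr g e f 0) (spGr g e f 1) := by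
  simp only [spGr, SPGradedPair.gr01, if_true, one_ne_zero, if_false]
  constructor
  · rw [Submodule.disjoint_def]
    intro x h0 h1
    apply Subtype.ext
    rw [← (mem_piece1 hef).1 h1, (mem_piece0 hef).1 h0]
    rfl
  · rw [codisjoint_iff, eq_top_iff]
    intro x _
    refine Submodule.mem_sup.2 ⟨x - ⟨tau g e f x, der_mem _ 3 x.2⟩, ?_,
      ⟨tau g e f x, der_mem _ 3 x.2⟩, ?_, by simp⟩
    · rw [mem_piece0 hef]
      simp [tau_tau hef]
    · rw [mem_piece1 hef]
      exact tau_tau hef _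

theorem tau_of_mem (hef : g e f = 1) {i : ℤ} {x : ⋀[K]^3 N} (hx : x ∈ spGr g e f i) :
    tau g e f x.1 = (i : K) • x.1 := by
  rcases SPGradedPair.mem_gr01 hx with rfl | ⟨rfl, hx⟩ | ⟨rfl, hx⟩
  · simp
  · simp [(mem_piece0 hef).1 hx]
  · simp [(mem_piece1 hef).1 hx]

theorem isSkew_rankOne : IsSkew g (-(g.flip f).smulRight e) ((g e).smulRight f) := fun m n => by
  simp [mul_comm]

theorem tau_prod (x : ⋀[K]^3 N) (y : ⋀[K]^3 M) (z : ⋀[K]^3 N) :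
    tau g e f (prod g x y z).1 =
      (der (eOp g (tau g e f x.1) y.1) z.1 - dot g.flip (tau g e f x.1) y.1 • z.1)
      - (der (eOp g x.1 (tau g.flip f e y.1)) z.1 -
          dot g.flip x.1 (tau g.flip f e y.1) • z.1)
      + (der (eOp g x.1 y.1) (tau g e f z.1) - dot g.flip x.1 y.1 • tau g e f z.1) := by
  have hs := isSkew_rankOne (g := g) (e := e) (f := f)
  have h1 := hs.eOp_der 2 x.2 y.2
  have h2 := hs.flip.dot_der 3 x.2 y.2
  have h3 := der_comm ((g e).smulRight f) (eOp g x.1 y.1) z.1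
  rw [h1] at h3
  simp only [map_neg, LinearMap.neg_apply, ← sub_eq_add_neg] at h2 h3
  rw [coe_prod, map_sub, map_smul, eq_add_of_sub_eq h3.symm, map_sub, LinearMap.sub_apply,
    sub_eq_zero.1 h2]
  abel

/-- The product of `⋀₃` respects the gradings. -/
theorem prod_mem (hef : g e f = 1) (h6 : IsUnit (6 : K)) (i j l : ℤ) (x : ⋀[K]^3 N) (hx : x ∈ spGr g e f i)
    (y : ⋀[K]^3 M) (hy : y ∈ spGr g.flip f e j) (z : ⋀[K]^3 N) (hz : z ∈ spGr g e f l) :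
    prod g x y z ∈ spGr g e f (i - j + l) := by
  have hfe : g.flip f e = 1 := hef
  have ht := tau_prod (g := g) (e := e) (f := f) x y z
  rw [tau_of_mem hef hx, tau_of_mem hfe hy, tau_of_mem hef hz] at ht
  simp only [map_smul, LinearMap.smul_apply, smul_eq_mul, mul_smul, ← smul_sub] at ht
  rw [smul_comm _ (l : K), ← smul_sub, ← coe_prod, ← sub_smul, ← add_smul] at ht
  have htt := tau_tau hef (prod g x y z).1
  have h2 : IsUnit (2 : K) := isUnit_of_dvd_unit ⟨3, by norm_num⟩ h6
  have key : (2 : K) • (prod g x y z).1 = 0 → prod g x y z = 0 := fun h =>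
    Subtype.ext (h2.smul_eq_zero.1 h)
  rcases SPGradedPair.mem_gr01 hx with rfl | ⟨rfl, hx⟩ | ⟨rfl, hx⟩
  · simp
  all_goals
    rcases SPGradedPair.mem_gr01 hy with rfl | ⟨rfl, hy⟩ | ⟨rfl, hy⟩
    · simp
    all_goals
      rcases SPGradedPair.mem_gr01 hz with rfl | ⟨rfl, hz⟩ | ⟨rfl, hz⟩
      · simp
      all_goals
        norm_num at ht
        norm_num [spGr, SPGradedPair.gr01]
  all_goals
    first
    | exact (mem_piece0 hef).2 ht
    | exact (mem_piece1 hef).2 ht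
    | refine key ?_
      rw [ht] at htt
      simp only [map_neg, map_smul, ht] at htt
      first
      | rw [two_smul]; nth_rewrite 1 [← neg_neg (prod g x y z).1]; rw [htt]; simp
      | rw [two_smul, two_smul] at htt; rw [two_smul]; simpa using htt

end Pair
end ExtPair

/-- An algebra with a bilinear product and a family of submodules, its homogeneous components. -/
structure GradedAlg (K : Type u) [CommRing K] (ι : Type*) where
  Carrier : Type v
  [addCommGroup : AddCommGroup Carrier]
  [module : Module K Carrier]
  bracket : Carrier →ₗ[K] Carrier →ₗ[K] Carrier
  component : ι → Submodule K Carrier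

namespace GradedAlg

attribute [instance] GradedAlg.addCommGroup GradedAlg.module

variable {K : Type u} [CommRing K] {ι : Type*}

/-- Graded isomorphisms: linear bijections preserving products and homogeneous components. -/
structure Iso (L : GradedAlg.{u, v} K ι) (L' : GradedAlg.{u, w} K ι) where
  equiv : L.Carrier ≃ₗ[K] L'.Carrier
  map_bracket : ∀ x y, equiv (L.bracket x y) = L'.bracket (equiv x) (equiv y)
  map_component : ∀ i, (L.component i).map equiv.toLinearMap = L'.component i

/-- Being graded isomorphic, as an equivalence relation. -/
def isoSetoid : Setoid (GradedAlg.{u, v} K ι) where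
  r L L' := Nonempty (Iso L L')
  iseqv := by
    refine ⟨fun L => ⟨⟨LinearEquiv.refl K _, fun _ _ => rfl, fun i => Submodule.map_id _⟩⟩,
      fun {L L'} ⟨e⟩ => ⟨⟨e.equiv.symm, fun x y => e.equiv.injective ?_, fun i => ?_⟩⟩,
      fun {L L' L''} ⟨e⟩ ⟨f⟩ => ⟨⟨e.equiv.trans f.equiv, fun x y => ?_, fun i => ?_⟩⟩⟩
    · simp [e.map_bracket]
    · rw [← e.map_component i]
      exact ((L.component i).map_symm_eq_iff e.equiv).2 rfl
    · simp [e.map_bracket, f.map_bracket]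
    · rw [← f.map_component, ← e.map_component]
      exact Submodule.map_comp _ _ _

end GradedAlg

namespace ExtPair

variable {K : Type u} [CommRing K]

section Envelope

variable {M : Type v} {N : Type w} [AddCommGroup M] [AddCommGroup N] [Module K M] [Module K N]
  [Module.Finite K N] [Module.Projective K N] (g : M →ₗ[K] N →ₗ[K] K)

/-- The pairs `(A, B) + c h₀`, where `(A, B)` is skew for `g` and `tr(B) + 3c = 0`. -/
def E0 : Submodule K (Module.End K M × Module.End K N × K) where
  carrier := {X | IsSkew g X.1 X.2.1 ∧ projTrace X.2.1 + 3 * X.2.2 = 0}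
  zero_mem' := ⟨fun m n => by simp, by simp⟩
  add_mem' := by
    rintro X Y ⟨hX, hX'⟩ ⟨hY, hY'⟩
    refine ⟨fun m n => ?_, ?_⟩
    · have h1 := hX m n
      have h2 := hY m n
      simp only [Prod.fst_add, Prod.snd_add, LinearMap.add_apply, map_add]
      linear_combination h1 + h2
    · simp only [Prod.snd_add, Prod.fst_add, map_add]
      linear_combination hX' + hY'
  smul_mem' := by
    rintro c X ⟨hX, hX'⟩
    refine ⟨fun m n => ?_, ?_⟩
    · have h1 := hX m n
      simp only [Prod.smul_fst, Prod.smul_snd, LinearMap.smul_apply, map_smul, smul_eq_mul]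
      linear_combination c * h1
    · simp only [Prod.smul_snd, Prod.smul_fst, map_smul, smul_eq_mul]
      linear_combination c * hX'

/-- The commutator product of `E0 g`, in which `h₀` is central. -/
def comm : E0 g →ₗ[K] E0 g →ₗ[K] E0 g :=
  LinearMap.mk₂ K (fun X Y =>
    ⟨(X.1.1 * Y.1.1 - Y.1.1 * X.1.1, X.1.2.1 * Y.1.2.1 - Y.1.2.1 * X.1.2.1, 0), by
      obtain ⟨hX, -⟩ := X.2
      obtain ⟨hY, -⟩ := Y.2
      refine ⟨fun m n => ?_, ?_⟩
      · have h1 := hX (Y.1.1 m) n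
        have h2 := hY (X.1.1 m) n
        have h3 := hX m (Y.1.2.1 n)
        have h4 := hY m (X.1.2.1 n)
        simp only [LinearMap.sub_apply, Module.End.mul_apply, map_sub]
        linear_combination h1 - h2 + h3 - h4
      · simp only [map_sub]
        rw [projTrace_comm, sub_self, mul_zero, add_zero]⟩)
    (fun a b c => Subtype.ext <| by
      refine Prod.ext ?_ (Prod.ext ?_ ?_) <;> simp [add_mul, mul_add] <;> abel)
    (fun r a b => Subtype.ext <| by
      refine Prod.ext ?_ (Prod.ext ?_ ?_) <;> simp [smul_sub])
    (fun a b c => Subtype.ext <| by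
      refine Prod.ext ?_ (Prod.ext ?_ ?_) <;> simp [add_mul, mul_add] <;> abel)
    (fun r a b => Subtype.ext <| by
      refine Prod.ext ?_ (Prod.ext ?_ ?_) <;> simp [smul_sub])

/-- The action of `(A, B) + c h₀` on `⋀³ᵏ(N)`: `x ↦ B ∘ x + k c x`. -/
def actPos (n k : ℕ) : E0 g →ₗ[K] ⋀[K]^n N →ₗ[K] ⋀[K]^n N :=
  LinearMap.mk₂ K (fun X x => ⟨der X.1.2.1 x + ((k : K) * X.1.2.2) • x.1,
      add_mem (der_mem _ n x.2) (Submodule.smul_mem _ _ x.2)⟩)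
    (fun a b c => Subtype.ext <| by simp [mul_add, add_smul]; abel)
    (fun r a b => Subtype.ext <| by simp [mul_smul, smul_add, mul_left_comm (k : K) r])
    (fun a b c => Subtype.ext <| by simp; abel)
    (fun r a b => Subtype.ext <| by simp [smul_comm r])

/-- The action of `(A, B) + c h₀` on `⋀³ᵏ(M)`: `x ↦ A ∘ x - k c x`. -/
def actNeg (n k : ℕ) : E0 g →ₗ[K] ⋀[K]^n M →ₗ[K] ⋀[K]^n M :=
  LinearMap.mk₂ K (fun X x => ⟨der X.1.1 x - ((k : K) * X.1.2.2) • x.1,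
      sub_mem (der_mem _ n x.2) (Submodule.smul_mem _ _ x.2)⟩)
    (fun a b c => Subtype.ext <| by simp [mul_add, add_smul]; abel)
    (fun r a b => Subtype.ext <| by simp [mul_smul, smul_sub, mul_left_comm (k : K) r])
    (fun a b c => Subtype.ext <| by simp; abel)
    (fun r a b => Subtype.ext <| by simp [smul_sub, smul_comm r])

end Envelope

section Products

variable {M : Type v} {N : Type w} [AddCommGroup M] [AddCommGroup N] [Module K M] [Module K N]

variable (K M) in
/-- The product `⋀³ × ⋀³ → ⋀⁶` of the exterior algebra. -/
def wedge33 : ⋀[K]^3 M →ₗ[K] ⋀[K]^3 M →ₗ[K] ⋀[K]^6 M :=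
  LinearMap.mk₂ K (fun x y => ⟨x * y, mul_mem x.2 y.2⟩)
    (fun a b c => Subtype.ext <| by simp [add_mul])
    (fun r a b => Subtype.ext <| by simp)
    (fun a b c => Subtype.ext <| by simp [mul_add])
    (fun r a b => Subtype.ext <| by simp)

/-- The action `⋀³(M) × ⋀⁶(N) → ⋀³(N)`. -/
def contr36 (g : M →ₗ[K] N →ₗ[K] K) : ⋀[K]^3 M →ₗ[K] ⋀[K]^6 N →ₗ[K] ⋀[K]^3 N :=
  LinearMap.mk₂ K (fun a x => ⟨contr g a x, contr_mem g 3 3 a.2 x.2⟩)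
    (fun a b c => Subtype.ext <| by simp)
    (fun r a b => Subtype.ext <| by simp)
    (fun a b c => Subtype.ext <| by simp)
    (fun r a b => Subtype.ext <| by simp)

end Products

section Envelope

variable {M : Type v} {N : Type w} [AddCommGroup M] [AddCommGroup N] [Module K M] [Module K N]
  [Module.Finite K N] [Module.Projective K N] (g : M →ₗ[K] N →ₗ[K] K) (hg : g.IsPerfPair)
  (hN : ∀ p, Module.rankAtStalk (R := K) N p = 6)

/-- `[p, q] = (E(p, q), -E(q, p)) + (p · q) h₀` for `p` in `⋀³(M)` and `q` in `⋀³(N)`. -/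
def pair1 : ⋀[K]^3 M →ₗ[K] ⋀[K]^3 N →ₗ[K] E0 g :=
  LinearMap.mk₂ K (fun p q =>
    ⟨(eOp g.flip p.1 q.1, -eOp g q.1 p.1, dot g p.1 q.1), eOp_isSkew g 2 q.2 p.2, by
      have h := projTrace_eOp (g := g.flip) hg 2 q.2 p.2
      rw [LinearMap.flip_flip] at h
      simp only [map_neg, h]
      push_cast
      ring⟩)
    (fun a b c => Subtype.ext <| Prod.ext
      (LinearMap.congr_fun ((eOp g.flip).map_add a.1 b.1) c.1) <| Prod.ext
        ((congrArg Neg.neg ((eOp g c.1).map_add a.1 b.1)).trans (neg_add _ _))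
        (LinearMap.congr_fun ((dot g).map_add a.1 b.1) c.1))
    (fun r a b => Subtype.ext <| Prod.ext
      (LinearMap.congr_fun ((eOp g.flip).map_smul r a.1) b.1) <| Prod.ext
        ((congrArg Neg.neg ((eOp g b.1).map_smul r a.1)).trans (smul_neg r (eOp g b.1 a.1)).symm)
        (LinearMap.congr_fun ((dot g).map_smul r a.1) b.1))
    (fun a b c => Subtype.ext <| Prod.ext ((eOp g.flip a.1).map_add b.1 c.1) <| Prod.ext
      ((congrArg Neg.neg (LinearMap.congr_fun ((eOp g).map_add b.1 c.1) a.1)).trans (neg_add _ _))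
      ((dot g a.1).map_add b.1 c.1))
    (fun r a b => Subtype.ext <| Prod.ext ((eOp g.flip a.1).map_smul r b.1) <| Prod.ext
      ((congrArg Neg.neg (LinearMap.congr_fun ((eOp g).map_smul r b.1) a.1)).trans
        (smul_neg r (eOp g b.1 a.1)).symm)
      ((dot g a.1).map_smul r b.1))

/-- The element `(id, -id) + 2 h₀`. -/
def hElt : E0 g :=
  ⟨(LinearMap.id, -LinearMap.id, 2), fun m n => by simp, by
    simp only [map_neg, projTrace_id hN]
    norm_num⟩

/-- `[p, q] = -(p · q) ((-id, id) - 2 h₀)` for `p` in `⋀⁶(M)` and `q` in `⋀⁶(N)`. -/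
def pair2 : ⋀[K]^6 M →ₗ[K] ⋀[K]^6 N →ₗ[K] E0 g :=
  ((dot g).domRestrict₁₂ (⋀[K]^6 M) (⋀[K]^6 N)).compr₂
    (LinearMap.toSpanSingleton K _ (hElt g hN))

/-- The module `⋀⁶(M) ⊕ ⋀³(M) ⊕ E₀ ⊕ ⋀³(N) ⊕ ⋀⁶(N)`. -/
abbrev Env : Type _ := ⋀[K]^6 M × ⋀[K]^3 M × E0 g × ⋀[K]^3 N × ⋀[K]^6 N

/-- The bracket, as a function. -/
def brFun (p q : Env g) : Env g :=
  (actNeg g 6 2 p.2.2.1 q.1 - actNeg g 6 2 q.2.2.1 p.1 + wedge33 K M p.2.1 q.2.1,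
    actNeg g 3 1 p.2.2.1 q.2.1 - actNeg g 3 1 q.2.2.1 p.2.1
      + contr36 g.flip p.2.2.2.1 q.1 - contr36 g.flip q.2.2.2.1 p.1,
    comm g p.2.2.1 q.2.2.1 + pair1 g hg p.2.1 q.2.2.2.1 - pair1 g hg q.2.1 p.2.2.2.1
      + pair2 g hN p.1 q.2.2.2.2 - pair2 g hN q.1 p.2.2.2.2,
    actPos g 3 1 p.2.2.1 q.2.2.2.1 - actPos g 3 1 q.2.2.1 p.2.2.2.1
      + contr36 g p.2.1 q.2.2.2.2 - contr36 g q.2.1 p.2.2.2.2,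
    actPos g 6 2 p.2.2.1 q.2.2.2.2 - actPos g 6 2 q.2.2.1 p.2.2.2.2
      + wedge33 K N p.2.2.2.1 q.2.2.2.1)

/-- The bracket of the 5-graded Lie algebra attached to `g`. -/
def br : Env g →ₗ[K] Env g →ₗ[K] Env g :=
  LinearMap.mk₂ K (brFun g hg hN)
    (fun a b c => by
      refine Prod.ext ?_ (Prod.ext ?_ (Prod.ext ?_ (Prod.ext ?_ ?_))) <;>
        simp only [brFun, Prod.fst_add, Prod.snd_add, map_add, LinearMap.add_apply] <;> abel)
    (fun r a b => by
      refine Prod.ext ?_ (Prod.ext ?_ (Prod.ext ?_ (Prod.ext ?_ ?_))) <;>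
        simp only [brFun, Prod.smul_fst, Prod.smul_snd, map_smul, LinearMap.smul_apply, smul_add,
          smul_sub])
    (fun a b c => by
      refine Prod.ext ?_ (Prod.ext ?_ (Prod.ext ?_ (Prod.ext ?_ ?_))) <;>
        simp only [brFun, Prod.fst_add, Prod.snd_add, map_add, LinearMap.add_apply] <;> abel)
    (fun r a b => by
      refine Prod.ext ?_ (Prod.ext ?_ (Prod.ext ?_ (Prod.ext ?_ ?_))) <;>
        simp only [brFun, Prod.smul_fst, Prod.smul_snd, map_smul, LinearMap.smul_apply, smul_add,
          smul_sub])

/-- The submodule of `Env g` with the given components. -/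
def sub5 (a : Submodule K (⋀[K]^6 M)) (b : Submodule K (⋀[K]^3 M)) (c : Submodule K (E0 g))
    (d : Submodule K (⋀[K]^3 N)) (e : Submodule K (⋀[K]^6 N)) : Submodule K (Env g) :=
  a.prod (b.prod (c.prod (d.prod e)))

/-- The 5-grading. -/
def gr5 : ℤ → Submodule K (Env g)
  | -2 => sub5 g ⊤ ⊥ ⊥ ⊥ ⊥
  | -1 => sub5 g ⊥ ⊤ ⊥ ⊥ ⊥
  | 0 => sub5 g ⊥ ⊥ ⊤ ⊥ ⊥
  | 1 => sub5 g ⊥ ⊥ ⊥ ⊤ ⊥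
  | 2 => sub5 g ⊥ ⊥ ⊥ ⊥ ⊤
  | _ => ⊥

variable (e : M) (f : N)

/-- The elements `(A, B) + c h₀` of `E₀` such that `B` stabilizes `K f` and `U`, the kernel of
`g e`. -/
def e00 : Submodule K (E0 g) where
  carrier := {X | X.1.2.1 f ∈ Submodule.span K {f} ∧ ∀ u, g e u = 0 → g e (X.1.2.1 u) = 0}
  zero_mem' := by simp
  add_mem' := fun hX hY => ⟨add_mem hX.1 hY.1, fun u hu => by simp [hX.2 u hu, hY.2 u hu]⟩
  smul_mem' := fun c X hX => ⟨Submodule.smul_mem _ c hX.1, fun u hu => by simp [hX.2 u hu]⟩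

/-- The elements `(A, B)` of `E₀` with `B` in `Hom(U, K f)`. -/
def e01 : Submodule K (E0 g) where
  carrier := {X | X.1.2.2 = 0 ∧ X.1.2.1 f = 0 ∧ ∀ n, X.1.2.1 n ∈ Submodule.span K {f}}
  zero_mem' := by simp
  add_mem' := fun hX hY => ⟨by simp [hX.1, hY.1], by simp [hX.2.1, hY.2.1],
    fun n => add_mem (hX.2.2 n) (hY.2.2 n)⟩
  smul_mem' := fun c X hX => ⟨by simp [hX.1], by simp [hX.2.1],
    fun n => Submodule.smul_mem _ c (hX.2.2 n)⟩

/-- The elements `(A, B)` of `E₀` with `B` in `Hom(K f, U)`. -/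
def e0m1 : Submodule K (E0 g) where
  carrier := {X | X.1.2.2 = 0 ∧ g e (X.1.2.1 f) = 0 ∧ ∀ u, g e u = 0 → X.1.2.1 u = 0}
  zero_mem' := by simp
  add_mem' := fun hX hY => ⟨by simp [hX.1, hY.1], by simp [hX.2.1, hY.2.1],
    fun u hu => by simp [hX.2.2 u hu, hY.2.2 u hu]⟩
  smul_mem' := fun c X hX => ⟨by simp [hX.1], by simp [hX.2.1],
    fun u hu => by simp [hX.2.2 u hu]⟩

/-- The `BC₂`-grading; the root `i₁ α₁ + i₂ α₂` is written `(i₁, i₂)`. -/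
def grBC2 : ℤ × ℤ → Submodule K (Env g)
  | (1, 0) => sub5 g ⊥ ⊥ ⊥ (piece0 g e) ⊥
  | (-1, 0) => sub5 g ⊥ (piece0 g.flip f) ⊥ ⊥ ⊥
  | (1, 1) => sub5 g ⊥ ⊥ ⊥ (piece1 g e f) ⊥
  | (-1, -1) => sub5 g ⊥ (piece1 g.flip f e) ⊥ ⊥ ⊥
  | (2, 1) => sub5 g ⊥ ⊥ ⊥ ⊥ ⊤
  | (-2, -1) => sub5 g ⊤ ⊥ ⊥ ⊥ ⊥
  | (0, 0) => sub5 g ⊥ ⊥ (e00 g e f) ⊥ ⊥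
  | (0, 1) => sub5 g ⊥ ⊥ (e01 g f) ⊥ ⊥
  | (0, -1) => sub5 g ⊥ ⊥ (e0m1 g e f) ⊥ ⊥
  | _ => ⊥

end Envelope
end ExtPair

/-- A nonsingular pairing `g : M⁻ × M⁺ → K` of finitely generated projective modules of rank 6. -/
structure ExtTriple (K : Type u) [CommRing K] where
  Mneg : Type v
  Mpos : Type v
  [addNeg : AddCommGroup Mneg]
  [addPos : AddCommGroup Mpos]
  [modNeg : Module K Mneg]
  [modPos : Module K Mpos]
  [finNeg : Module.Finite K Mneg]
  [finPos : Module.Finite K Mpos]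
  [projNeg : Module.Projective K Mneg]
  [projPos : Module.Projective K Mpos]
  g : Mneg →ₗ[K] Mpos →ₗ[K] K
  perf : g.IsPerfPair
  rank_neg : ∀ p, Module.rankAtStalk (R := K) Mneg p = 6
  rank_pos : ∀ p, Module.rankAtStalk (R := K) Mpos p = 6

attribute [instance] ExtTriple.addNeg ExtTriple.addPos ExtTriple.modNeg ExtTriple.modPos
  ExtTriple.finNeg ExtTriple.finPos ExtTriple.projNeg ExtTriple.projPos

/-- A triple `(M⁻, M⁺, g)` with elements `e⁻`, `e⁺` such that `g(e⁻, e⁺) = 1`. -/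
structure ExtQuad (K : Type u) [CommRing K] extends ExtTriple.{u, v} K where
  eneg : Mneg
  epos : Mpos
  g_e : g eneg epos = 1

variable {K : Type u} [CommRing K]

namespace ExtTriple

/-- The pair `Λ₃(M⁻, M⁺, g) = (⋀³(M⁻), ⋀³(M⁺))`. -/
def lambda3 (T : ExtTriple.{u, v} K) : TrilinearPair K where
  Neg := ⋀[K]^3 T.Mneg
  Pos := ⋀[K]^3 T.Mpos
  prodNeg := ExtPair.prod T.g.flip
  prodPos := ExtPair.prod T.g

/-- The 5-graded Lie algebra `E(M⁻, M⁺, g)`. -/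
def lie (T : ExtTriple.{u, v} K) : GradedAlg K ℤ where
  Carrier := ExtPair.Env T.g
  bracket := ExtPair.br T.g T.perf T.rank_pos
  component := ExtPair.gr5 T.g

end ExtTriple

namespace ExtQuad

/-- The SP-graded pair `Λ₃(M⁻, M⁺, g, e)`, over a ring containing `1/6`. -/
def lambda3 (h6 : IsUnit (6 : K)) (Q : ExtQuad.{u, v} K) : SPGradedPair K where
  toTrilinearPair := Q.toExtTriple.lambda3
  negGr := ExtPair.spGr Q.g.flip Q.epos Q.eneg
  posGr := ExtPair.spGr Q.g Q.eneg Q.epos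
  neg_isCompl := ExtPair.spGr_isCompl (g := Q.g.flip) Q.g_e
  pos_isCompl := ExtPair.spGr_isCompl Q.g_e
  neg_support := SPGradedPair.gr01_support _ _
  pos_support := SPGradedPair.gr01_support _ _
  neg_mem := ExtPair.prod_mem (g := Q.g.flip) Q.g_e h6
  pos_mem := ExtPair.prod_mem Q.g_e h6

/-- The reflection of the SP-graded pair `Λ₃`. -/
def lambda3Reflection (h6 : IsUnit (6 : K)) (Q : ExtQuad.{u, v} K) : SPGradedPair K :=
  (Q.lambda3 h6).reflect

/-- The Lie algebra `E(M⁻, M⁺, g)` with the `BC₂`-grading given by `e`. -/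
def lie (Q : ExtQuad.{u, v} K) : GradedAlg K (ℤ × ℤ) where
  Carrier := ExtPair.Env Q.g
  bracket := ExtPair.br Q.g Q.perf Q.rank_pos
  component := ExtPair.grBC2 Q.g Q.eneg Q.epos

end ExtQuad

section Rank

theorem ExtPair.rank_dual (M : Type v) [AddCommGroup M] [Module K M] [Module.Finite K M]
    [Module.Projective K M] (p : PrimeSpectrum K) :
    Module.rankAtStalk (R := K) (Module.Dual K M) p = Module.rankAtStalk (R := K) M p := by
  let S := p.asIdeal.primeCompl
  let L := Localization.AtPrime p.asIdeal
  have : Module.FinitePresentation K M := Module.finitePresentation_of_projective K M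
  have : Module.Free L (LocalizedModule S M) := Module.free_of_flat_of_isLocalRing
  let e := (IsLocalizedModule.linearEquiv S (LocalizedModule.mkLinearMap S (Module.Dual K M))
    (IsLocalizedModule.mapExtendScalars S (LocalizedModule.mkLinearMap S M)
      (Algebra.linearMap K L) L)).extendScalarsOfIsLocalization S L
  rw [Module.rankAtStalk, Module.rankAtStalk, e.finrank_eq]
  exact Module.finrank_linearMap_self L L _

theorem ExtPair.rank_pic (I : Type v) [AddCommGroup I] [Module K I] [Module.Invertible K I]
    (p : PrimeSpectrum K) : Module.rankAtStalk (R := K) I p = 1 := by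
  have : Module.Free (Localization.AtPrime p.asIdeal) (LocalizedModule p.asIdeal.primeCompl I) :=
    Module.free_of_flat_of_isLocalRing
  exact Module.Invertible.finrank_eq_one _ _

variable (I : Type v) [AddCommGroup I] [Module K I] [Module.Finite K I] [Module.Projective K I]

theorem ExtPair.rank_six (hI : ∀ p, Module.rankAtStalk (R := K) I p = 1) (p : PrimeSpectrum K) :
    Module.rankAtStalk (R := K) ((Fin 5 → K) × I) p = 6 := by
  have : Nontrivial K := p.nontrivial
  rw [Module.rankAtStalk_prod, Pi.add_apply, hI]
  simp

variable (K) in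
/-- The triple `(M_I*, M_I, can)` with `M_I = K⁵ ⊕ I`, for a module `I` of rank 1. -/
def tripleOf (hI : ∀ p, Module.rankAtStalk (R := K) I p = 1) : ExtTriple K where
  Mneg := Module.Dual K ((Fin 5 → K) × I)
  Mpos := (Fin 5 → K) × I
  g := LinearMap.id
  perf := inferInstance
  rank_neg := fun p => (ExtPair.rank_dual _ p).trans (ExtPair.rank_six I hI p)
  rank_pos := ExtPair.rank_six I hI

variable (K) in
/-- The quadruple `(M_I*, M_I, can, e_I)`, where `e_I⁺` is the first standard vector of `K⁵`, and
`e_I⁻` is the first coordinate. -/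
def quadOf (hI : ∀ p, Module.rankAtStalk (R := K) I p = 1) : ExtQuad K where
  toExtTriple := tripleOf K I hI
  eneg := (LinearMap.proj 0 ∘ₗ LinearMap.fst K (Fin 5 → K) I : Module.Dual K ((Fin 5 → K) × I))
  epos := ((Pi.single 0 1, 0) : (Fin 5 → K) × I)
  g_e := by
    change (Pi.single 0 1 : Fin 5 → K) 0 = 1
    simp

end Rank

end

/-! All the structures are functorial in the pairing, or in the quadruple, so an isomorphism `I ≃
I'` yields isomorphic quadruples and hence isomorphisms of everything built from them. The substance
lies in recovering `I` from the weakest structures, and, over a Dedekind domain, in showing that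
every triple or quadruple is a standard one.

The module `I` is recovered as the top exterior power: `⋀⁶(M_I) ≃ I` (`hasTopPower_free_prod`). In
the Lie algebras `⋀⁶(M⁺)` is visible as the component of degree `2`, resp. `(2, 1)`.

An ungraded pair has no such component. It does have the invariant `kSpan`, the span in `Hom(P⁻,
P⁺)` of the operators `K(x, z) : y ↦ {x, y, z} - {z, y, x}`. For `⋀₃` the identity `contr_mul_eq`
gives `K(x, z) y = -y · (xz)`. The products `xz` span `⋀⁶(M⁺)` and contraction is nondegenerate
(`eq_zero_of_contr`), so `kSpan` is `⋀⁶(M⁺)`.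

In the reflection the products of `⋀³(U⁻)` with itself and of `⋀²(U⁺)e⁺` with itself vanish, so only
the brackets between these two pieces contribute to `K(a, c)`. They are rank-one operators given by
a vector `ψ(a, c)` of `U⁻` (`reflProd_sub_reflProd`). Up to the factor `12`, wedging up from `U` to
`⋀³(U)` and contracting back is the identity. When `6` is invertible this shows that the vectors `ψ`
span `U⁻` and that `U⁻` acts faithfully, so here `kSpan` is `U⁻`. Then `K ⊕ U⁻ = M_I*` determines
`M_I`, and `⋀⁶(M_I) ≃ I` again.

Over a Dedekind domain, Steinitz' theorem writes a projective module of rank `n + 1` as `Kⁿ ⊕ I`. It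
is applied to `M⁺` for triples and to `U⁺` for quadruples. A perfect pairing is then the canonical
one for `M⁺`, which gives surjectivity; injectivity is the recovery of `I`. -/

namespace ExtPair

variable {K : Type u} [CommRing K]

/-! ### Projective modules of rank one. -/

section RankOne

variable {I : Type v} [AddCommGroup I] [Module K I]

/-- The evaluation `I* ⊗ I → K` hits `1`, the trace of the identity, so it is onto; a surjection
between projective modules of the same rank is bijective. -/
theorem invertible_of_rank_one [Module.Finite K I] [Module.Projective K I]
    (hI : ∀ p, Module.rankAtStalk (R := K) I p = 1) : Module.Invertible K I where
  bijective := by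
    refine Module.bijective_of_surjective_of_rankAtStalk_eq (R := K)
      (M := Module.Dual K I ⊗[K] I) (N := K) (fun r => ?_) fun m _ => ?_
    · obtain ⟨t, ht⟩ := (dualTensorHom_bijective (R := K) (M := I) (N := I)).2 LinearMap.id
      refine ⟨r • t, ?_⟩
      rw [map_smul, ← projTrace_dualTensorHom, ht, projTrace_id hI]
      simp
    · have : Nontrivial K := (PrimeSpectrum.mk m inferInstance).nontrivial
      rw [Module.rankAtStalk_tensorProduct, Module.rankAtStalk_self, Pi.mul_apply, rank_dual, hI,
        mul_one, Pi.one_apply]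

/-- The swap on `I ⊗ I` is the identity; `f` is applied to the first factor of `x ⊗ y = y ⊗ x`. -/
theorem dual_smul_comm [Module.Invertible K I] (f : Module.Dual K I) (x y : I) :
    f x • y = f y • x := by
  simpa using congrArg ((TensorProduct.lid K I).toLinearMap ∘ₗ LinearMap.rTensor I f)
    (Module.Invertible.tmul_comm (R := K) (m₁ := x) (m₂ := y))

/-- For `r = f(p)` one has `r x = f(x) p` and `r y = f(y) p`, so `r²` kills `x ∧ y` because `p ∧ p =
0`. A dual basis supplies scalars `r` with sum `1`, the trace of the identity, and their squares
still generate the unit ideal. -/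
theorem ι_mul_ι_eq_zero [Module.Invertible K I] (x y : I) :
    ExteriorAlgebra.ι K x * ExteriorAlgebra.ι K y = 0 := by
  have hid : projTrace (LinearMap.id : Module.End K I) = 1 := by
    simpa using projTrace_id (n := 1) (rank_pic (K := K) I)
  obtain ⟨s, hs, ht⟩ := exists_dual_basis K I
  rw [ht] at hid
  simp only [LinearMap.id_apply] at hid
  have hle : Ideal.span ((fun p : Module.Dual K I × I => p.1 p.2) '' s) = ⊤ := by
    rw [Ideal.eq_top_iff_one, ← hid]
    exact sum_mem fun p hp => Ideal.subset_span ⟨p, hp, rfl⟩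
  have h2 := Ideal.span_pow_eq_top _ hle 2
  have h3 : ∀ r : K, r ∈ Ideal.span ((fun x => x ^ 2) '' ((fun p : Module.Dual K I × I => p.1 p.2) '' s)) →
      r • (ExteriorAlgebra.ι K x * ExteriorAlgebra.ι K y) = 0 := by
    intro r hr
    induction hr using Submodule.span_induction with
    | zero => simp
    | add a b _ _ ha hb => rw [add_smul, ha, hb, add_zero]
    | smul a b _ hb => rw [smul_assoc, hb, smul_zero]
    | mem r hr =>
      obtain ⟨_, ⟨p, -, rfl⟩, rfl⟩ := hr
      dsimp only
      rw [sq, mul_smul, ← mul_smul_comm, ← map_smul, ← smul_mul_assoc, ← map_smul,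
        dual_smul_comm p.1 p.2 x, dual_smul_comm p.1 p.2 y, map_smul, map_smul, smul_mul_smul_comm,
        ExteriorAlgebra.ι_sq_zero, smul_zero]
  simpa using h3 1 (h2 ▸ Submodule.mem_top)

end RankOne

/-! ### The top exterior power of `Kⁿ ⊕ I`. -/

section TopPower

variable {M : Type v} {N : Type w} [AddCommGroup M] [AddCommGroup N] [Module K M] [Module K N]

theorem map_mem (f : M →ₗ[K] N) (k : ℕ) {x : ExteriorAlgebra K M} (hx : x ∈ ⋀[K]^k M) :
    ExteriorAlgebra.map f x ∈ ⋀[K]^k N := by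
  induction k generalizing x with
  | zero =>
    obtain ⟨r, rfl⟩ := mem_zero_iff.1 hx
    rw [AlgHom.commutes]
    exact mem_zero_iff.2 ⟨r, rfl⟩
  | succ k ih =>
    induction hx using power_ind with
    | hm m y hy =>
      rw [map_mul, ExteriorAlgebra.map_apply_ι]
      exact ι_mul_mem _ (ih hy)
    | ha a b _ _ ha hb => rw [map_add]; exact add_mem ha hb

/-- The isomorphism of exterior powers induced by a linear equivalence. -/
noncomputable def powEquiv (f : M ≃ₗ[K] N) (k : ℕ) : ⋀[K]^k M ≃ₗ[K] ⋀[K]^k N :=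
  LinearEquiv.ofLinearMap
    ((ExteriorAlgebra.map f.toLinearMap).toLinearMap.restrict fun _ hx => map_mem _ k hx)
    ((ExteriorAlgebra.map f.symm.toLinearMap).toLinearMap.restrict fun _ hx => map_mem _ k hx)
    (by
      refine LinearMap.ext fun x => Subtype.ext ?_
      change (((ExteriorAlgebra.map f.toLinearMap).comp
        (ExteriorAlgebra.map f.symm.toLinearMap)) x.1 : ExteriorAlgebra K N) = x.1
      rw [ExteriorAlgebra.map_comp_map]; simp)
    (by
      refine LinearMap.ext fun x => Subtype.ext ?_
      change (((ExteriorAlgebra.map f.symm.toLinearMap).comp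
        (ExteriorAlgebra.map f.toLinearMap)) x.1 : ExteriorAlgebra K M) = x.1
      rw [ExteriorAlgebra.map_comp_map]; simp)

@[simp]
theorem coe_powEquiv (f : M ≃ₗ[K] N) (k : ℕ) (x : ⋀[K]^k M) :
    (powEquiv f k x : ExteriorAlgebra K N) = ExteriorAlgebra.map f.toLinearMap x.1 := rfl

variable (K M) in
/-- The exterior powers of `M` vanish above degree `k`, and `⋀ᵏ(M)` is isomorphic to `I`. -/
def HasTopPower (k : ℕ) (I : Type w) [AddCommGroup I] [Module K I] : Prop :=
  (∀ x ∈ ⋀[K]^(k + 1) M, x = 0) ∧ Nonempty (⋀[K]^k M ≃ₗ[K] I)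

theorem HasTopPower.congr {k : ℕ} {I : Type v'} [AddCommGroup I] [Module K I]
    (h : HasTopPower K M k I) (f : M ≃ₗ[K] N) : HasTopPower K N k I := by
  obtain ⟨h0, ⟨e⟩⟩ := h
  refine ⟨fun x hx => ?_, ⟨(powEquiv f k).symm ≪≫ₗ e⟩⟩
  have h1 : (powEquiv f (k + 1)).symm ⟨x, hx⟩ = 0 := Subtype.ext (h0 _ (Subtype.prop _))
  simpa using h1

theorem hasTopPower_one (I : Type v) [AddCommGroup I] [Module K I] [Module.Invertible K I] :
    HasTopPower K I 1 I := by
  refine ⟨fun x hx => ?_, ⟨exteriorPower.oneEquiv K I⟩⟩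
  induction hx using power_ind with
  | hm m y hy =>
    obtain ⟨n, rfl⟩ := mem_one_iff.1 hy
    exact ι_mul_ι_eq_zero m n
  | ha a b _ _ ha hb => rw [ha, hb, add_zero]

/-- With `E = (1, 0)` and `c` the contraction by the first coordinate, every `x` is the sum of `i (p
x)`, coming from `⋀(M)`, and `E ∧ c x`. In degree `k + 1` the first summand vanishes, and `x ↦ p (c
x)` and `y ↦ E ∧ i y` are inverse to each other. -/
theorem HasTopPower.prod {k : ℕ} {I : Type v'} [AddCommGroup I] [Module K I]
    (h : HasTopPower K M k I) : HasTopPower K (K × M) (k + 1) I := by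
  obtain ⟨h0, ⟨e⟩⟩ := h
  let p : ExteriorAlgebra K (K × M) →ₐ[K] ExteriorAlgebra K M :=
    ExteriorAlgebra.map (LinearMap.snd K K M)
  let i : ExteriorAlgebra K M →ₐ[K] ExteriorAlgebra K (K × M) :=
    ExteriorAlgebra.map (LinearMap.inr K K M)
  have hpi : ∀ x, p (i x) = x := fun x => by
    change ((ExteriorAlgebra.map _).comp (ExteriorAlgebra.map _)) x = x
    rw [ExteriorAlgebra.map_comp_map]; simp
  let E : ExteriorAlgebra K (K × M) := ExteriorAlgebra.ι K (1, 0)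
  let c : ExteriorAlgebra K (K × M) →ₗ[K] ExteriorAlgebra K (K × M) :=
    contr LinearMap.id (ExteriorAlgebra.ι K (LinearMap.fst K K M))
  -- The projection of `K × M` along `K (1, 0)` factors through `M`, so `map_eq` becomes the
  -- decomposition `hdec`.
  have hi : ∀ x, ExteriorAlgebra.map (LinearMap.id -
      ((LinearMap.id : _ →ₗ[K] Module.Dual K (K × M)) (LinearMap.fst K K M)).smulRight (1, 0)) x =
        i (p x) := fun x => by
    change _ = ((ExteriorAlgebra.map _).comp (ExteriorAlgebra.map _)) x
    rw [ExteriorAlgebra.map_comp_map]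
    congr 2
    ext <;> simp
  have hdec : ∀ x, x = i (p x) + E * c x := fun x => by
    rw [← hi, map_eq, tau_apply, sub_add_cancel]
  have hcc : ∀ x, c (c x) = 0 := fun x => contr_contr_self _ _ x
  have hci : ∀ x, c (i x) = 0 := fun x => by
    induction x using leftInd with
    | h0 r => rw [AlgHom.commutes]; exact contr_ι_algebraMap _ _ r
    | ha x y hx hy => rw [map_add, map_add, hx, hy, add_zero]
    | hm m x hx =>
      rw [map_mul, ExteriorAlgebra.map_apply_ι]
      refine (contr_ι_ι_mul _ _ _ _).trans ?_
      erw [hx]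
      simp
  have hcE : ∀ x, c (E * i x) = i x := fun x => by
    refine (contr_ι_ι_mul _ _ _ _).trans ?_
    erw [hci]
    simp
  have hc : ∀ n, ∀ x ∈ ⋀[K]^(n + 1) (K × M), c x ∈ ⋀[K]^n (K × M) := fun n x hx =>
    contr_ι_mem _ _ n hx
  -- The decomposition of `c x` has no second summand, since `c ∘ c = 0`.
  have hd : ∀ x, c x = i (p (c x)) := fun x => by
    conv_lhs => rw [hdec (c x), hcc, mul_zero, add_zero]
  have hz : ∀ n ≥ k, ∀ x ∈ ⋀[K]^(n + 1) M, x = 0 := by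
    intro n hn
    induction n, hn using Nat.le_induction with
    | base => exact h0
    | succ n hn ih =>
      intro x hx
      induction hx using power_ind with
      | hm m y hy => rw [ih y hy, mul_zero]
      | ha a b _ _ ha hb => rw [ha, hb, add_zero]
  suffices h : ⋀[K]^(k + 1) (K × M) ≃ₗ[K] ⋀[K]^k M from ⟨fun x hx => by
    rw [hdec x, hz (k + 1) (by omega) _ (map_mem _ _ hx), hd x,
      hz k le_rfl _ (map_mem _ _ (hc _ x hx))]
    simp, ⟨h ≪≫ₗ e⟩⟩
  exact LinearEquiv.ofLinearMap
      ((p.toLinearMap ∘ₗ c).restrict fun x hx => map_mem _ k (hc k x hx))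
      ((LinearMap.mulLeft K E ∘ₗ i.toLinearMap).restrict fun x hx => by
        exact ι_mul_mem _ (map_mem _ k hx))
      (by
        refine LinearMap.ext fun x => Subtype.ext ?_
        change p (c (E * i x.1)) = x.1
        rw [hcE, hpi])
      (by
        refine LinearMap.ext fun x => Subtype.ext ?_
        change E * i (p (c x.1)) = x.1
        rw [← hd]
        conv_rhs => rw [hdec x.1, hz k le_rfl _ (map_mem _ _ x.2), map_zero, zero_add])

theorem hasTopPower_free_prod (n : ℕ) (I : Type v) [AddCommGroup I] [Module K I]
    [Module.Invertible K I] : HasTopPower K ((Fin n → K) × I) (n + 1) I := by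
  induction n with
  | zero => exact (hasTopPower_one I).congr (LinearEquiv.uniqueProd (R := K) (M := I) (M₂ := Fin 0 → K)).symm
  | succ n ih =>
    exact ih.prod.congr ((LinearEquiv.prodAssoc K K (Fin n → K) I).symm ≪≫ₗ
      LinearEquiv.prodCongr (Fin.consLinearEquiv K fun _ => K) (LinearEquiv.refl K I))

end TopPower
end ExtPair

namespace ExtPair

variable {K : Type u} [CommRing K]

/-! ### Functoriality of the constructions in the pairing. -/

section Functoriality

variable {M : Type v} {N : Type w} [AddCommGroup M] [AddCommGroup N] [Module K M] [Module K N]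
  {M' : Type v'} {N' : Type w'} [AddCommGroup M'] [AddCommGroup N'] [Module K M'] [Module K N']
  {g : M →ₗ[K] N →ₗ[K] K} {g' : M' →ₗ[K] N' →ₗ[K] K}

/-- Isomorphisms of pairings. -/
structure PairingEquiv (g : M →ₗ[K] N →ₗ[K] K) (g' : M' →ₗ[K] N' →ₗ[K] K) where
  left : M ≃ₗ[K] M'
  right : N ≃ₗ[K] N'
  map_apply : ∀ m n, g' (left m) (right n) = g m n

/-- The inverse isomorphism. -/
def PairingEquiv.symm (φ : PairingEquiv g g') : PairingEquiv g' g where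
  left := φ.left.symm
  right := φ.right.symm
  map_apply m n := by rw [← φ.map_apply]; simp

/-- The isomorphism of the flipped pairings. -/
def PairingEquiv.flip (φ : PairingEquiv g g') : PairingEquiv g.flip g'.flip where
  left := φ.right
  right := φ.left
  map_apply m n := φ.map_apply n m

theorem map_der (f : M →ₗ[K] M') {A : Module.End K M} {A' : Module.End K M'}
    (h : ∀ m, f (A m) = A' (f m)) (x : ExteriorAlgebra K M) :
    ExteriorAlgebra.map f (der A x) = der A' (ExteriorAlgebra.map f x) := by
  induction x using leftInd with
  | h0 r => simp only [der_algebraMap, map_zero, AlgHom.commutes]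
  | ha x y hx hy => simp only [map_add, hx, hy]
  | hm m x hx =>
    simp only [der_ι_mul, map_add, map_mul, ExteriorAlgebra.map_apply_ι, hx, h]

theorem algebraMapInv_map (f : M →ₗ[K] M') (x : ExteriorAlgebra K M) :
    ExteriorAlgebra.algebraMapInv (ExteriorAlgebra.map f x) = ExteriorAlgebra.algebraMapInv x := by
  induction x using leftInd with
  | h0 r => simp only [AlgHom.commutes]
  | ha x y hx hy => simp only [map_add, hx, hy]
  | hm m x hx =>
    simp only [map_mul, ExteriorAlgebra.map_apply_ι]
    simp [ExteriorAlgebra.algebraMapInv]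

variable (φ : PairingEquiv g g')

theorem PairingEquiv.map_contr (a : ExteriorAlgebra K M) (x : ExteriorAlgebra K N) :
    ExteriorAlgebra.map φ.right.toLinearMap (contr g a x) =
      contr g' (ExteriorAlgebra.map φ.left.toLinearMap a)
        (ExteriorAlgebra.map φ.right.toLinearMap x) := by
  induction a using leftInd generalizing x with
  | h0 r => rw [contr_algebraMap, map_smul, AlgHom.commutes, contr_algebraMap]
  | ha a b ha hb => simp only [map_add, LinearMap.add_apply, ha, hb]
  | hm m a ha =>
    rw [contr_ι_mul, map_mul, ExteriorAlgebra.map_apply_ι, contr_ι_mul, ← ha]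
    generalize contr g a x = y
    induction y using leftInd with
    | h0 r => simp only [contr_ι_algebraMap, map_zero, AlgHom.commutes]
    | ha x y hx hy => simp only [map_add, hx, hy]
    | hm n y hy =>
      rw [contr_ι_ι_mul, map_mul, ExteriorAlgebra.map_apply_ι, contr_ι_ι_mul, ← hy, map_sub,
        map_mul, map_smul, ExteriorAlgebra.map_apply_ι]
      simp [φ.map_apply]

theorem PairingEquiv.map_dot (a : ExteriorAlgebra K M) (x : ExteriorAlgebra K N) :
    dot g' (ExteriorAlgebra.map φ.left.toLinearMap a)
      (ExteriorAlgebra.map φ.right.toLinearMap x) = dot g a x := by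
  rw [dot_apply, ← φ.map_contr, algebraMapInv_map, dot_apply]

theorem PairingEquiv.map_eOp (x : ExteriorAlgebra K N) (a : ExteriorAlgebra K M) (v : N) :
    φ.right (eOp g x a v) = eOp g' (ExteriorAlgebra.map φ.right.toLinearMap x)
      (ExteriorAlgebra.map φ.left.toLinearMap a) (φ.right v) := by
  rw [eOp_apply, eOp_apply]
  have h := φ.flip.map_contr (ExteriorAlgebra.ι K v) a
  rw [ExteriorAlgebra.map_apply_ι] at h
  change _ = contr g'.flip (ExteriorAlgebra.ι K (φ.right v)) _ at h
  erw [← h, ← φ.map_contr]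
  exact (LinearMap.congr_fun (ExteriorAlgebra.ιInv_comp_map φ.right.toLinearMap) _).symm

theorem PairingEquiv.map_prod (x : ⋀[K]^3 N) (y : ⋀[K]^3 M) (z : ⋀[K]^3 N) :
    powEquiv φ.right 3 (prod g x y z) =
      prod g' (powEquiv φ.right 3 x) (powEquiv φ.left 3 y) (powEquiv φ.right 3 z) := by
  refine Subtype.ext ?_
  rw [coe_prod, coe_powEquiv, coe_prod, map_sub, map_smul,
    map_der φ.right.toLinearMap (φ.map_eOp x.1 y.1)]
  congr 2
  exact (φ.flip.map_dot x.1 y.1).symm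

/-- Only inclusions then need proof: the one for the inverse isomorphism is another instance of the
same statement. -/
theorem map_submodule_eq {e : M ≃ₗ[K] M'} {S : Submodule K M} {S' : Submodule K M'}
    (h : ∀ x ∈ S, e x ∈ S') (h' : ∀ y ∈ S', e.symm y ∈ S) : S.map e.toLinearMap = S' := by
  refine le_antisymm ?_ fun y hy => ⟨e.symm y, h' y hy, e.apply_symm_apply y⟩
  rintro _ ⟨x, hx, rfl⟩
  exact h x hx

theorem PairingEquiv.map_tau (e : M) (f : N) (x : ExteriorAlgebra K N) :
    ExteriorAlgebra.map φ.right.toLinearMap (tau g e f x) =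
      tau g' (φ.left e) (φ.right f) (ExteriorAlgebra.map φ.right.toLinearMap x) :=
  map_der _ (fun m => by simp [φ.map_apply]) x

theorem powEquiv_wedge33 (f : M ≃ₗ[K] M') (x y : ⋀[K]^3 M) :
    powEquiv f 6 (wedge33 K M x y) = wedge33 K M' (powEquiv f 3 x) (powEquiv f 3 y) :=
  Subtype.ext <| map_mul (ExteriorAlgebra.map f.toLinearMap) x.1 y.1

theorem PairingEquiv.powEquiv_contr36 (a : ⋀[K]^3 M) (x : ⋀[K]^6 N) :
    powEquiv φ.right 3 (contr36 g a x) = contr36 g' (powEquiv φ.left 3 a) (powEquiv φ.right 6 x) :=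
  Subtype.ext <| φ.map_contr _ _

theorem PairingEquiv.powEquiv_contr36_flip (a : ⋀[K]^3 N) (x : ⋀[K]^6 M) :
    powEquiv φ.left 3 (contr36 g.flip a x) =
      contr36 g'.flip (powEquiv φ.right 3 a) (powEquiv φ.left 6 x) :=
  φ.flip.powEquiv_contr36 a x

variable {φ} {e : M} {f : N} {e' : M'} {f' : N'}

/-- The two pieces are the eigenspaces of `tau` for `0` and `1`, and `tau` is natural. -/
theorem PairingEquiv.map_mem_spGr (hef : g e f = 1) (he : φ.left e = e') (hf : φ.right f = f')
    (i : ℤ) {x : ⋀[K]^3 N} (hx : x ∈ spGr g e f i) : powEquiv φ.right 3 x ∈ spGr g' e' f' i := by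
  have hef' : g' e' f' = 1 := by rw [← he, ← hf, φ.map_apply, hef]
  rcases SPGradedPair.mem_gr01 hx with rfl | ⟨rfl, hx⟩ | ⟨rfl, hx⟩
  · simp
  · simp only [spGr, SPGradedPair.gr01, if_true]
    replace hx := (mem_piece0 hef).1 hx
    rw [mem_piece0 hef', coe_powEquiv, ← he, ← hf, ← φ.map_tau, hx, map_zero]
  · simp only [spGr, SPGradedPair.gr01, if_true, one_ne_zero, if_false]
    replace hx := (mem_piece1 hef).1 hx
    rw [mem_piece1 hef', coe_powEquiv, ← he, ← hf, ← φ.map_tau, hx]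

theorem PairingEquiv.map_spGr (hef : g e f = 1) (he : φ.left e = e') (hf : φ.right f = f')
    (i : ℤ) : (spGr g e f i).map (powEquiv φ.right 3).toLinearMap = spGr g' e' f' i :=
  map_submodule_eq (fun _ hx => map_mem_spGr hef he hf i hx) fun _ hy =>
    map_mem_spGr (φ := φ.symm) (by rw [← he, ← hf, φ.map_apply, hef])
      (φ.left.symm_apply_eq.2 he.symm) (φ.right.symm_apply_eq.2 hf.symm) i hy

variable [Module.Finite K N] [Module.Projective K N] [Module.Finite K N'] [Module.Projective K N']

/-- A dual basis of `N` is transported by `f` to express the conjugate as an explicit tensor, whose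
evaluation is the trace of `A`. -/
theorem projTrace_conj (f : N ≃ₗ[K] N') (A : Module.End K N) :
    projTrace (f.conj A) = projTrace A := by
  obtain ⟨s, hs, ht⟩ := exists_dual_basis K N
  have hA : f.conj A = dualTensorHom K N' N' (∑ p ∈ s, (p.1 ∘ₗ f.symm.toLinearMap) ⊗ₜ f (A p.2)) := by
    ext v
    rw [map_sum, LinearMap.sum_apply, LinearEquiv.conj_apply_apply]
    conv_lhs => rw [hs (f.symm v), map_sum, map_sum]
    simp
  rw [hA, projTrace_dualTensorHom, ht]
  simp

variable (φ)

theorem PairingEquiv.conj_mem_E0 {X : Module.End K M × Module.End K N × K} (hX : X ∈ E0 g) :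
    (φ.left.conj X.1, φ.right.conj X.2.1, X.2.2) ∈ E0 g' := by
  refine ⟨fun m n => ?_, ?_⟩
  · have h := hX.1 (φ.left.symm m) (φ.right.symm n)
    rw [← φ.map_apply, ← φ.map_apply] at h
    simpa using h
  · have h := hX.2
    rwa [← projTrace_conj φ.right] at h

/-- The isomorphism of degree `0` parts. -/
noncomputable def PairingEquiv.e0Equiv : E0 g ≃ₗ[K] E0 g' :=
  LinearEquiv.ofLinearMap
    (((LinearEquiv.prodCongr φ.left.conj (LinearEquiv.prodCongr φ.right.conj
      (LinearEquiv.refl K K))).toLinearMap).restrict fun _ hX => φ.conj_mem_E0 hX)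
    (((LinearEquiv.prodCongr φ.symm.left.conj (LinearEquiv.prodCongr φ.symm.right.conj
      (LinearEquiv.refl K K))).toLinearMap).restrict fun _ hX => φ.symm.conj_mem_E0 hX)
    (LinearMap.ext fun X => Subtype.ext <| Prod.ext
      (LinearMap.ext fun m => by simp [PairingEquiv.symm]) <|
      Prod.ext (LinearMap.ext fun m => by simp [PairingEquiv.symm]) rfl)
    (LinearMap.ext fun X => Subtype.ext <| Prod.ext
      (LinearMap.ext fun m => by simp [PairingEquiv.symm]) <|
      Prod.ext (LinearMap.ext fun m => by simp [PairingEquiv.symm]) rfl)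

theorem PairingEquiv.coe_e0Equiv (X : E0 g) :
    (φ.e0Equiv X).1 = (φ.left.conj X.1.1, φ.right.conj X.1.2.1, X.1.2.2) := rfl

theorem PairingEquiv.e0Equiv_comm (X Y : E0 g) :
    φ.e0Equiv (comm g X Y) = comm g' (φ.e0Equiv X) (φ.e0Equiv Y) :=
  Subtype.ext <| Prod.ext (LinearMap.ext fun m => by simp [coe_e0Equiv, comm]) <|
    Prod.ext (LinearMap.ext fun m => by simp [coe_e0Equiv, comm]) rfl

theorem PairingEquiv.powEquiv_actPos (n k : ℕ) (X : E0 g) (x : ⋀[K]^n N) :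
    powEquiv φ.right n (actPos g n k X x) = actPos g' n k (φ.e0Equiv X) (powEquiv φ.right n x) :=
  Subtype.ext <| by
    simp only [actPos, LinearMap.mk₂_apply, coe_powEquiv, map_add, map_smul, coe_e0Equiv]
    rw [map_der]
    simp

theorem PairingEquiv.powEquiv_actNeg (n k : ℕ) (X : E0 g) (x : ⋀[K]^n M) :
    powEquiv φ.left n (actNeg g n k X x) = actNeg g' n k (φ.e0Equiv X) (powEquiv φ.left n x) :=
  Subtype.ext <| by
    simp only [actNeg, LinearMap.mk₂_apply, coe_powEquiv, map_sub, map_smul, coe_e0Equiv]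
    rw [map_der]
    simp

theorem PairingEquiv.e0Equiv_pair1 (hg : g.IsPerfPair) (hg' : g'.IsPerfPair) (p : ⋀[K]^3 M)
    (q : ⋀[K]^3 N) :
    φ.e0Equiv (pair1 g hg p q) = pair1 g' hg' (powEquiv φ.left 3 p) (powEquiv φ.right 3 q) := by
  refine Subtype.ext <| Prod.ext (LinearMap.ext fun m => ?_) <|
    Prod.ext (LinearMap.ext fun n => ?_) (φ.map_dot p.1 q.1).symm
  · obtain ⟨m, rfl⟩ := φ.left.surjective m
    simp only [coe_e0Equiv, pair1, LinearMap.mk₂_apply, LinearEquiv.conj_apply_apply,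
      LinearEquiv.symm_apply_apply, coe_powEquiv]
    exact φ.flip.map_eOp p.1 q.1 m
  · obtain ⟨n, rfl⟩ := φ.right.surjective n
    simp only [coe_e0Equiv, pair1, LinearMap.mk₂_apply, LinearEquiv.conj_apply_apply,
      LinearEquiv.symm_apply_apply, coe_powEquiv, LinearMap.neg_apply, map_neg]
    rw [φ.map_eOp]

theorem PairingEquiv.e0Equiv_pair2 (hN : ∀ p, Module.rankAtStalk (R := K) N p = 6)
    (hN' : ∀ p, Module.rankAtStalk (R := K) N' p = 6) (p : ⋀[K]^6 M) (q : ⋀[K]^6 N) :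
    φ.e0Equiv (pair2 g hN p q) = pair2 g' hN' (powEquiv φ.left 6 p) (powEquiv φ.right 6 q) := by
  have h : φ.e0Equiv (hElt g hN) = hElt g' hN' :=
    Subtype.ext <| Prod.ext (LinearMap.ext fun m => by simp [coe_e0Equiv, hElt]) <|
      Prod.ext (LinearMap.ext fun m => by simp [coe_e0Equiv, hElt]) rfl
  change φ.e0Equiv (dot g p.1 q.1 • hElt g hN) = dot g' _ _ • hElt g' hN'
  rw [map_smul, h]
  congr 1
  exact (φ.map_dot p.1 q.1).symm

/-- The isomorphism of 5-graded Lie algebras induced by an isomorphism of pairings. -/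
noncomputable def PairingEquiv.envEquiv : Env g ≃ₗ[K] Env g' :=
  LinearEquiv.prodCongr (powEquiv φ.left 6) <| LinearEquiv.prodCongr (powEquiv φ.left 3) <|
    LinearEquiv.prodCongr φ.e0Equiv <| LinearEquiv.prodCongr (powEquiv φ.right 3)
      (powEquiv φ.right 6)

theorem PairingEquiv.envEquiv_apply (p : Env g) :
    φ.envEquiv p = (powEquiv φ.left 6 p.1, powEquiv φ.left 3 p.2.1, φ.e0Equiv p.2.2.1,
      powEquiv φ.right 3 p.2.2.2.1, powEquiv φ.right 6 p.2.2.2.2) := rfl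

theorem PairingEquiv.envEquiv_br (hg : g.IsPerfPair) (hg' : g'.IsPerfPair)
    (hN : ∀ p, Module.rankAtStalk (R := K) N p = 6)
    (hN' : ∀ p, Module.rankAtStalk (R := K) N' p = 6) (p q : Env g) :
    φ.envEquiv (br g hg hN p q) = br g' hg' hN' (φ.envEquiv p) (φ.envEquiv q) := by
  change φ.envEquiv (brFun g hg hN p q) = brFun g' hg' hN' (φ.envEquiv p) (φ.envEquiv q)
  simp only [brFun, envEquiv_apply, map_add, map_sub, powEquiv_actPos, powEquiv_actNeg,
    powEquiv_wedge33, powEquiv_contr36, powEquiv_contr36_flip, e0Equiv_comm,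
    φ.e0Equiv_pair1 hg hg', φ.e0Equiv_pair2 hN hN']

theorem PairingEquiv.envEquiv_mem_sub5 {a : Submodule K (⋀[K]^6 M)} {b : Submodule K (⋀[K]^3 M)}
    {c : Submodule K (E0 g)} {d : Submodule K (⋀[K]^3 N)} {r : Submodule K (⋀[K]^6 N)}
    {a' : Submodule K (⋀[K]^6 M')} {b' : Submodule K (⋀[K]^3 M')}
    {c' : Submodule K (E0 g')} {d' : Submodule K (⋀[K]^3 N')} {r' : Submodule K (⋀[K]^6 N')}
    (ha : ∀ x ∈ a, powEquiv φ.left 6 x ∈ a') (hb : ∀ x ∈ b, powEquiv φ.left 3 x ∈ b')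
    (hc : ∀ x ∈ c, φ.e0Equiv x ∈ c') (hd : ∀ x ∈ d, powEquiv φ.right 3 x ∈ d')
    (hr : ∀ x ∈ r, powEquiv φ.right 6 x ∈ r') :
    ∀ x ∈ sub5 g a b c d r, φ.envEquiv x ∈ sub5 g' a' b' c' d' r' :=
  fun _ hx => ⟨ha _ hx.1, hb _ hx.2.1, hc _ hx.2.2.1, hd _ hx.2.2.2.1, hr _ hx.2.2.2.2⟩

theorem map_mem_bot (f : M ≃ₗ[K] M') : ∀ x ∈ (⊥ : Submodule K M), f x ∈ (⊥ : Submodule K M') :=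
  fun x hx => by rw [(Submodule.mem_bot K).1 hx]; simp

theorem map_mem_top (f : M ≃ₗ[K] M') : ∀ x ∈ (⊤ : Submodule K M), f x ∈ (⊤ : Submodule K M') :=
  fun _ _ => trivial

theorem PairingEquiv.envEquiv_mem_gr5 (i : ℤ) : ∀ x ∈ gr5 g i, φ.envEquiv x ∈ gr5 g' i := by
  unfold gr5
  split
  iterate 5
    · apply envEquiv_mem_sub5 <;> first | exact map_mem_bot _ | exact map_mem_top _
  · exact map_mem_bot _

theorem PairingEquiv.map_gr5 (i : ℤ) :
    (gr5 g i).map φ.envEquiv.toLinearMap = gr5 g' i :=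
  map_submodule_eq (φ.envEquiv_mem_gr5 i) (φ.symm.envEquiv_mem_gr5 i)

variable {φ}

theorem map_mem_span (f : M ≃ₗ[K] M') {x y : M} {y' : M'} (hy : f y = y')
    (h : x ∈ Submodule.span K {y}) : f x ∈ Submodule.span K {y'} := by
  obtain ⟨c, rfl⟩ := Submodule.mem_span_singleton.1 h
  exact Submodule.mem_span_singleton.2 ⟨c, by rw [map_smul, hy]⟩

theorem PairingEquiv.envEquiv_mem_grBC2 (hef : g e f = 1) (he : φ.left e = e')
    (hf : φ.right f = f') (i : ℤ × ℤ) :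
    ∀ x ∈ grBC2 g e f i, φ.envEquiv x ∈ grBC2 g' e' f' i := by
  have hs : φ.right.symm f' = f := φ.right.symm_apply_eq.2 hf.symm
  have hker : ∀ u, g' e' u = 0 → g e (φ.right.symm u) = 0 := fun u hu => by
    rw [← φ.map_apply, he, φ.right.apply_symm_apply, hu]
  have hker' : ∀ u, g e u = 0 → g' e' (φ.right u) = 0 := fun u hu => by
    rw [← he, φ.map_apply, hu]
  have p0 : ∀ x ∈ piece0 g e, powEquiv φ.right 3 x ∈ piece0 g' e' := fun _ hx =>
    map_mem_spGr hef he hf 0 hx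
  have p1 : ∀ x ∈ piece1 g e f, powEquiv φ.right 3 x ∈ piece1 g' e' f' := fun _ hx =>
    map_mem_spGr hef he hf 1 hx
  have q0 : ∀ x ∈ piece0 g.flip f, powEquiv φ.left 3 x ∈ piece0 g'.flip f' := fun _ hx =>
    map_mem_spGr (φ := φ.flip) (g := g.flip) hef hf he 0 hx
  have q1 : ∀ x ∈ piece1 g.flip f e, powEquiv φ.left 3 x ∈ piece1 g'.flip f' e' := fun _ hx =>
    map_mem_spGr (φ := φ.flip) (g := g.flip) hef hf he 1 hx
  have r0 : ∀ x ∈ e00 g e f, φ.e0Equiv x ∈ e00 g' e' f' := fun x hx => by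
    refine ⟨?_, fun u hu => hker' _ (hx.2 _ (hker u hu))⟩
    rw [coe_e0Equiv, LinearEquiv.conj_apply_apply, hs]
    exact map_mem_span _ hf hx.1
  have r1 : ∀ x ∈ e01 g f, φ.e0Equiv x ∈ e01 g' f' := fun x hx => by
    refine ⟨hx.1, ?_, fun n => map_mem_span _ hf (hx.2.2 _)⟩
    rw [coe_e0Equiv, LinearEquiv.conj_apply_apply, hs, hx.2.1, map_zero]
  have r2 : ∀ x ∈ e0m1 g e f, φ.e0Equiv x ∈ e0m1 g' e' f' := fun x hx => by
    refine ⟨hx.1, ?_, fun n hn => ?_⟩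
    · rw [coe_e0Equiv, LinearEquiv.conj_apply_apply, hs]
      exact hker' _ hx.2.1
    · rw [coe_e0Equiv, LinearEquiv.conj_apply_apply, hx.2.2 _ (hker n hn), map_zero]
  unfold grBC2
  split
  iterate 9
    · apply envEquiv_mem_sub5 <;> first | exact map_mem_bot _ | exact map_mem_top _ | assumption
  · exact map_mem_bot _

theorem PairingEquiv.map_grBC2 (hef : g e f = 1) (he : φ.left e = e') (hf : φ.right f = f')
    (i : ℤ × ℤ) : (grBC2 g e f i).map φ.envEquiv.toLinearMap = grBC2 g' e' f' i :=
  map_submodule_eq (envEquiv_mem_grBC2 hef he hf i)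
    (envEquiv_mem_grBC2 (φ := φ.symm) (by rw [← he, ← hf, φ.map_apply, hef])
      (φ.left.symm_apply_eq.2 he.symm) (φ.right.symm_apply_eq.2 hf.symm) i)

end Functoriality

end ExtPair

/-! ### Isomorphisms of the pairs, Lie algebras and reflections. -/

section Isomorphisms

open ExtPair

variable {K : Type u} [CommRing K]

/-- The isomorphism of pairs `⋀₃` induced by an isomorphism of pairings. -/
noncomputable def ExtTriple.lambda3Iso {T : ExtTriple.{u, v} K} {T' : ExtTriple.{u, w} K}
    (φ : PairingEquiv T.g T'.g) : TrilinearPair.Iso T.lambda3 T'.lambda3 where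
  neg := powEquiv φ.left 3
  pos := powEquiv φ.right 3
  map_neg := φ.flip.map_prod
  map_pos := φ.map_prod

/-- The isomorphism of Lie algebras induced by an isomorphism of pairings. -/
noncomputable def ExtTriple.lieIso {T : ExtTriple.{u, v} K} {T' : ExtTriple.{u, w} K}
    (φ : PairingEquiv T.g T'.g) : GradedAlg.Iso T.lie T'.lie where
  equiv := φ.envEquiv
  map_bracket := φ.envEquiv_br T.perf T'.perf T.rank_pos T'.rank_pos
  map_component := φ.map_gr5

/-- Isomorphisms of quadruples. -/
structure ExtQuad.Equiv (Q : ExtQuad.{u, v} K) (Q' : ExtQuad.{u, w} K) extends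
    PairingEquiv Q.g Q'.g where
  map_eneg : left Q.eneg = Q'.eneg
  map_epos : right Q.epos = Q'.epos

/-- The isomorphism of SP-graded pairs `⋀₃` induced by an isomorphism of quadruples. -/
noncomputable def ExtQuad.lambda3Iso (h6 : IsUnit (6 : K)) {Q : ExtQuad.{u, v} K}
    {Q' : ExtQuad.{u, w} K} (φ : ExtQuad.Equiv Q Q') :
    SPGradedPair.Iso (Q.lambda3 h6) (Q'.lambda3 h6) where
  toIso := ExtTriple.lambda3Iso φ.toPairingEquiv
  map_negGr := PairingEquiv.map_spGr (φ := φ.toPairingEquiv.flip) (g := Q.g.flip) Q.g_e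
    φ.map_epos φ.map_eneg
  map_posGr := PairingEquiv.map_spGr (φ := φ.toPairingEquiv) Q.g_e φ.map_eneg φ.map_epos

/-- The isomorphism of `BC₂`-graded Lie algebras induced by an isomorphism of quadruples. -/
noncomputable def ExtQuad.lieIso {Q : ExtQuad.{u, v} K} {Q' : ExtQuad.{u, w} K}
    (φ : ExtQuad.Equiv Q Q') : GradedAlg.Iso Q.lie Q'.lie where
  equiv := φ.toPairingEquiv.envEquiv
  map_bracket := φ.toPairingEquiv.envEquiv_br Q.perf Q'.perf Q.rank_pos Q'.rank_pos
  map_component := PairingEquiv.map_grBC2 Q.g_e φ.map_eneg φ.map_epos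

namespace SPGradedPair

/-- The linear equivalence of homogeneous components induced by a linear equivalence. -/
noncomputable def componentEquiv {V : Type v} {W : Type w} [AddCommGroup V] [AddCommGroup W] [Module K V]
    [Module K W] (e : V ≃ₗ[K] W) {S : Submodule K V} {T : Submodule K W}
    (h : S.map e.toLinearMap = T) : S ≃ₗ[K] T :=
  e.submoduleMap S ≪≫ₗ LinearEquiv.ofEq _ _ h

theorem prodCongr_map_gr01 {V : Type v} {V' : Type v'} {W : Type w} {W' : Type w'}
    [AddCommGroup V] [AddCommGroup W] [Module K V] [Module K W] [AddCommGroup V']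
    [AddCommGroup W'] [Module K V'] [Module K W'] (e : V ≃ₗ[K] V') (f : W ≃ₗ[K] W') (i : ℤ) :
    (gr01 (K := K) (Submodule.prod (⊤ : Submodule K V) (⊥ : Submodule K W))
      (Submodule.prod ⊥ ⊤) i).map (LinearEquiv.prodCongr e f).toLinearMap =
      gr01 (Submodule.prod (⊤ : Submodule K V') (⊥ : Submodule K W')) (Submodule.prod ⊥ ⊤) i := by
  unfold gr01
  split_ifs
  · exact map_submodule_eq (fun x hx => ⟨trivial, map_mem_bot f _ hx.2⟩)
      fun x hx => ⟨trivial, map_mem_bot f.symm _ hx.2⟩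
  · exact map_submodule_eq (fun x hx => ⟨map_mem_bot e _ hx.1, trivial⟩)
      fun x hx => ⟨map_mem_bot e.symm _ hx.1, trivial⟩
  · exact Submodule.map_bot _

/-- Both components of the product are sums of values of `f` or of `h`, so compatibility holds term
by term; the gradings enter only through the components they cut out. -/
theorem prodCongr_reflProd {A : Type v} {B : Type w} [AddCommGroup A] [AddCommGroup B] [Module K A]
    [Module K B] {A' : Type v'} {B' : Type w'} [AddCommGroup A'] [AddCommGroup B'] [Module K A']
    [Module K B'] {f : A →ₗ[K] B →ₗ[K] A →ₗ[K] A} {h : B →ₗ[K] A →ₗ[K] B →ₗ[K] B}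
    {grA : ℤ → Submodule K A} {grB : ℤ → Submodule K B}
    {hf : ∀ g k l, ∀ x ∈ grA g, ∀ y ∈ grB k, ∀ z ∈ grA l, f x y z ∈ grA (g - k + l)}
    {hh : ∀ g k l, ∀ x ∈ grB g, ∀ y ∈ grA k, ∀ z ∈ grB l, h x y z ∈ grB (g - k + l)}
    {f' : A' →ₗ[K] B' →ₗ[K] A' →ₗ[K] A'} {h' : B' →ₗ[K] A' →ₗ[K] B' →ₗ[K] B'}
    {grA' : ℤ → Submodule K A'} {grB' : ℤ → Submodule K B'}
    {hf' : ∀ g k l, ∀ x ∈ grA' g, ∀ y ∈ grB' k, ∀ z ∈ grA' l, f' x y z ∈ grA' (g - k + l)}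
    {hh' : ∀ g k l, ∀ x ∈ grB' g, ∀ y ∈ grA' k, ∀ z ∈ grB' l, h' x y z ∈ grB' (g - k + l)}
    (α : A ≃ₗ[K] A') (β : B ≃ₗ[K] B') (hα : ∀ x y z, α (f x y z) = f' (α x) (β y) (α z))
    (hβ : ∀ x y z, β (h x y z) = h' (β x) (α y) (β z))
    (hA : ∀ i, (grA i).map α.toLinearMap = grA' i) (hB : ∀ i, (grB i).map β.toLinearMap = grB' i)
    (x : grB 0 × grA 1) (y : grA 0 × grB 1) (z : grB 0 × grA 1) :
    LinearEquiv.prodCongr (componentEquiv β (hB 0)) (componentEquiv α (hA 1))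
        (reflProd f h grA grB hf hh x y z) =
      reflProd f' h' grA' grB' hf' hh'
        (LinearEquiv.prodCongr (componentEquiv β (hB 0)) (componentEquiv α (hA 1)) x)
        (LinearEquiv.prodCongr (componentEquiv α (hA 0)) (componentEquiv β (hB 1)) y)
        (LinearEquiv.prodCongr (componentEquiv β (hB 0)) (componentEquiv α (hA 1)) z) := by
  refine Prod.ext (Subtype.ext ?_) (Subtype.ext ?_)
  · change β (h x.1 y.1 z.1 - h y.2 x.2 z.1 + (h x.1 z.2 y.2 - h y.2 z.2 x.1)) =
      h' (β x.1) (α y.1) (β z.1) - h' (β y.2) (α x.2) (β z.1) +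
        (h' (β x.1) (α z.2) (β y.2) - h' (β y.2) (α z.2) (β x.1))
    simp only [map_add, map_sub, hβ]
  · change α (f x.2 y.2 z.2 - f y.1 x.1 z.2 + (f x.2 z.1 y.1 - f y.1 z.1 x.2)) =
      f' (α x.2) (β y.2) (α z.2) - f' (α y.1) (β x.1) (α z.2) +
        (f' (α x.2) (β z.1) (α y.1) - f' (α y.1) (β z.1) (α x.2))
    simp only [map_add, map_sub, hα]

/-- The isomorphism of reflections induced by an isomorphism of SP-graded pairs. -/
noncomputable def reflectIso {P : SPGradedPair.{u, v, w} K} {Q : SPGradedPair.{u, v', w'} K}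
    (e : Iso P Q) : Iso P.reflect Q.reflect where
  neg := LinearEquiv.prodCongr (componentEquiv e.pos (e.map_posGr 0))
    (componentEquiv e.neg (e.map_negGr 1))
  pos := LinearEquiv.prodCongr (componentEquiv e.neg (e.map_negGr 0))
    (componentEquiv e.pos (e.map_posGr 1))
  map_neg := prodCongr_reflProd (hf := P.neg_mem) (hh := P.pos_mem) (hf' := Q.neg_mem)
    (hh' := Q.pos_mem) _ _ e.map_neg e.map_pos e.map_negGr e.map_posGr
  map_pos := prodCongr_reflProd (hf := P.pos_mem) (hh := P.neg_mem) (hf' := Q.pos_mem)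
    (hh' := Q.neg_mem) _ _ e.map_pos e.map_neg e.map_posGr e.map_negGr
  map_negGr := prodCongr_map_gr01 _ _
  map_posGr := prodCongr_map_gr01 _ _

end SPGradedPair

end Isomorphisms

namespace ExtPair

variable {K : Type u} [CommRing K]

/-! ### Contractions: the Jacobi identity in degrees `-1, 1, 1`, and nondegeneracy. -/

section Contraction

variable {M : Type v} {N : Type w} [AddCommGroup M] [AddCommGroup N] [Module K M] [Module K N]
  (g : M →ₗ[K] N →ₗ[K] K)

theorem contr_ι_mul_eq (m : M) (x z : ExteriorAlgebra K N) :
    contr g (ExteriorAlgebra.ι K m) (x * z) = contr g (ExteriorAlgebra.ι K m) x * z +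
      CliffordAlgebra.involute x * contr g (ExteriorAlgebra.ι K m) z := by
  induction x using leftInd with
  | h0 r => simp [contr_ι_algebraMap, ← Algebra.smul_def]
  | ha x y hx hy => simp only [add_mul, map_add, hx, hy]; abel
  | hm n x hx =>
    rw [mul_assoc, contr_ι_ι_mul, hx, contr_ι_ι_mul, map_mul CliffordAlgebra.involute,
      CliffordAlgebra.involute_ι]
    simp only [mul_add, sub_mul, smul_mul_assoc, neg_mul, mul_assoc]
    abel

theorem contr_ι_mul_of_mem {k : ℕ} (m : M) {x : ExteriorAlgebra K N} (hx : x ∈ ⋀[K]^k N)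
    (z : ExteriorAlgebra K N) :
    contr g (ExteriorAlgebra.ι K m) (x * z) = contr g (ExteriorAlgebra.ι K m) x * z +
      (-1 : K) ^ k • (x * contr g (ExteriorAlgebra.ι K m) z) := by
  rw [contr_ι_mul_eq, involute_of_mem k hx, smul_mul_assoc]

theorem contr_ι_comm (m n : M) (x : ExteriorAlgebra K N) :
    contr g (ExteriorAlgebra.ι K m) (contr g (ExteriorAlgebra.ι K n) x) =
      -contr g (ExteriorAlgebra.ι K n) (contr g (ExteriorAlgebra.ι K m) x) := by
  rw [← contr_ι_mul, ← contr_ι_mul,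
    eq_neg_of_add_eq_zero_left (ExteriorAlgebra.ι_add_mul_swap m n), map_neg, LinearMap.neg_apply]

theorem mul_ι_of_mem_two {x : ExteriorAlgebra K N} (hx : x ∈ ⋀[K]^2 N) (n : N) :
    x * ExteriorAlgebra.ι K n = ExteriorAlgebra.ι K n * x := by
  rw [ι_mul_eq, involute_of_mem 2 hx]
  simp

/-- For decomposable `y` the expansion of `v · y` makes `E(x, y)` a signed sum of three rank-one
operators, whose vectors are the double contractions of `x`; `der_rankOne` gives the derivation
extending each of them. -/
theorem der_eOp_eq (m₁ m₂ m₃ : M) {x : ExteriorAlgebra K N} (hx : x ∈ ⋀[K]^3 N)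
    (z : ExteriorAlgebra K N) :
    der (eOp g x (ExteriorAlgebra.ι K m₁ * (ExteriorAlgebra.ι K m₂ * ExteriorAlgebra.ι K m₃))) z =
      contr g (ExteriorAlgebra.ι K m₂) (contr g (ExteriorAlgebra.ι K m₃) x) *
          contr g (ExteriorAlgebra.ι K m₁) z -
        contr g (ExteriorAlgebra.ι K m₁) (contr g (ExteriorAlgebra.ι K m₃) x) *
          contr g (ExteriorAlgebra.ι K m₂) z +
        contr g (ExteriorAlgebra.ι K m₁) (contr g (ExteriorAlgebra.ι K m₂) x) *
          contr g (ExteriorAlgebra.ι K m₃) z := by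
  obtain ⟨n₁, h₁⟩ := mem_one_iff.1 (contr_ι_mem g m₂ 1 (contr_ι_mem g m₃ 2 hx))
  obtain ⟨n₂, h₂⟩ := mem_one_iff.1 (contr_ι_mem g m₁ 1 (contr_ι_mem g m₃ 2 hx))
  obtain ⟨n₃, h₃⟩ := mem_one_iff.1 (contr_ι_mem g m₁ 1 (contr_ι_mem g m₂ 2 hx))
  have hy : ExteriorAlgebra.ι K m₁ * (ExteriorAlgebra.ι K m₂ * ExteriorAlgebra.ι K m₃) ∈
      ⋀[K]^3 M := ι_mul_mem _ (ι_mul_mem _ (mem_one_iff.2 ⟨_, rfl⟩))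
  have h : eOp g x (ExteriorAlgebra.ι K m₁ * (ExteriorAlgebra.ι K m₂ * ExteriorAlgebra.ι K m₃)) =
      (g m₁).smulRight n₁ - (g m₂).smulRight n₂ + (g m₃).smulRight n₃ := by
    ext v
    have h0 : contr g.flip (ExteriorAlgebra.ι K v) (ExteriorAlgebra.ι K m₃) =
        algebraMap K (ExteriorAlgebra K M) (g m₃ v) :=
      (contr_ι g.flip v _).trans (CliffordAlgebra.contractLeft_ι _ _ _)
    rw [← ExteriorAlgebra.ι_inj K, ι_eOp g 2 hx hy, contr_ι_ι_mul, contr_ι_ι_mul, h0]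
    simp only [LinearMap.flip_apply, mul_sub, map_sub, map_smul, LinearMap.sub_apply,
      LinearMap.smul_apply, contr_ι_mul, LinearMap.add_apply, LinearMap.smulRight_apply, map_add,
      h₁, h₂, h₃, mul_smul_comm, contr_algebraMap]
    abel
  rw [h, map_add, map_sub, LinearMap.add_apply, LinearMap.sub_apply, der_rankOne, der_rankOne,
    der_rankOne, h₁, h₂, h₃]

/-- The Jacobi identity for elements of degrees `-1`, `1`, `1`. -/
theorem contr_mul_eq {x z : ExteriorAlgebra K N} (hx : x ∈ ⋀[K]^3 N) (hz : z ∈ ⋀[K]^3 N)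
    {y : ExteriorAlgebra K M} (hy : y ∈ ⋀[K]^3 M) :
    contr g y (x * z) = (der (eOp g z y) x - dot g.flip z y • x) -
      (der (eOp g x y) z - dot g.flip x y • z) := by
  -- Replacing the scalars by products in `⋀(N)` makes the identity visibly additive in `y`, so that
  -- `y = m₁m₂m₃` may be assumed.
  have hdot : ∀ x ∈ ⋀[K]^3 N, ∀ z : ExteriorAlgebra K N,
      dot g.flip x y • z = contr g y x * z := by
    intro x hx z
    rw [← dot_comm g 3 hy hx, Algebra.smul_def, algebraMap_dot g 3 hy hx]
  rw [hdot x hx, hdot z hz]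
  clear hdot
  induction hy using power_ind with
  | ha a b _ _ ha hb => simp only [map_add, LinearMap.add_apply, ha, hb, add_mul]; abel
  | hm m₁ y hy =>
    induction hy using power_ind with
    | ha a b _ _ ha hb =>
      simp only [mul_add, map_add, LinearMap.add_apply, ha, hb, add_mul]; abel
    | hm m₂ y hy =>
      obtain ⟨m₃, rfl⟩ := mem_one_iff.1 hy
      have h1 : ∀ m, ∀ x ∈ ⋀[K]^3 N, contr g (ExteriorAlgebra.ι K m) x ∈ ⋀[K]^2 N :=
        fun m x hx => contr_ι_mem g m 2 hx
      have h2 : ∀ m m', ∀ x ∈ ⋀[K]^3 N, contr g (ExteriorAlgebra.ι K m)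
          (contr g (ExteriorAlgebra.ι K m') x) ∈ ⋀[K]^1 N :=
        fun m m' x hx => contr_ι_mem g m 1 (h1 m' x hx)
      have hc : ∀ a ∈ ⋀[K]^1 N, ∀ b ∈ ⋀[K]^2 N, a * b = b * a := by
        intro a ha b hb
        obtain ⟨n, rfl⟩ := mem_one_iff.1 ha
        exact (mul_ι_of_mem_two hb n).symm
      rw [der_eOp_eq g m₁ m₂ m₃ hx, der_eOp_eq g m₁ m₂ m₃ hz]
      -- Three applications of the anti-derivation rule to `xz` give eight terms. The two in which
      -- all contractions hit the same factor are the scalar terms; the other six are the terms of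
      -- the two derivations, once factors of degrees one and two are commuted.
      simp only [contr_ι_mul]
      rw [contr_ι_mul_of_mem g m₃ hx]
      simp only [map_add, map_smul]
      rw [contr_ι_mul_of_mem g m₂ (h1 m₃ x hx), contr_ι_mul_of_mem g m₂ hx]
      simp only [map_add, map_smul, smul_add]
      rw [contr_ι_mul_of_mem g m₁ (h2 m₂ m₃ x hx), contr_ι_mul_of_mem g m₁ (h1 m₃ x hx),
        contr_ι_mul_of_mem g m₁ (h1 m₂ x hx), contr_ι_mul_of_mem g m₁ hx]
      obtain ⟨r, hr⟩ := mem_zero_iff.1 (contr_ι_mem g m₁ 0 (h2 m₂ m₃ z hz))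
      rw [hc _ (h2 m₂ m₃ z hz) _ (h1 m₁ x hx), hc _ (h2 m₁ m₃ z hz) _ (h1 m₂ x hx),
        hc _ (h2 m₁ m₂ z hz) _ (h1 m₃ x hx), ← hr, Algebra.commutes r x]
      norm_num
      abel

theorem contractLeft_map (s : N →ₗ[K] M) (d : Module.Dual K M) (x : ExteriorAlgebra K N) :
    contr LinearMap.id (ExteriorAlgebra.ι K d) (ExteriorAlgebra.map s x) =
      ExteriorAlgebra.map s (contr LinearMap.id (ExteriorAlgebra.ι K (d ∘ₗ s)) x) := by
  induction x using leftInd with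
  | h0 r => simp only [AlgHom.commutes, contr_ι_algebraMap, map_zero]
  | ha x y hx hy => simp only [map_add, hx, hy]
  | hm m x hx =>
    rw [map_mul, ExteriorAlgebra.map_apply_ι, contr_ι_ι_mul, contr_ι_ι_mul, hx, map_sub, map_mul,
      map_smul, ExteriorAlgebra.map_apply_ι]
    rfl

theorem map_zero_of_mem (k : ℕ) {x : ExteriorAlgebra K N} (hx : x ∈ ⋀[K]^(k + 1) N) :
    ExteriorAlgebra.map (0 : N →ₗ[K] M) x = 0 := by
  induction hx using power_ind with
  | hm m y hy => simp
  | ha a b _ _ ha hb => rw [map_add, ha, hb, add_zero]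

/-- If the `i`-th coordinate contracts `x` to zero, the algebra map that kills the `i`-th basis
vector fixes `x`. Composing these maps over all `i` gives the map induced by `0`. -/
theorem eq_map_zero_of_contr_eq_zero {n : ℕ} {x : ExteriorAlgebra K (Fin n → K)}
    (h : ∀ i, contr LinearMap.id (ExteriorAlgebra.ι K
      (LinearMap.proj i : Module.Dual K (Fin n → K))) x = 0) :
    x = ExteriorAlgebra.map (0 : (Fin n → K) →ₗ[K] (Fin n → K)) x := by
  classical
  let p : Fin n → Module.End K (Fin n → K) := fun i =>
    ((LinearMap.id : _ →ₗ[K] Module.Dual K (Fin n → K)) (LinearMap.proj i)).smulRight (Pi.single i 1)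
  have h1 : ∀ i, ExteriorAlgebra.map (LinearMap.id - p i) x = x := fun i => by
    rw [map_eq, tau_apply, h, mul_zero, sub_zero]
  have h2 : ∀ s : Finset (Fin n), ExteriorAlgebra.map (LinearMap.id - ∑ i ∈ s, p i) x = x := by
    intro s
    induction s using Finset.induction_on with
    | empty => simp
    | insert i s hi ih =>
      have hp : LinearMap.id - ∑ j ∈ insert i s, p j =
          (LinearMap.id - p i) ∘ₗ (LinearMap.id - ∑ j ∈ s, p j) := by
        have h0 : p i ∘ₗ ∑ j ∈ s, p j = 0 := by
          refine LinearMap.ext fun v => ?_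
          rw [LinearMap.comp_apply, LinearMap.sum_apply, map_sum]
          refine Finset.sum_eq_zero fun j hj => ?_
          have : i ≠ j := fun h => hi (h ▸ hj)
          simp [p, this]
        rw [LinearMap.sub_comp, LinearMap.comp_sub _ _ (p i), h0, Finset.sum_insert hi]
        simp only [LinearMap.id_comp, sub_zero, LinearMap.comp_id]
        abel
      rw [hp, ← ExteriorAlgebra.map_comp_map, AlgHom.comp_apply, ih, h1]
  have h3 : LinearMap.id - ∑ i, p i = 0 := by
    rw [sub_eq_zero]
    refine LinearMap.ext fun x => funext fun j => ?_
    simp [p, LinearMap.sum_apply, Finset.sum_apply, Pi.single_apply]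
  rw [← h3, h2]

variable {g} in
/-- Nondegeneracy of the contraction. -/
theorem eq_zero_of_contr_ι [Module.Finite K N] [Module.Projective K N] (hg : g.IsPerfPair) (k : ℕ)
    {x : ExteriorAlgebra K N} (hx : x ∈ ⋀[K]^(k + 1) N)
    (h : ∀ m, contr g (ExteriorAlgebra.ι K m) x = 0) : x = 0 := by
  obtain ⟨n, p, s, -, -, hps⟩ := Module.Finite.exists_comp_eq_id_of_projective K N
  have h1 : ExteriorAlgebra.map s x = ExteriorAlgebra.map 0 (ExteriorAlgebra.map s x) := by
    refine eq_map_zero_of_contr_eq_zero fun i => ?_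
    obtain ⟨m, hm⟩ := hg.bijective_left.2 (LinearMap.proj i ∘ₗ s)
    have h2 := h m
    rw [contr_ι, hm] at h2
    rw [contractLeft_map, contr_ι, LinearMap.id_apply, h2, map_zero]
  rw [map_zero_of_mem k (map_mem s _ hx)] at h1
  have h2 : ExteriorAlgebra.map p (ExteriorAlgebra.map s x) = x := by
    rw [← AlgHom.comp_apply, ExteriorAlgebra.map_comp_map, hps]
    simp
  rw [← h2, h1, map_zero]

variable {g} in
theorem eq_zero_of_contr [Module.Finite K N] [Module.Projective K N] (hg : g.IsPerfPair) (k l : ℕ)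
    {x : ExteriorAlgebra K N} (hx : x ∈ ⋀[K]^(l + k) N)
    (h : ∀ y ∈ ⋀[K]^k M, contr g y x = 0) : x = 0 := by
  induction k generalizing x with
  | zero => simpa [contr_algebraMap] using h 1 (mem_zero_iff.2 ⟨1, map_one _⟩)
  | succ k ih =>
    refine eq_zero_of_contr_ι hg (l + k) hx fun m => ih (contr_ι_mem g m _ hx) fun y hy => ?_
    have h1 := h _ (ι_mul_mem m hy)
    -- The vector `m` has to act first, so it is moved to the right of `y` at the cost of a sign.
    rw [ι_mul_eq, involute_of_mem k hy, smul_mul_assoc, map_smul, LinearMap.smul_apply, map_mul] at h1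
    rcases neg_one_pow_eq_or K k with h | h <;> simpa [h] using h1

end Contraction
end ExtPair

/-! ### The invariant `kSpan` of an ungraded pair, and its value on `⋀₃`. -/

namespace TrilinearPair

variable {K : Type u} [CommRing K]

section KSpan

variable {A : Type v} {B : Type w} [AddCommGroup A] [AddCommGroup B] [Module K A] [Module K B]

/-- The submodule of `Hom(P⁻, P⁺)` spanned by the maps `K(x, z) : y ↦ {x, y, z} - {z, y, x}`. -/
def kSpan (f : B →ₗ[K] A →ₗ[K] B →ₗ[K] B) : Submodule K (A →ₗ[K] B) :=
  Submodule.span K (Set.range fun a : B × B => (f a.1).flip a.2 - (f a.2).flip a.1)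

/-- A description of `kSpan` through an injective parametrization `T`. -/
noncomputable def kSpanEquivOfRange (f : B →ₗ[K] A →ₗ[K] B →ₗ[K] B) {X : Type v'} {Y : Type w'}
    [AddCommGroup X] [Module K X] [AddCommGroup Y] [Module K Y] (j : B →ₗ[K] Y)
    (hj : Function.Injective j) (T : X →ₗ[K] A →ₗ[K] Y) (hT : Function.Injective T)
    (ψ : B × B → X) (hψ : Submodule.span K (Set.range ψ) = ⊤)
    (h : ∀ a c y, j (f a y c - f c y a) = T (ψ (a, c)) y) :
    kSpan f ≃ₗ[K] X :=
  Submodule.equivMapOfInjective (LinearMap.compRight K j) (fun a b hab => LinearMap.ext fun y =>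
      hj (LinearMap.congr_fun hab y)) (kSpan f) ≪≫ₗ
    LinearEquiv.ofEq _ (LinearMap.range T) (by
      rw [LinearMap.range_eq_map, ← hψ, kSpan, Submodule.map_span, Submodule.map_span,
        ← Set.range_comp, ← Set.range_comp]
      congr 2
      ext a y
      exact h a.1 a.2 y) ≪≫ₗ (LinearEquiv.ofInjective T hT).symm

end KSpan

/-- Isomorphic pairs have isomorphic modules `kSpan`. -/
noncomputable def Iso.kSpanEquiv {P : TrilinearPair.{u, v, w} K} {Q : TrilinearPair.{u, v', w'} K}
    (e : Iso P Q) : kSpan P.prodPos ≃ₗ[K] kSpan Q.prodPos :=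
  (LinearEquiv.arrowCongr e.neg e.pos).submoduleMap (kSpan P.prodPos) ≪≫ₗ LinearEquiv.ofEq _ _ (by
    rw [kSpan, kSpan, Submodule.map_span, ← Set.range_comp]
    congr 1
    have h : ∀ a : P.Pos × P.Pos, LinearEquiv.arrowCongr e.neg e.pos
        ((P.prodPos a.1).flip a.2 - (P.prodPos a.2).flip a.1) =
        (Q.prodPos (e.pos a.1)).flip (e.pos a.2) - (Q.prodPos (e.pos a.2)).flip (e.pos a.1) :=
      fun a => LinearMap.ext fun y => by simp [LinearEquiv.arrowCongr_apply, e.map_pos]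
    ext f
    constructor
    · rintro ⟨a, rfl⟩
      exact ⟨(e.pos a.1, e.pos a.2), (h a).symm⟩
    · rintro ⟨a, rfl⟩
      exact ⟨(e.pos.symm a.1, e.pos.symm a.2), (h _).trans (by simp)⟩)

end TrilinearPair

namespace ExtPair

open TrilinearPair

variable {K : Type u} [CommRing K] {M : Type v} {N : Type w} [AddCommGroup M] [AddCommGroup N]
  [Module K M] [Module K N]

theorem contr36_flip_injective [Module.Finite K N] [Module.Projective K N]
    {g : M →ₗ[K] N →ₗ[K] K} (hg : g.IsPerfPair) : Function.Injective (contr36 g).flip := by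
  rw [injective_iff_map_eq_zero]
  intro x hx
  refine Subtype.ext (eq_zero_of_contr hg 3 3 x.2 fun y hy => ?_)
  exact congrArg Subtype.val (LinearMap.congr_fun hx ⟨y, hy⟩)

theorem span_neg_wedge33 : Submodule.span K
    (Set.range fun a : ⋀[K]^3 N × ⋀[K]^3 N => -wedge33 K N a.1 a.2) = ⊤ := by
  have h3 : ⋀[K]^3 N * ⋀[K]^3 N = ⋀[K]^6 N := (pow_add _ 3 3).symm
  rw [eq_top_iff]
  rintro ⟨x, hx⟩ -
  have hx' := hx
  rw [← h3] at hx'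
  induction hx' using Submodule.mul_induction_on' with
  | mem_mul_mem a ha b hb =>
    rw [← neg_neg (⟨a * b, hx⟩ : ⋀[K]^6 N)]
    exact neg_mem (Submodule.subset_span ⟨(⟨a, ha⟩, ⟨b, hb⟩), rfl⟩)
  | add a h1 b h2 ha hb => exact add_mem (ha (h3 ▸ h1)) (hb (h3 ▸ h2))

/-- This is `contr_mul_eq` read as a formula for the operator `K(a, c)`: contraction into `-ac`. -/
theorem prod_sub_prod (g : M →ₗ[K] N →ₗ[K] K) (a c : ⋀[K]^3 N) (y : ⋀[K]^3 M) :
    prod g a y c - prod g c y a = (contr36 g).flip (-wedge33 K N a c) y := by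
  refine Subtype.ext ?_
  rw [map_neg, LinearMap.neg_apply]
  have h := contr_mul_eq g a.2 c.2 y.2
  change (der (eOp g a.1 y.1) c.1 - dot g.flip a.1 y.1 • c.1) -
    (der (eOp g c.1 y.1) a.1 - dot g.flip c.1 y.1 • a.1) = -contr g y.1 (a.1 * c.1)
  rw [h, neg_sub]

/-- The module `kSpan` of `⋀₃` is the top exterior power. -/
noncomputable def kSpanEquiv [Module.Finite K N] [Module.Projective K N]
    {g : M →ₗ[K] N →ₗ[K] K} (hg : g.IsPerfPair) : kSpan (prod g) ≃ₗ[K] ⋀[K]^6 N :=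
  kSpanEquivOfRange (prod g) LinearMap.id (fun _ _ h => h) (contr36 g).flip
    (contr36_flip_injective hg) (fun a => -wedge33 K N a.1 a.2) span_neg_wedge33 (prod_sub_prod g)

end ExtPair

namespace ExtPair

open TrilinearPair SPGradedPair

variable {K : Type u} [CommRing K]

/-! ### The invariant `kSpan` of the reflection. -/

section Reflection

variable {M : Type v} {N : Type w} [AddCommGroup M] [AddCommGroup N] [Module K M] [Module K N]
  {g : M →ₗ[K] N →ₗ[K] K} {e : M} {f : N}

/-- The families `a`, `b` are a dual basis of `N` projected to the annihilator of `f` and to `U =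
ker (g e)`. The anti-derivation rule turns the sum into `∑ g(a, b) y - ∑ b ∧ (a · y)`: the first
coefficient is the trace of the identity of `U`, that is `n - 1`, and the second sum is the Euler
operator, which multiplies `⋀ᵏ(U)` by `k`. -/
theorem exists_dual_basis_ker [Module.Finite K N] [Module.Projective K N] (hg : g.IsPerfPair)
    {n : ℕ} (hn : ∀ p, Module.rankAtStalk (R := K) N p = n) (hef : g e f = 1) :
    ∃ (s : Finset (Module.Dual K N × N)) (a : Module.Dual K N × N → M)
      (b : Module.Dual K N × N → N), (∀ p, g (a p) f = 0) ∧ (∀ p, g e (b p) = 0) ∧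
      ∀ k, ∀ y ∈ ⋀[K]^k N, contr g (ExteriorAlgebra.ι K e) y = 0 →
        ∑ p ∈ s, contr g (ExteriorAlgebra.ι K (a p)) (ExteriorAlgebra.ι K (b p) * y) =
          ((n : K) - 1 - k) • y := by
  obtain ⟨s, hs, ht⟩ := exists_dual_basis K N
  have hsurj : ∀ d : Module.Dual K N, ∃ m, g m = d := hg.bijective_left.2
  choose r hr using hsurj
  refine ⟨s, fun p => r p.1 - p.1 f • e, fun p => p.2 - g e p.2 • f, fun p => by simp [hr, hef],
    fun p => by simp [hef], fun k y hy hey => ?_⟩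
  have h1 : ∑ p ∈ s, p.1 p.2 = (n : K) := by
    rw [← projTrace_id hn, ht]
    rfl
  have h2 : ∑ p ∈ s, g e p.2 * p.1 f = 1 := by
    rw [← hef]
    conv_rhs => rw [hs f, map_sum]
    simp [mul_comm]
  have h3 : ∑ p ∈ s, ExteriorAlgebra.ι K p.2 * contr g (ExteriorAlgebra.ι K (r p.1)) y =
      (k : K) • y := by
    have hid : (LinearMap.id : Module.End K N) = ∑ p ∈ s, (g (r p.1)).smulRight p.2 := by
      ext v
      rw [LinearMap.sum_apply]
      simp only [hr]
      exact hs v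
    rw [← der_id k hy, hid, map_sum, LinearMap.sum_apply]
    exact Finset.sum_congr rfl fun p _ => (der_rankOne g _ _ y).symm
  -- The vectors `r p.1` with these coefficients add up to `e`, which annihilates `y`.
  have h4 : ∑ p ∈ s, g e p.2 • contr g (ExteriorAlgebra.ι K (r p.1)) y = 0 := by
    have he : ∑ p ∈ s, g e p.2 • r p.1 = e := by
      apply hg.bijective_left.1
      ext v
      conv_rhs => rw [hs v, map_sum]
      simp [hr, mul_comm]
    rw [← hey]
    conv_rhs => rw [← he]
    simp
  calc _ = ∑ p ∈ s, ((p.1 p.2 - g e p.2 * p.1 f) • y -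
        (ExteriorAlgebra.ι K p.2 * contr g (ExteriorAlgebra.ι K (r p.1)) y -
          ExteriorAlgebra.ι K f * (g e p.2 • contr g (ExteriorAlgebra.ι K (r p.1)) y))) := by
        refine Finset.sum_congr rfl fun p _ => ?_
        rw [contr_ι_ι_mul]
        simp only [map_sub, map_smul, LinearMap.sub_apply, LinearMap.smul_apply, hey, hr, hef,
          smul_zero, sub_zero, sub_mul, smul_mul_assoc, mul_smul_comm, smul_eq_mul]
        congr 2
        ring
    _ = _ := by
        rw [Finset.sum_sub_distrib, Finset.sum_sub_distrib, ← Finset.mul_sum, h3, h4, mul_zero,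
          sub_zero, ← Finset.sum_smul, Finset.sum_sub_distrib, h1, h2, ← sub_smul]

theorem contr_ι_ι_mul_eq_zero {n : N} (hn : g e n = 0) {y : ExteriorAlgebra K N}
    (hy : contr g (ExteriorAlgebra.ι K e) y = 0) :
    contr g (ExteriorAlgebra.ι K e) (ExteriorAlgebra.ι K n * y) = 0 := by
  rw [contr_ι_ι_mul, hn, hy, zero_smul, mul_zero, sub_zero]

theorem contr_ι_ι (m : M) (n : N) : contr g (ExteriorAlgebra.ι K m) (ExteriorAlgebra.ι K n) =
    algebraMap K (ExteriorAlgebra K N) (g m n) :=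
  (contr_ι g m _).trans (CliffordAlgebra.contractLeft_ι _ _ _)

/-- The preceding lemma for `n = 6` is used in degree `2` and then in degree `1`: `12 = (6 - 1 -
2)(6 - 1 - 1)`. Thus, up to `12`, each vector of `U` is a sum of double contractions of elements of
`⋀³(U)`. -/
theorem exists_dual_basis_ker_two [Module.Finite K N] [Module.Projective K N] (hg : g.IsPerfPair)
    (hn : ∀ p, Module.rankAtStalk (R := K) N p = 6) (hef : g e f = 1) :
    ∃ (s : Finset (Module.Dual K N × N)) (a : Module.Dual K N × N → M)
      (b : Module.Dual K N × N → N), (∀ p, g (a p) f = 0) ∧ (∀ p, g e (b p) = 0) ∧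
      ∀ n, g e n = 0 → ∑ p ∈ s, ∑ q ∈ s, contr g (ExteriorAlgebra.ι K (a p))
        (contr g (ExteriorAlgebra.ι K (a q)) (ExteriorAlgebra.ι K (b q) *
          (ExteriorAlgebra.ι K (b p) * ExteriorAlgebra.ι K n))) =
            (12 : K) • ExteriorAlgebra.ι K n := by
  obtain ⟨s, a, b, ha, hb, h⟩ := exists_dual_basis_ker hg hn hef
  refine ⟨s, a, b, ha, hb, fun n hn => ?_⟩
  have h0 : contr g (ExteriorAlgebra.ι K e) (ExteriorAlgebra.ι K n) = 0 := by
    rw [contr_ι_ι, hn, map_zero]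
  have h1 : ExteriorAlgebra.ι K n ∈ ⋀[K]^1 N := mem_one_iff.2 ⟨_, rfl⟩
  have h2 := h 1 _ h1 h0
  have h3 : ∀ p, _ := fun p => h 2 _ (ι_mul_mem (b p) h1) (contr_ι_ι_mul_eq_zero (hb p) h0)
  simp only [← map_sum, h3, map_smul]
  rw [← Finset.smul_sum, h2, smul_smul]
  congr 1
  norm_num

theorem contr_eq_zero_of_mem_spGr (hef : g e f = 1) {x : ⋀[K]^3 N} (hx : x ∈ spGr g e f 0) :
    contr g (ExteriorAlgebra.ι K e) x.1 = 0 := by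
  rw [← contr_tau hef, tau_of_mem hef hx]
  simp

theorem mem_spGr_zero (hef : g e f = 1) {x : ⋀[K]^3 N}
    (hx : contr g (ExteriorAlgebra.ι K e) x.1 = 0) : x ∈ spGr g e f 0 := by
  simp only [spGr, gr01, if_true]
  rw [mem_piece0 hef, tau_apply, hx, mul_zero]

theorem ι_mul_contr_of_mem_spGr (hef : g e f = 1) {x : ⋀[K]^3 N} (hx : x ∈ spGr g e f 1) :
    ExteriorAlgebra.ι K f * contr g (ExteriorAlgebra.ι K e) x.1 = x.1 := by
  have h := tau_of_mem hef hx
  rw [tau_apply] at h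
  simpa using h

theorem mem_spGr_one (hef : g e f = 1) {y : ExteriorAlgebra K N} (hy : y ∈ ⋀[K]^2 N)
    (hey : contr g (ExteriorAlgebra.ι K e) y = 0) :
    (⟨ExteriorAlgebra.ι K f * y, ι_mul_mem f hy⟩ : ⋀[K]^3 N) ∈ spGr g e f 1 := by
  simp only [spGr, gr01, if_true, one_ne_zero, if_false]
  rw [mem_piece1 hef, tau_apply, contr_ι_ι_mul, hef, hey, one_smul, mul_zero, sub_zero]

variable (g e) in
/-- The element `ψ` of `M` such that `[a, c]` is the operator `v ↦ g(v, f) ψ` of `M`, for `a` in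
`⋀³(U⁻)` and `c` in `⋀²(U⁺) f`. -/
def psi : ExteriorAlgebra K M →ₗ[K] ExteriorAlgebra K N →ₗ[K] M :=
  LinearMap.mk₂ K
    (fun a c => ExteriorAlgebra.ιInv (contr g.flip (contr g (ExteriorAlgebra.ι K e) c) a))
    (fun a b c => by simp) (fun r a c => by simp) (fun a b c => by simp) (fun r a c => by simp)

theorem ι_psi {a : ExteriorAlgebra K M} (ha : a ∈ ⋀[K]^3 M) {c : ExteriorAlgebra K N}
    (hc : c ∈ ⋀[K]^3 N) : ExteriorAlgebra.ι K (psi g e a c) =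
      contr g.flip (contr g (ExteriorAlgebra.ι K e) c) a := by
  obtain ⟨y, hy⟩ := mem_one_iff.1 (contr_mem g.flip 2 1 (contr_ι_mem g e 2 hc) ha)
  change ExteriorAlgebra.ι K (ExteriorAlgebra.ιInv _) = _
  rw [← hy, ExteriorAlgebra.ι_leftInverse]

theorem contr_ι_mul_eq_zero {a : ExteriorAlgebra K M}
    (ha : contr g.flip (ExteriorAlgebra.ι K f) a = 0) (y : ExteriorAlgebra K N) :
    contr g.flip (ExteriorAlgebra.ι K f * y) a = 0 := by
  rw [ι_mul_eq, map_mul, Module.End.mul_apply, ha, map_zero]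

variable (hef : g e f = 1)
include hef

/-- Contracting `ψ = (e · c) · a` by `f` gives the action of `f ∧ (e · c)` on `a`, which vanishes
because `f` already annihilates `a`. -/
theorem psi_mem_ker {a : ⋀[K]^3 M} (ha : a ∈ spGr g.flip f e 0) (c : ⋀[K]^3 N) :
    g (psi g e a.1 c.1) f = 0 := by
  have h0 := contr_eq_zero_of_mem_spGr (g := g.flip) hef ha
  have h : contr g.flip (ExteriorAlgebra.ι K f) (ExteriorAlgebra.ι K (psi g e a.1 c.1)) = 0 := by
    rw [ι_psi a.2 c.2, ← contr_ι_mul, contr_ι_mul_eq_zero h0]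
  rw [contr_ι_ι] at h
  exact (ExteriorAlgebra.algebraMap_eq_zero_iff M _).1 h

/-- Since `c = f ∧ (e · c)`, contracting `c` by `v` gives `g(v, f)(e · c)` minus a multiple of `f`,
and multiples of `f` annihilate `a`. -/
theorem eOp_flip_eq {a : ⋀[K]^3 M} (ha : a ∈ spGr g.flip f e 0) {c : ⋀[K]^3 N}
    (hc : c ∈ spGr g e f 1) :
    eOp g.flip a.1 c.1 = (g.flip f).smulRight (psi g e a.1 c.1) := by
  have h0 := contr_eq_zero_of_mem_spGr (g := g.flip) hef ha
  ext v
  rw [← ExteriorAlgebra.ι_inj K, ι_eOp g.flip 2 a.2 c.2, LinearMap.smulRight_apply, map_smul,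
    ι_psi a.2 c.2]
  have h1 : contr g (ExteriorAlgebra.ι K v) c.1 =
      g v f • contr g (ExteriorAlgebra.ι K e) c.1 - ExteriorAlgebra.ι K f *
        contr g (ExteriorAlgebra.ι K v) (contr g (ExteriorAlgebra.ι K e) c.1) := by
    conv_lhs => rw [← ι_mul_contr_of_mem_spGr hef hc, contr_ι_ι_mul]
  change contr g.flip (contr g (ExteriorAlgebra.ι K v) c.1) a.1 = _
  rw [h1, map_sub, LinearMap.sub_apply, contr_ι_mul_eq_zero h0, sub_zero, map_smul]
  rfl

theorem contr_flip_eq_zero {a : ⋀[K]^3 M} (ha : a ∈ spGr g.flip f e 0) {c : ⋀[K]^3 N}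
    (hc : c ∈ spGr g e f 1) : contr g.flip c.1 a.1 = 0 := by
  rw [← ι_mul_contr_of_mem_spGr hef hc]
  exact contr_ι_mul_eq_zero (contr_eq_zero_of_mem_spGr (g := g.flip) hef ha) _

/-- The scalar `a · c` is zero because `c` is a multiple of `f`; what remains is the derivation
extending a rank-one operator. -/
theorem prod_flip_eq {a : ⋀[K]^3 M} (ha : a ∈ spGr g.flip f e 0) {c : ⋀[K]^3 N}
    (hc : c ∈ spGr g e f 1) (b : ⋀[K]^3 M) : (prod g.flip a c b : ExteriorAlgebra K M) =
      ExteriorAlgebra.ι K (psi g e a.1 c.1) * contr g.flip (ExteriorAlgebra.ι K f) b.1 := by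
  have h : dot g.flip.flip a.1 c.1 = 0 := by
    rw [← dot_comm g.flip 3 c.2 a.2, dot_apply, contr_flip_eq_zero hef ha hc, map_zero]
  rw [coe_prod, h, zero_smul, sub_zero, eOp_flip_eq hef ha hc]
  exact der_rankOne g.flip f _ _

/-- `E(c, a)` is the transpose of `E(a, c)`, and the transpose of `v ↦ g(v, f) ψ` is `n ↦ g(ψ, n)
f`. -/
theorem prod_eq (hg : g.IsPerfPair) {a : ⋀[K]^3 M} (ha : a ∈ spGr g.flip f e 0) {c : ⋀[K]^3 N}
    (hc : c ∈ spGr g e f 1) (b : ⋀[K]^3 N) : (prod g c a b : ExteriorAlgebra K N) =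
      ExteriorAlgebra.ι K f * contr g (ExteriorAlgebra.ι K (psi g e a.1 c.1)) b.1 := by
  have h : dot g.flip c.1 a.1 = 0 := by
    rw [dot_apply, contr_flip_eq_zero hef ha hc, map_zero]
  have h1 : eOp g c.1 a.1 = (g (psi g e a.1 c.1)).smulRight f := by
    ext n
    apply hg.bijective_right.1
    ext m
    rw [LinearMap.flip_apply, ← eOp_adjoint g 2 c.2 a.2, eOp_flip_eq hef ha hc]
    simp [mul_comm]
  rw [coe_prod, h, zero_smul, sub_zero, h1, der_rankOne]

/-- Both factors are multiples of `f`. -/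
theorem mul_eq_zero_of_mem_spGr_one {x z : ⋀[K]^3 N} (hx : x ∈ spGr g e f 1)
    (hz : z ∈ spGr g e f 1) : x.1 * z.1 = 0 := by
  rw [← ι_mul_contr_of_mem_spGr hef hx, ← ι_mul_contr_of_mem_spGr hef hz, mul_assoc,
    ← mul_assoc (contr g _ _), mul_ι_of_mem_two (contr_ι_mem g e 2 x.2), ← mul_assoc, ← mul_assoc,
    ExteriorAlgebra.ι_sq_zero, zero_mul, zero_mul]

/-- The product `xz` lies in `⋀⁶(U)`, which is zero: `f ∧ xz` has degree `7`, so it vanishes, and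
contracting it by `e` gives back `xz`. -/
theorem mul_eq_zero_of_mem_spGr_zero (h7 : ∀ x ∈ ⋀[K]^7 N, x = 0) {x z : ⋀[K]^3 N}
    (hx : x ∈ spGr g e f 0) (hz : z ∈ spGr g e f 0) : x.1 * z.1 = 0 := by
  have h := contr_ι_ι_mul g e f (x.1 * z.1)
  rw [h7 _ (ι_mul_mem f (mul_mem x.2 z.2)), contr_ι_mul_of_mem g e x.2,
    contr_eq_zero_of_mem_spGr hef hx, contr_eq_zero_of_mem_spGr hef hz, hef] at h
  simpa using h.symm

-- The difference of the two sides is, up to sign, the contraction of `xz` by `y`.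
omit hef in
theorem prod_eq_prod_of_mul_eq_zero {x z : ⋀[K]^3 N} (h : x.1 * z.1 = 0) (y : ⋀[K]^3 M) :
    prod g x y z = prod g z y x := by
  have h1 := contr_mul_eq g x.2 z.2 y.2
  rw [h, map_zero] at h1
  exact Subtype.ext (sub_eq_zero.1 h1.symm).symm

variable (g e f) in
omit hef in
/-- The operators `K(a, c)` of the reflection, parametrized by `U⁻`. -/
def reflOp : LinearMap.ker (g.flip f) →ₗ[K] (spGr g e f 0 × spGr g.flip f e 1) →ₗ[K]
    ExteriorAlgebra K M × ExteriorAlgebra K N :=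
  LinearMap.mk₂ K (fun p b => (ExteriorAlgebra.ι K p.1 * contr g.flip (ExteriorAlgebra.ι K f) b.2.1.1,
      -(ExteriorAlgebra.ι K f * contr g (ExteriorAlgebra.ι K p.1) b.1.1.1)))
    (fun p q b => by simp [add_mul, mul_add]; abel) (fun r p b => by simp)
    (fun p b c => by simp [mul_add]; abel) (fun r p b => by simp)

/-- If `p` acts as zero, it contracts `⋀³(U⁺)` to zero. The double contractions of `⋀³(U⁺)` yield
`12` times any vector of `U⁺`, and contractions anticommute, so `g p` vanishes on `U⁺`. It vanishes
on `f` because `p` is in `U⁻`; hence `p = 0`. -/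
theorem reflOp_injective [Module.Finite K N] [Module.Projective K N] (hg : g.IsPerfPair)
    (hn : ∀ p, Module.rankAtStalk (R := K) N p = 6) (h6 : IsUnit (6 : K)) :
    Function.Injective (reflOp g e f) := by
  have h12 : IsUnit (12 : K) := by
    have h2 : IsUnit (2 : K) := isUnit_of_dvd_unit ⟨3, by norm_num⟩ h6
    have := h6.mul h2
    norm_num at this
    exact this
  rw [injective_iff_map_eq_zero]
  intro p hp
  have hpf : g p.1 f = 0 := p.2
  have h0 : ∀ b ∈ ⋀[K]^3 N, contr g (ExteriorAlgebra.ι K e) b = 0 →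
      contr g (ExteriorAlgebra.ι K p.1) b = 0 := by
    intro b hb hbe
    have h1 := congrArg Prod.snd (LinearMap.congr_fun hp
      (⟨⟨b, hb⟩, mem_spGr_zero hef hbe⟩, 0))
    have h2 : ExteriorAlgebra.ι K f * contr g (ExteriorAlgebra.ι K p.1) b = 0 := neg_eq_zero.1 h1
    -- Contracting by `e` cancels the factor `f`, as `e` annihilates `p · b`.
    have h3 := contr_ι_ι_mul g e f (contr g (ExteriorAlgebra.ι K p.1) b)
    rw [h2, contr_ι_comm, hbe, hef] at h3
    simpa using h3.symm
  obtain ⟨s, a, b, ha, hb, h⟩ := exists_dual_basis_ker_two hg hn hef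
  have hker : ∀ n, g e n = 0 → g p.1 n = 0 := by
    intro n hn
    have h1 := congrArg (contr g (ExteriorAlgebra.ι K p.1)) (h n hn)
    rw [map_sum, Finset.sum_eq_zero, map_smul, contr_ι_ι] at h1
    · exact (ExteriorAlgebra.algebraMap_eq_zero_iff N _).1 (h12.smul_eq_zero.1 h1.symm)
    · intro i _
      rw [map_sum, Finset.sum_eq_zero]
      intro j _
      have he : contr g (ExteriorAlgebra.ι K e) (ExteriorAlgebra.ι K n) = 0 := by
        rw [contr_ι_ι, hn, map_zero]
      rw [contr_ι_comm g p.1, contr_ι_comm g p.1 (a j), h0, map_zero, neg_zero, map_zero, neg_zero]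
      · exact ι_mul_mem _ (ι_mul_mem _ (mem_one_iff.2 ⟨_, rfl⟩))
      · exact contr_ι_ι_mul_eq_zero (hb j) (contr_ι_ι_mul_eq_zero (hb i) he)
  refine Subtype.ext (hg.bijective_left.1 (LinearMap.ext fun n => ?_))
  -- `n - g(e, n) f` is the component of `n` in `U⁺`.
  have h1 := hker (n - g e n • f) (by simp [hef])
  simpa [hpf] using h1

/-- The element of `U⁻` attached to a pair of elements of the reflection. -/
def reflPsi (x : (spGr g.flip f e 0 × spGr g e f 1) × (spGr g.flip f e 0 × spGr g e f 1)) :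
    LinearMap.ker (g.flip f) :=
  ⟨psi g e x.1.1.1.1 x.2.2.1.1 - psi g e x.2.1.1.1 x.1.2.1.1,
    sub_mem (psi_mem_ker hef x.1.1.2 x.2.2.1) (psi_mem_ker hef x.2.1.2 x.1.2.1)⟩

theorem span_reflPsi [Module.Finite K M] [Module.Projective K M] (hg : g.IsPerfPair)
    (hm : ∀ p, Module.rankAtStalk (R := K) M p = 6) (h6 : IsUnit (6 : K)) :
    Submodule.span K (Set.range (reflPsi hef)) = ⊤ := by
  have h12 : IsUnit (12 : K) := by
    have h2 : IsUnit (2 : K) := isUnit_of_dvd_unit ⟨3, by norm_num⟩ h6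
    have := h6.mul h2
    norm_num at this
    exact this
  obtain ⟨s, a, b, ha, hb, h⟩ := exists_dual_basis_ker_two (g := g.flip) hg.flip hm hef
  rw [eq_top_iff]
  rintro ⟨m, hm⟩ -
  have hmf : contr g.flip (ExteriorAlgebra.ι K f) (ExteriorAlgebra.ι K m) = 0 := by
    rw [contr_ι_ι, LinearMap.mem_ker.1 hm, map_zero]
  have hA : ∀ p q, ExteriorAlgebra.ι K (b q) *
      (ExteriorAlgebra.ι K (b p) * ExteriorAlgebra.ι K m) ∈ ⋀[K]^3 M := fun p q =>
    ι_mul_mem _ (ι_mul_mem _ (mem_one_iff.2 ⟨_, rfl⟩))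
  have hA' : ∀ p q, (⟨_, hA p q⟩ : ⋀[K]^3 M) ∈ spGr g.flip f e 0 := fun p q =>
    mem_spGr_zero (g := g.flip) hef
      (contr_ι_ι_mul_eq_zero (hb q) (contr_ι_ι_mul_eq_zero (hb p) hmf))
  have hC : ∀ p q, ExteriorAlgebra.ι K (a p) * ExteriorAlgebra.ι K (a q) ∈ ⋀[K]^2 N := fun p q =>
    ι_mul_mem _ (mem_one_iff.2 ⟨_, rfl⟩)
  have hCe : ∀ p q, contr g (ExteriorAlgebra.ι K e)
      (ExteriorAlgebra.ι K (a p) * ExteriorAlgebra.ι K (a q)) = 0 := fun p q =>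
    contr_ι_ι_mul_eq_zero (g := g) (e := e) (ha p)
      ((contr_ι_ι e (a q)).trans ((congrArg _ (ha q)).trans (map_zero _)))
  -- For `c = f ∧ a_p ∧ a_q` one has `e · c = a_p ∧ a_q`, so `ψ(b_q ∧ b_p ∧ m, c)` is exactly a term
  -- of the double sum equal to `12 m`.
  have hsum : (12 : K) • (⟨m, hm⟩ : LinearMap.ker (g.flip f)) =
      ∑ p ∈ s, ∑ q ∈ s, reflPsi hef ((⟨_, hA' p q⟩, 0), (0, ⟨_, mem_spGr_one hef (hC p q) (hCe p q)⟩)) := by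
    apply Subtype.ext
    rw [← ExteriorAlgebra.ι_inj K]
    simp only [Submodule.coe_sum, Submodule.coe_smul, map_sum, map_smul]
    rw [← h m hm]
    refine Finset.sum_congr rfl fun p _ => Finset.sum_congr rfl fun q _ => ?_
    simp only [reflPsi, ZeroMemClass.coe_zero, map_zero, sub_zero]
    rw [ι_psi (hA p q) (ι_mul_mem f (hC p q)), contr_ι_ι_mul g e f, hef, hCe, mul_zero, sub_zero, one_smul,
      contr_ι_mul]
  obtain ⟨c, hc⟩ := h12.exists_left_inv
  rw [← one_smul K (⟨m, hm⟩ : LinearMap.ker (g.flip f)), ← hc, mul_smul, hsum]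
  exact Submodule.smul_mem _ _ (sum_mem fun p _ => sum_mem fun q _ => Submodule.subset_span ⟨_, rfl⟩)

/-- In `K(a, c) b` the terms `{b, ·, ·}` of the two reflected products cancel, and the pure terms
`{a₁, b₁, c₁}` and `{a₂, b₂, c₂}` are symmetric in `a` and `c` because the corresponding wedge
products vanish. What survives is `{a₁, c₂, b₂} - {c₁, a₂, b₂}` in degree `0` and `{a₂, c₁, b₁} -
{c₂, a₁, b₁}` in degree `1`, and these depend only on `ψ(a₁, c₂) - ψ(c₁, a₂)`. -/
theorem reflProd_sub_reflProd (hg : g.IsPerfPair) (h7 : ∀ x ∈ ⋀[K]^7 M, x = 0)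
    (hf : ∀ i k l, ∀ x ∈ spGr g e f i, ∀ y ∈ spGr g.flip f e k, ∀ z ∈ spGr g e f l,
      prod g x y z ∈ spGr g e f (i - k + l))
    (hh : ∀ i k l, ∀ x ∈ spGr g.flip f e i, ∀ y ∈ spGr g e f k, ∀ z ∈ spGr g.flip f e l,
      prod g.flip x y z ∈ spGr g.flip f e (i - k + l))
    (a c : spGr g.flip f e 0 × spGr g e f 1) (b : spGr g e f 0 × spGr g.flip f e 1) :
    LinearMap.prodMap ((⋀[K]^3 M).subtype ∘ₗ (spGr g.flip f e 0).subtype)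
      ((⋀[K]^3 N).subtype ∘ₗ (spGr g e f 1).subtype)
      (reflProd (prod g) (prod g.flip) (spGr g e f) (spGr g.flip f e) hf hh a b c -
        reflProd (prod g) (prod g.flip) (spGr g e f) (spGr g.flip f e) hf hh c b a) =
      reflOp g e f (reflPsi hef (a, c)) b := by
  obtain ⟨⟨a₁, ha₁⟩, ⟨a₂, ha₂⟩⟩ := a
  obtain ⟨⟨c₁, hc₁⟩, ⟨c₂, hc₂⟩⟩ := c
  obtain ⟨⟨b₁, hb₁⟩, ⟨b₂, hb₂⟩⟩ := b
  have h1 : prod g.flip a₁ b₁ c₁ = prod g.flip c₁ b₁ a₁ := prod_eq_prod_of_mul_eq_zero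
    (mul_eq_zero_of_mem_spGr_zero (g := g.flip) hef h7 ha₁ hc₁) b₁
  have h2 : prod g a₂ b₂ c₂ = prod g c₂ b₂ a₂ := prod_eq_prod_of_mul_eq_zero
    (mul_eq_zero_of_mem_spGr_one hef ha₂ hc₂) b₂
  have h3 := prod_flip_eq hef ha₁ hc₂ b₂
  have h4 := prod_flip_eq hef hc₁ ha₂ b₂
  have h5 := prod_eq hef hg hc₁ ha₂ b₁
  have h6 := prod_eq hef hg ha₁ hc₂ b₁
  refine Prod.ext ?_ ?_
  · change ((prod g.flip a₁ b₁ c₁ - prod g.flip b₂ a₂ c₁ +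
        (prod g.flip a₁ c₂ b₂ - prod g.flip b₂ c₂ a₁) -
      (prod g.flip c₁ b₁ a₁ - prod g.flip b₂ c₂ a₁ +
        (prod g.flip c₁ a₂ b₂ - prod g.flip b₂ a₂ c₁)) : ⋀[K]^3 M) : ExteriorAlgebra K M) =
      ExteriorAlgebra.ι K (psi g e a₁.1 c₂.1 - psi g e c₁.1 a₂.1) *
        contr g.flip (ExteriorAlgebra.ι K f) b₂.1
    rw [map_sub, sub_mul, ← h3, ← h4, h1, ← Submodule.coe_sub]
    congr 1
    abel
  · change ((prod g a₂ b₂ c₂ - prod g b₁ a₁ c₂ + (prod g a₂ c₁ b₁ - prod g b₁ c₁ a₂) -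
      (prod g c₂ b₂ a₂ - prod g b₁ c₁ a₂ + (prod g c₂ a₁ b₁ - prod g b₁ a₁ c₂)) : ⋀[K]^3 N) :
        ExteriorAlgebra K N) =
      -(ExteriorAlgebra.ι K f *
        contr g (ExteriorAlgebra.ι K (psi g e a₁.1 c₂.1 - psi g e c₁.1 a₂.1)) b₁.1)
    rw [map_sub, map_sub, LinearMap.sub_apply, mul_sub, ← h5, ← h6, h2, neg_sub,
      ← Submodule.coe_sub]
    congr 1
    abel

end Reflection

end ExtPair

namespace ExtQuad

open ExtPair TrilinearPair

variable {K : Type u} [CommRing K]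

/-- The module `kSpan` of the reflection of `⋀₃` is `U⁻`. -/
noncomputable def kSpanReflectionEquiv (h6 : IsUnit (6 : K)) (Q : ExtQuad.{u, v} K)
    (h7 : ∀ x ∈ ⋀[K]^7 Q.Mneg, x = 0) :
    kSpan (Q.lambda3Reflection h6).prodPos ≃ₗ[K] LinearMap.ker (Q.g.flip Q.epos) :=
  kSpanEquivOfRange _ (LinearMap.prodMap
      ((⋀[K]^3 Q.Mneg).subtype ∘ₗ (spGr Q.g.flip Q.epos Q.eneg 0).subtype)
      ((⋀[K]^3 Q.Mpos).subtype ∘ₗ (spGr Q.g Q.eneg Q.epos 1).subtype))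
    ((Subtype.val_injective.comp Subtype.val_injective).prodMap
      (Subtype.val_injective.comp Subtype.val_injective))
    (reflOp Q.g Q.eneg Q.epos) (reflOp_injective Q.g_e Q.perf Q.rank_pos h6)
    (reflPsi Q.g_e) (span_reflPsi Q.g_e Q.perf Q.rank_neg h6)
    (reflProd_sub_reflProd Q.g_e Q.perf h7 (prod_mem Q.g_e h6)
      (prod_mem (g := Q.g.flip) Q.g_e h6))

end ExtQuad

namespace ExtPair

variable {K : Type u} [CommRing K]

/-! ### Splitting off a free summand. -/

section Split

variable {M : Type v} [AddCommGroup M] [Module K M]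

/-- The splitting `M = K m ⊕ ker d` for `d(m) = 1`. -/
noncomputable def splitEquiv (d : Module.Dual K M) (m : M) (h : d m = 1) :
    M ≃ₗ[K] K × LinearMap.ker d :=
  LinearEquiv.ofLinearMap
    (d.prod ((LinearMap.id - d.smulRight m).codRestrict (LinearMap.ker d) fun x => by simp [h]))
    ((LinearMap.toSpanSingleton K M m).coprod (LinearMap.ker d).subtype)
    (LinearMap.ext fun x => by
      obtain ⟨r, x, hx⟩ := x
      have hx' : d x = 0 := hx
      refine Prod.ext ?_ (Subtype.ext ?_) <;> simp [h, hx'])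
    (LinearMap.ext fun x => by simp)

theorem finite_ker [Module.Finite K M] {d : Module.Dual K M} {m : M} (h : d m = 1) :
    Module.Finite K (LinearMap.ker d) :=
  Module.Finite.of_surjective (LinearMap.snd K K (LinearMap.ker d) ∘ₗ (splitEquiv d m h).toLinearMap)
    (Prod.snd_surjective.comp (splitEquiv d m h).surjective)

theorem projective_ker [Module.Projective K M] {d : Module.Dual K M} {m : M} (h : d m = 1) :
    Module.Projective K (LinearMap.ker d) := by
  let i : LinearMap.ker d →ₗ[K] M :=
    (splitEquiv d m h).symm.toLinearMap ∘ₗ LinearMap.inr K K (LinearMap.ker d)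
  let s : M →ₗ[K] LinearMap.ker d :=
    LinearMap.snd K K (LinearMap.ker d) ∘ₗ (splitEquiv d m h).toLinearMap
  exact Module.Projective.of_split i s (LinearMap.ext fun x => by simp [i, s])

theorem rank_ker [Module.Finite K M] [Module.Projective K M] {d : Module.Dual K M} {m : M}
    (h : d m = 1) {n : ℕ} (hn : ∀ p, Module.rankAtStalk (R := K) M p = n + 1) (p : PrimeSpectrum K) :
    Module.rankAtStalk (R := K) (LinearMap.ker d) p = n := by
  have := finite_ker h
  have := projective_ker h
  have : Nontrivial K := p.nontrivial
  have h1 := hn p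
  rw [Module.rankAtStalk_eq_of_equiv (splitEquiv d m h), Module.rankAtStalk_prod,
    Module.rankAtStalk_self, Pi.add_apply, Pi.one_apply] at h1
  omega

end Split

/-! ### Steinitz' theorem over a Dedekind domain. -/

section Dedekind

variable [IsDedekindDomain K] {M : Type v} [AddCommGroup M] [Module K M] [Module.Finite K M]
  [Module.Projective K M]

theorem projective_ideal (J : Ideal K) : Module.Projective K J := by
  have : Module.FinitePresentation K J := Module.finitePresentation_of_finite K J
  exact Module.Flat.projective_of_finitePresentation

/-- A projective module of rank at least two over a Dedekind domain has a direct summand `K`. -/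
theorem exists_dual_apply_eq_one {n : ℕ}
    (hn : ∀ p, Module.rankAtStalk (R := K) M p = n + 2) :
    ∃ (d : Module.Dual K M) (m : M), d m = 1 := by
  have hfin : Module.finrank K M = n + 2 := by
    rw [← hn ⟨⊥, Ideal.isPrime_bot⟩, ← Ideal.finrank_fiber_eq_rankAtStalk,
      Ideal.finrank_fiber_eq_finrank]
  have : Nontrivial M := Module.nontrivial_of_finrank_pos (R := K) (by omega)
  obtain ⟨x, hx⟩ := exists_ne (0 : M)
  obtain ⟨d₁, hd₁⟩ := Module.Projective.exists_dual_ne_zero K hx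
  -- Rank at least two forces a kernel of `d₁`. The image `J` of `d₁` is projective, so `M` is the
  -- direct sum of `ker d₁` and a copy `s(J)` of `J`. The form sought is `d₁` on `s(J)` and a
  -- suitable multiple of `d₂` on `ker d₁`.
  have hinj : ¬ Function.Injective d₁ := fun h => by
    have := LinearMap.finrank_le_finrank_of_injective h
    rw [hfin, Module.finrank_self] at this
    omega
  rw [← LinearMap.ker_eq_bot, Submodule.eq_bot_iff] at hinj
  push Not at hinj
  obtain ⟨y, hy, hy0⟩ := hinj
  obtain ⟨d₂, hd₂⟩ := Module.Projective.exists_dual_ne_zero K hy0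
  let J : Ideal K := LinearMap.range d₁
  let J' : Ideal K := (LinearMap.ker d₁).map d₂
  have hJ : J ≠ 0 := fun h => hd₁ ((Submodule.eq_bot_iff _).1 h _ ⟨x, rfl⟩)
  have := projective_ideal J
  obtain ⟨s, hs⟩ := Module.projective_lifting_property d₁.rangeRestrict
    (LinearMap.id : J →ₗ[K] J) d₁.surjective_rangeRestrict
  have hs' : ∀ j : J, d₁ (s j) = j := fun j => congrArg Subtype.val (LinearMap.congr_fun hs j)
  -- `L` complements `J'` in the sense that `J' L = (d₂ y)`. So `b d₂ / d₂(y)` takes values in `K`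
  -- on `ker d₁` for every `b` in `L`; this will be `D`.
  obtain ⟨L, hL⟩ := Ideal.dvd_iff_le.2 ((Ideal.span_singleton_le_iff_mem J').2 ⟨y, hy, rfl⟩)
  have hc0 : Ideal.span {d₂ y} ≠ 0 := by simpa using hd₂
  have hL0 : L ≠ 0 := fun h => hc0 (by rw [hL, h, mul_zero])
  -- Choosing `b` with `L J + (b) = L` and multiplying by `J'` gives `(d₂ y) = (d₂ y) J + b J'`.
  -- Dividing an expression of `d₂ y` by `d₂ y` produces `j` in `J` and `l` in `ker d₁` with `j +
  -- D(l) = 1`.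
  obtain ⟨b, hb⟩ := IsDedekindDomain.exists_sup_span_eq (Ideal.mul_le_left : L * J ≤ L)
    (mul_ne_zero hL0 hJ)
  have hdvd : ∀ l ∈ LinearMap.ker d₁, ∃ k, d₂ y * k = b * d₂ l := by
    intro l hl
    have h1 : d₂ l * b ∈ J' * L := Ideal.mul_mem_mul ⟨l, hl, rfl⟩
      (hb ▸ Ideal.mem_sup_right (Ideal.mem_span_singleton_self b))
    rw [← hL] at h1
    obtain ⟨k, hk⟩ := Ideal.mem_span_singleton'.1 h1
    exact ⟨k, by rw [mul_comm, hk, mul_comm]⟩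
  choose δ hδ using fun l : LinearMap.ker d₁ => hdvd l.1 l.2
  let D : LinearMap.ker d₁ →ₗ[K] K :=
    { toFun := δ
      map_add' := fun l l' => mul_left_cancel₀ hd₂ (by simp [mul_add, hδ])
      map_smul' := fun r l => mul_left_cancel₀ hd₂ (by simp [hδ, mul_left_comm]) }
  have hmem : d₂ y ∈ J' * (L * J ⊔ Ideal.span {b}) := by
    rw [hb, ← hL]
    exact Ideal.mem_span_singleton_self _
  rw [Ideal.mul_sup, ← mul_assoc, ← hL] at hmem
  obtain ⟨p, hp, q, hq, hpq⟩ := Submodule.mem_sup.1 hmem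
  obtain ⟨j, hj, rfl⟩ := Ideal.mem_span_singleton_mul.1 hp
  rw [mul_comm] at hq
  obtain ⟨_, ⟨l, hl, rfl⟩, rfl⟩ := Ideal.mem_span_singleton_mul.1 hq
  have hker : ∀ m, ((LinearMap.id : M →ₗ[K] M) - s ∘ₗ d₁.rangeRestrict) m ∈ LinearMap.ker d₁ :=
    fun m => by simp [hs']
  refine ⟨d₁ + D ∘ₗ (LinearMap.id - s ∘ₗ d₁.rangeRestrict).codRestrict (LinearMap.ker d₁) hker,
    s ⟨j, hj⟩ + l, ?_⟩
  · have hl' : d₁ l = 0 := hl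
    have h1 : (LinearMap.id - s ∘ₗ d₁.rangeRestrict).codRestrict (LinearMap.ker d₁)
        hker (s ⟨j, hj⟩ + l) = ⟨l, hl⟩ := by
      have h2 : d₁.rangeRestrict (s ⟨j, hj⟩ + l) = ⟨j, hj⟩ := Subtype.ext (by simp [hs', hl'])
      refine Subtype.ext ?_
      change s ⟨j, hj⟩ + l - s (d₁.rangeRestrict (s ⟨j, hj⟩ + l)) = l
      rw [h2, add_sub_cancel_left]
    rw [LinearMap.add_apply, LinearMap.comp_apply, h1, map_add, hs', hl', add_zero]
    apply mul_left_cancel₀ hd₂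
    change d₂ y * (j + δ ⟨l, hl⟩) = _
    rw [mul_add, hδ, hpq, mul_one]

/-- Steinitz' theorem. -/
theorem exists_equiv_free_prod (n : ℕ) {M : Type u} [AddCommGroup M] [Module K M]
    [Module.Finite K M] [Module.Projective K M]
    (hn : ∀ p, Module.rankAtStalk (R := K) M p = n + 1) :
    ∃ I : CommRing.Pic K, Nonempty (M ≃ₗ[K] (Fin n → K) × I) := by
  induction n generalizing M with
  | zero =>
    have := invertible_of_rank_one hn
    exact ⟨CommRing.Pic.mk K M, ⟨(CommRing.Pic.mk.linearEquiv K M).symm ≪≫ₗ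
      (LinearEquiv.uniqueProd (R := K) (M₂ := Fin 0 → K)).symm⟩⟩
  | succ n ih =>
    obtain ⟨d, m, h⟩ := exists_dual_apply_eq_one (n := n) hn
    have := finite_ker h
    have := projective_ker h
    obtain ⟨I, ⟨f⟩⟩ := ih (rank_ker h hn)
    exact ⟨I, ⟨splitEquiv d m h ≪≫ₗ LinearEquiv.prodCongr (LinearEquiv.refl K K) f ≪≫ₗ
      (LinearEquiv.prodAssoc K K (Fin n → K) I).symm ≪≫ₗ
      LinearEquiv.prodCongr (Fin.consLinearEquiv K fun _ => K) (LinearEquiv.refl K I)⟩⟩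

end Dedekind
end ExtPair

/-! ### Recovering `I`, and the classification. -/

section Classification

open ExtPair TrilinearPair

variable {K : Type u} [CommRing K]

namespace ExtPair

/-- A perfect pairing is isomorphic to the canonical pairing. -/
noncomputable def PairingEquiv.toDual {M : Type v} {N : Type w} {N' : Type w'} [AddCommGroup M]
    [AddCommGroup N] [AddCommGroup N'] [Module K M] [Module K N] [Module K N']
    {g : M →ₗ[K] N →ₗ[K] K} (hg : g.IsPerfPair) (f : N ≃ₗ[K] N') :
    PairingEquiv g (LinearMap.id : Module.Dual K N' →ₗ[K] N' →ₗ[K] K) where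
  left := LinearEquiv.ofBijective g hg.bijective_left ≪≫ₗ f.symm.dualMap
  right := f
  map_apply m n := by simp

/-- The component `⋀⁶(N)` of the 5-graded Lie algebra. -/
def topComponentEquiv {M : Type v} {N : Type w} [AddCommGroup M] [AddCommGroup N] [Module K M]
    [Module K N] [Module.Finite K N] [Module.Projective K N] (g : M →ₗ[K] N →ₗ[K] K) :
    sub5 g ⊥ ⊥ ⊥ ⊥ ⊤ ≃ₗ[K] ⋀[K]^6 N where
  toFun x := x.1.2.2.2.2
  invFun y := ⟨(0, 0, 0, 0, y), rfl, rfl, rfl, rfl, trivial⟩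
  map_add' _ _ := rfl
  map_smul' _ _ := rfl
  left_inv x := Subtype.ext <| Prod.ext x.2.1.symm <| Prod.ext x.2.2.1.symm <|
    Prod.ext x.2.2.2.1.symm <| Prod.ext x.2.2.2.2.1.symm rfl
  right_inv _ := rfl

end ExtPair

section Standard

variable {I : Type v} {I' : Type w} [AddCommGroup I] [AddCommGroup I'] [Module K I] [Module K I']
  [Module.Finite K I] [Module.Finite K I'] [Module.Projective K I] [Module.Projective K I']
  (hI : ∀ p, Module.rankAtStalk (R := K) I p = 1) (hI' : ∀ p, Module.rankAtStalk (R := K) I' p = 1)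

include hI in
theorem hasTopPower_of_rank_one : HasTopPower K ((Fin 5 → K) × I) 6 I :=
  have := invertible_of_rank_one hI
  hasTopPower_free_prod 5 I

include hI hI' in
theorem nonempty_equiv_of_exteriorPower
    (e : ⋀[K]^6 ((Fin 5 → K) × I) ≃ₗ[K] ⋀[K]^6 ((Fin 5 → K) × I')) : Nonempty (I ≃ₗ[K] I') := by
  obtain ⟨f⟩ := (hasTopPower_of_rank_one hI).2
  obtain ⟨f'⟩ := (hasTopPower_of_rank_one hI').2
  exact ⟨f.symm ≪≫ₗ e ≪≫ₗ f'⟩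

theorem nonempty_equiv_of_lambda3
    (e : TrilinearPair.Iso (tripleOf K I hI).lambda3 (tripleOf K I' hI').lambda3) :
    Nonempty (I ≃ₗ[K] I') :=
  nonempty_equiv_of_exteriorPower hI hI' ((kSpanEquiv (tripleOf K I hI).perf).symm ≪≫ₗ
    e.kSpanEquiv ≪≫ₗ kSpanEquiv (tripleOf K I' hI').perf)

theorem nonempty_equiv_of_lie
    (e : GradedAlg.Iso (tripleOf K I hI).lie (tripleOf K I' hI').lie) :
    Nonempty (I ≃ₗ[K] I') :=
  nonempty_equiv_of_exteriorPower hI hI' ((topComponentEquiv (tripleOf K I hI).g).symm ≪≫ₗ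
    SPGradedPair.componentEquiv e.equiv (e.map_component 2) ≪≫ₗ
      topComponentEquiv (tripleOf K I' hI').g)

theorem nonempty_equiv_of_quad_lie
    (e : GradedAlg.Iso (quadOf K I hI).lie (quadOf K I' hI').lie) :
    Nonempty (I ≃ₗ[K] I') :=
  nonempty_equiv_of_exteriorPower hI hI' ((topComponentEquiv (tripleOf K I hI).g).symm ≪≫ₗ
    SPGradedPair.componentEquiv e.equiv (e.map_component (2, 1)) ≪≫ₗ
      topComponentEquiv (tripleOf K I' hI').g)

/-- `⋀⁷(M⁺) = 0`, and contraction by `⋀⁷(M⁺)` detects the elements of `⋀⁷(M⁻)`. -/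
theorem exteriorPower_seven_tripleOf : ∀ x ∈ ⋀[K]^7 (tripleOf K I hI).Mneg, x = 0 :=
  fun x hx => eq_zero_of_contr (tripleOf K I hI).perf.flip 7 0 hx fun y hy => by
    have hy0 : y = 0 := (hasTopPower_of_rank_one hI).1 y hy
    rw [hy0, map_zero, LinearMap.zero_apply]

theorem nonempty_equiv_of_reflection (h6 : IsUnit (6 : K))
    (e : TrilinearPair.Iso ((quadOf K I hI).lambda3Reflection h6).toTrilinearPair
      ((quadOf K I' hI').lambda3Reflection h6).toTrilinearPair) : Nonempty (I ≃ₗ[K] I') := by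
  let Q := quadOf K I hI
  let Q' := quadOf K I' hI'
  let f := (Q.kSpanReflectionEquiv h6 (exteriorPower_seven_tripleOf hI)).symm ≪≫ₗ e.kSpanEquiv ≪≫ₗ
    Q'.kSpanReflectionEquiv h6 (exteriorPower_seven_tripleOf hI')
  -- `M_I*` is `K ⊕ U⁻`, so an isomorphism of the modules `U⁻` extends to the duals; biduality then
  -- gives `M_I ≃ M_I'`.
  let f' : Module.Dual K ((Fin 5 → K) × I) ≃ₗ[K] Module.Dual K ((Fin 5 → K) × I') :=
    splitEquiv (Q.g.flip Q.epos) Q.eneg Q.g_e ≪≫ₗ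
      LinearEquiv.prodCongr (LinearEquiv.refl K K) f ≪≫ₗ
        (splitEquiv (Q'.g.flip Q'.epos) Q'.eneg Q'.g_e).symm
  let F : ((Fin 5 → K) × I) ≃ₗ[K] (Fin 5 → K) × I' := Module.evalEquiv K _ ≪≫ₗ
    f'.symm.dualMap ≪≫ₗ (Module.evalEquiv K _).symm
  exact nonempty_equiv_of_exteriorPower hI hI' (powEquiv F 6)

/-- Isomorphic modules of rank one yield isomorphic quadruples. -/
noncomputable def quadOfEquiv (f : I ≃ₗ[K] I') : ExtQuad.Equiv (quadOf K I hI) (quadOf K I' hI') where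
  toPairingEquiv := PairingEquiv.toDual (tripleOf K I hI).perf
    (LinearEquiv.prodCongr (LinearEquiv.refl K (Fin 5 → K)) f)
  map_eneg := LinearMap.ext fun _ => rfl
  map_epos := Prod.ext rfl (map_zero f)

/-- The graded `⋀₃` determines the other three structures by reflecting and forgetting, and either
ungraded pair already determines `I`, from which the graded `⋀₃` is rebuilt. -/
theorem tfae_iso (h6 : IsUnit (6 : K)) : List.TFAE [
    Nonempty (TrilinearPair.Iso ((quadOf K I hI).lambda3Reflection h6).toTrilinearPair
      ((quadOf K I' hI').lambda3Reflection h6).toTrilinearPair),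
    Nonempty (SPGradedPair.Iso ((quadOf K I hI).lambda3Reflection h6)
      ((quadOf K I' hI').lambda3Reflection h6)),
    Nonempty (SPGradedPair.Iso ((quadOf K I hI).lambda3 h6) ((quadOf K I' hI').lambda3 h6)),
    Nonempty (TrilinearPair.Iso (tripleOf K I hI).lambda3 (tripleOf K I' hI').lambda3),
    Nonempty (I ≃ₗ[K] I')] := by
  tfae_have 1 → 5 := fun ⟨e⟩ => nonempty_equiv_of_reflection hI hI' h6 e
  tfae_have 2 → 1 := fun ⟨e⟩ => ⟨e.toIso⟩
  tfae_have 3 → 2 := fun ⟨e⟩ => ⟨SPGradedPair.reflectIso e⟩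
  tfae_have 3 → 4 := fun ⟨e⟩ => ⟨e.toIso⟩
  tfae_have 4 → 5 := fun ⟨e⟩ => nonempty_equiv_of_lambda3 hI hI' e
  tfae_have 5 → 3 := fun ⟨f⟩ => ⟨ExtQuad.lambda3Iso h6 (quadOfEquiv hI hI' f)⟩
  tfae_finish

end Standard

section Dedekind

variable [IsDedekindDomain K]

theorem ExtTriple.exists_pairingEquiv (T : ExtTriple.{u, u} K) :
    ∃ I : CommRing.Pic K, Nonempty (PairingEquiv (tripleOf K I (rank_pic I)).g T.g) := by
  obtain ⟨I, ⟨f⟩⟩ := exists_equiv_free_prod 5 T.rank_pos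
  exact ⟨I, ⟨(PairingEquiv.toDual T.perf f).symm⟩⟩

/-- Steinitz' theorem is applied to `U⁺`, of rank `5`, and not to `M⁺`: then `e⁺` becomes the first
standard vector and `e⁻` the first coordinate. -/
theorem ExtQuad.exists_equiv (Q : ExtQuad.{u, u} K) :
    ∃ I : CommRing.Pic K, Nonempty (ExtQuad.Equiv (quadOf K I (rank_pic I)) Q) := by
  have := finite_ker Q.g_e
  have := projective_ker Q.g_e
  obtain ⟨I, ⟨f⟩⟩ := exists_equiv_free_prod 4 (rank_ker Q.g_e (n := 5) Q.rank_pos)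
  let F : Q.Mpos ≃ₗ[K] (Fin 5 → K) × I := splitEquiv (Q.g Q.eneg) Q.epos Q.g_e ≪≫ₗ
    LinearEquiv.prodCongr (LinearEquiv.refl K K) f ≪≫ₗ
      (LinearEquiv.prodAssoc K K (Fin 4 → K) I).symm ≪≫ₗ
      LinearEquiv.prodCongr (Fin.consLinearEquiv K fun _ => K) (LinearEquiv.refl K I)
  have hF : ∀ n, (F n).1 0 = Q.g Q.eneg n := fun n => rfl
  let φ := PairingEquiv.toDual Q.perf F
  have h0 : F Q.epos = (Pi.single 0 1, 0) := by
    have h2 : splitEquiv (Q.g Q.eneg) Q.epos Q.g_e Q.epos = (1, 0) :=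
      Prod.ext Q.g_e <| Subtype.ext <| by
        change Q.epos - Q.g Q.eneg Q.epos • Q.epos = 0
        rw [Q.g_e, one_smul, sub_self]
    change LinearEquiv.prodCongr (Fin.consLinearEquiv K fun _ => K) (LinearEquiv.refl K I)
      ((LinearEquiv.prodAssoc K K (Fin 4 → K) I).symm
        (LinearEquiv.prodCongr (LinearEquiv.refl K K) f (splitEquiv _ _ Q.g_e Q.epos))) = _
    rw [h2]
    refine Prod.ext (funext fun i => Fin.cases rfl (fun i => ?_) i)
      (show (f 0).2 = 0 by rw [map_zero]; rfl)
    change (f 0).1 i = (Pi.single 0 1 : Fin 5 → K) i.succ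
    rw [map_zero, Pi.single_eq_of_ne (Fin.succ_ne_zero i)]
    rfl
  have h1 : φ.left Q.eneg = LinearMap.proj 0 ∘ₗ LinearMap.fst K (Fin 5 → K) I :=
    LinearMap.ext fun n => by
      obtain ⟨n, rfl⟩ := F.surjective n
      exact (φ.map_apply _ _).trans (hF n).symm
  exact ⟨I, ⟨φ.symm, φ.left.symm_apply_eq.2 h1.symm, φ.right.symm_apply_eq.2 h0.symm⟩⟩

end Dedekind

end Classification

/-- For rank-one modules `I` and `I'` the five isomorphism statements are equivalent; over a
Dedekind domain the six families of structures are parametrized by the Picard group. -/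
theorem mainTheorem11 {K : Type u} [CommRing K] :
    (∀ (h6 : IsUnit (6 : K)) (I : Type v) (I' : Type w) [AddCommGroup I] [AddCommGroup I']
      [Module K I] [Module K I'] [Module.Finite K I] [Module.Finite K I']
      [Module.Projective K I] [Module.Projective K I']
      (hI : ∀ p, Module.rankAtStalk (R := K) I p = 1)
      (hI' : ∀ p, Module.rankAtStalk (R := K) I' p = 1),
      List.TFAE [
        Nonempty (TrilinearPair.Iso ((quadOf K I hI).lambda3Reflection h6).toTrilinearPair
          ((quadOf K I' hI').lambda3Reflection h6).toTrilinearPair),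
        Nonempty (SPGradedPair.Iso ((quadOf K I hI).lambda3Reflection h6)
          ((quadOf K I' hI').lambda3Reflection h6)),
        Nonempty (SPGradedPair.Iso ((quadOf K I hI).lambda3 h6) ((quadOf K I' hI').lambda3 h6)),
        Nonempty (TrilinearPair.Iso (tripleOf K I hI).lambda3 (tripleOf K I' hI').lambda3),
        Nonempty (I ≃ₗ[K] I')]) ∧
    (IsDedekindDomain K →
      (Function.Bijective fun I : CommRing.Pic K =>
        (⟦tripleOf K I (ExtPair.rank_pic I)⟧ :
          Quotient (GradedAlg.isoSetoid.comap (ExtTriple.lie : ExtTriple.{u, u} K → _)))) ∧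
      (Function.Bijective fun I : CommRing.Pic K =>
        (⟦quadOf K I (ExtPair.rank_pic I)⟧ :
          Quotient (GradedAlg.isoSetoid.comap (ExtQuad.lie : ExtQuad.{u, u} K → _)))) ∧
      ∀ h6 : IsUnit (6 : K),
        (Function.Bijective fun I : CommRing.Pic K =>
          (⟦tripleOf K I (ExtPair.rank_pic I)⟧ : Quotient (TrilinearPair.isoSetoid.comap
            (ExtTriple.lambda3 : ExtTriple.{u, u} K → _)))) ∧
        (Function.Bijective fun I : CommRing.Pic K =>
          (⟦quadOf K I (ExtPair.rank_pic I)⟧ : Quotient (SPGradedPair.isoSetoid.comap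
            (ExtQuad.lambda3 h6 : ExtQuad.{u, u} K → _)))) ∧
        (Function.Bijective fun I : CommRing.Pic K =>
          (⟦quadOf K I (ExtPair.rank_pic I)⟧ : Quotient (SPGradedPair.isoSetoid.comap
            (ExtQuad.lambda3Reflection h6 : ExtQuad.{u, u} K → _)))) ∧
        (Function.Bijective fun I : CommRing.Pic K =>
          (⟦quadOf K I (ExtPair.rank_pic I)⟧ : Quotient (TrilinearPair.isoSetoid.comap
            (fun Q : ExtQuad.{u, u} K => (Q.lambda3Reflection h6).toTrilinearPair))))) := by
  refine ⟨fun h6 I I' _ _ _ _ _ _ _ _ hI hI' => tfae_iso hI hI' h6, fun _ => ?_⟩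
  -- Elements of `Pic(K)` are equal once their modules are isomorphic, so each of the six bijections
  -- amounts to recovering `I` from a standard structure and to finding a standard structure in each
  -- class.
  have key : ∀ {S : Type (u + 1)} (s : Setoid S) (F : CommRing.Pic K → S),
      (∀ I J, s.r (F I) (F J) → Nonempty (I ≃ₗ[K] J)) → (∀ x, ∃ I, s.r (F I) x) →
      Function.Bijective fun I => (Quotient.mk s (F I)) := fun s F h1 h2 =>
    ⟨fun I J h => CommRing.Pic.ext_iff.2 (h1 I J (Quotient.exact h)), fun x => by
      obtain ⟨x, rfl⟩ := Quotient.exists_rep x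
      obtain ⟨I, hI⟩ := h2 x
      exact ⟨I, Quotient.sound hI⟩⟩
  refine ⟨key _ _ ?_ ?_, key _ _ ?_ ?_, fun h6 => ⟨key _ _ ?_ ?_, key _ _ ?_ ?_, key _ _ ?_ ?_,
    key _ _ ?_ ?_⟩⟩
  · exact fun I J ⟨e⟩ => nonempty_equiv_of_lie _ _ e
  · exact fun T => T.exists_pairingEquiv.imp fun I ⟨φ⟩ => ⟨ExtTriple.lieIso φ⟩
  · exact fun I J ⟨e⟩ => nonempty_equiv_of_quad_lie _ _ e
  · exact fun Q => Q.exists_equiv.imp fun I ⟨φ⟩ => ⟨ExtQuad.lieIso φ⟩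
  · exact fun I J ⟨e⟩ => nonempty_equiv_of_lambda3 _ _ e
  · exact fun T => T.exists_pairingEquiv.imp fun I ⟨φ⟩ => ⟨ExtTriple.lambda3Iso φ⟩
  · exact fun I J ⟨e⟩ => nonempty_equiv_of_lambda3 (ExtPair.rank_pic I) (ExtPair.rank_pic J) e.toIso
  · exact fun Q => Q.exists_equiv.imp fun I ⟨φ⟩ => ⟨ExtQuad.lambda3Iso h6 φ⟩
  · exact fun I J ⟨e⟩ => nonempty_equiv_of_reflection _ _ h6 e.toIso
  · exact fun Q => Q.exists_equiv.imp fun I ⟨φ⟩ =>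
      ⟨SPGradedPair.reflectIso (ExtQuad.lambda3Iso h6 φ)⟩
  · exact fun I J ⟨e⟩ => nonempty_equiv_of_reflection _ _ h6 e
  · exact fun Q => Q.exists_equiv.imp fun I ⟨φ⟩ =>
      ⟨(SPGradedPair.reflectIso (ExtQuad.lambda3Iso h6 φ)).toIso⟩
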